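/- Let $M$ be a type II$_1$ factor with separable predual and normal, faithful, normalized trace $\tau$, and put $\|x\|_2=\tau(x^*x)^{1/2}$ and $[a,b]=ab-ba$ for $x,a,b\in M$. Let $N\subset M$ be a subfactor (with the same unit) that is irreducible, i.e. $N'\cap M\subset N$, and let $\mathbb{E}_N$ denote the $\tau$-preserving conditional expectation of $M$ onto $N$. Let $\omega$ be a free ultrafilter on $\mathbb{N}$ and assume that $N$ is full, i.e. $N_\omega=N'\cap N^\omega=\mathbb{C}$, where $N^\omega$ is the ultrapower of $(N,\tau|_N)$: whenever $(x_n)\subset N$ is a sequence, bounded in operator norm, with $\lim_{n\to\omega}\|[y,x_n]\|_2=0$ for every $y\in N$, there is $c\in\mathbb{C}$ such that $\lim_{n\to\omega}\|x_n-c1\|_2=0$. Say that $N$ has property gamma relative to $M$ if there is a sequence $(x_n)\subset M$, bounded in operator norm, such that $\|x_n\|_2=1$ and $\mathbb{E}_N(x_n)=0$ for every $n$, and $\|yx_n-x_ny\|_2\to 0$ for every $y\in N$. Then $N$ has property gamma relative to $M$ if and only if, for all $y_1,\ldots,y_m\in N$ and every $\varepsilon>0$, there is a unitary element $u\in M$ such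 that $\mathbb{E}_N(u)=0$ and $\|[y_j,u]\|_2\le\varepsilon$ for $j=1,\ldots,m$. -/

import Mathlib

open Filter Topology
open scoped ComplexOrder

namespace VonNeumannAlgebra

section Defs

variable {H : Type*} [NormedAddCommGroup H] [InnerProductSpace ℂ H] [CompleteSpace H]

/-- A von Neumann algebra is closed under multiplication by complex scalars, so that its
elements form a normed `ℂ`-vector space (with the operator norm). -/
instance instSMulMemClass : SMulMemClass (VonNeumannAlgebra H) ℂ (H →L[ℂ] H) where
  smul_mem {S} c _ hx := S.toStarSubalgebra.smul_mem hx c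

/-- A linear functional on `M` is normal (σ-weakly continuous) if it has the form
`x ↦ ∑ₙ ⟪ξₙ, x ηₙ⟫` with `∑ₙ ‖ξₙ‖² < ∞` and `∑ₙ ‖ηₙ‖² < ∞`. -/
def IsNormal {M : VonNeumannAlgebra H} (φ : M →ₗ[ℂ] ℂ) : Prop :=
  ∃ ξ η : ℕ → H, Summable (fun n => ‖ξ n‖ ^ 2) ∧ Summable (fun n => ‖η n‖ ^ 2) ∧
    ∀ x : M, HasSum (fun n => inner ℂ (ξ n) ((x : H →L[ℂ] H) (η n))) (φ x)

/-- The predual of `M`: the set of normal functionals, inside the Banach space dual of `M`. -/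
def predual (M : VonNeumannAlgebra H) : Set (StrongDual ℂ M) :=
  {φ | IsNormal (φ : M →ₗ[ℂ] ℂ)}

/-- `M` has separable predual (for the norm of the dual of `M`). -/
def HasSeparablePredual (M : VonNeumannAlgebra H) : Prop :=
  TopologicalSpace.IsSeparable M.predual

/-- `M` is a factor: its centre consists of the scalars. -/
def IsFactor (M : VonNeumannAlgebra H) : Prop :=
  ∀ x : M, (∀ y : M, x * y = y * x) → ∃ c : ℂ, x = c • 1

/-- `τ` is a normal, faithful, normalized trace on `M`. -/
structure IsTrace {M : VonNeumannAlgebra H} (τ : M →ₗ[ℂ] ℂ) : Prop where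
  map_one : τ 1 = 1
  nonneg : ∀ x : M, 0 ≤ τ (star x * x)
  tracial : ∀ x y : M, τ (x * y) = τ (y * x)
  faithful : ∀ x : M, τ (star x * x) = 0 → x = 0
  normal : IsNormal τ

/-- `M` is a type II₁ factor: an infinite-dimensional factor that has a normal, faithful,
normalized trace. -/
structure IsTypeIIOneFactor (M : VonNeumannAlgebra H) : Prop where
  factor : M.IsFactor
  infinite_dimensional : ¬ FiniteDimensional ℂ M
  exists_trace : ∃ τ : M →ₗ[ℂ] ℂ, IsTrace τ

/-- The `2`-norm `‖x‖₂ = τ(x* x)^(1/2)`. -/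
noncomputable def twoNorm {M : VonNeumannAlgebra H} (τ : M →ₗ[ℂ] ℂ) (x : M) : ℝ :=
  Real.sqrt (τ (star x * x)).re

/-- The inclusion of a von Neumann subalgebra `N` (with the same unit) of `M` into `M`. -/
def incl {N M : VonNeumannAlgebra H} (hNM : N ≤ M) : N →ₗ[ℂ] M where
  toFun x := ⟨x, hNM x.2⟩
  map_add' _ _ := rfl
  map_smul' _ _ := rfl

/-- `N` is irreducible in `M`: `N' ∩ M ⊆ N`. -/
def IsIrreducibleIn {N M : VonNeumannAlgebra H} (hNM : N ≤ M) : Prop :=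
  ∀ x : M, (∀ y : N, incl hNM y * x = x * incl hNM y) → ∃ z : N, incl hNM z = x

open Classical in
/-- The `τ`-preserving conditional expectation `E_N` of `M` onto `N`: for a trace `τ`, `E_N(x)` is
the unique element `z` of `N` such that `τ(z y) = τ(x y)` for every `y ∈ N`. -/
noncomputable def condExp {N M : VonNeumannAlgebra H} (hNM : N ≤ M) (τ : M →ₗ[ℂ] ℂ) (x : M) : N :=
  if h : ∃ z : N, ∀ y : N, τ (incl hNM z * incl hNM y) = τ (x * incl hNM y) then h.choose else 0

/-- Uniqueness of the element that defines the conditional expectation. -/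
theorem condExp_eq {N M : VonNeumannAlgebra H} (hNM : N ≤ M) {τ : M →ₗ[ℂ] ℂ} (hτ : IsTrace τ)
    {x : M} {z : N} (hz : ∀ y : N, τ (incl hNM z * incl hNM y) = τ (x * incl hNM y)) :
    condExp hNM τ x = z := by
  have h : ∃ z : N, ∀ y : N, τ (incl hNM z * incl hNM y) = τ (x * incl hNM y) := ⟨z, hz⟩
  have hc := h.choose_spec
  rw [condExp, dif_pos h]
  have hd : incl hNM (h.choose - z) = 0 := by
    apply hτ.faithful
    have hs : star (incl hNM (h.choose - z)) = incl hNM (star (h.choose - z)) := rfl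
    rw [hτ.tracial, hs, map_sub, sub_mul, map_sub, hc, hz, sub_self]
  have hd' : h.choose - z = 0 := Subtype.ext (congrArg (fun w : M => (w : H →L[ℂ] H)) hd)
  exact sub_eq_zero.mp hd'

/-- For an ultrafilter `ω` on `ℕ`, two bounded sequences define the same element of the
ultrapower `M^ω = ℓ^∞(ℕ, M) / I_ω` if and only if their difference lies in the ideal
`I_ω = {(aₙ) : lim_{n → ω} ‖aₙ‖₂ = 0}`. -/
def UltraEq {M : VonNeumannAlgebra H} (τ : M →ₗ[ℂ] ℂ) (ω : Ultrafilter ℕ) (x y : ℕ → M) : Prop :=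
  Tendsto (fun n => twoNorm τ (x n - y n)) ω (𝓝 0)

/-- `M` is full (with respect to `ω`): the relative commutant `M_ω = M' ∩ M^ω` is `ℂ`. Elements of
`M^ω` are represented by bounded sequences, and `M` sits in `M^ω` as the constant sequences. -/
def IsFull {M : VonNeumannAlgebra H} (τ : M →ₗ[ℂ] ℂ) (ω : Ultrafilter ℕ) : Prop :=
  ∀ x : ℕ → M, (∃ C : ℝ, ∀ n, ‖x n‖ ≤ C) →
    (∀ y : M, UltraEq τ ω (fun n => y * x n) (fun n => x n * y)) →
    ∃ c : ℂ, UltraEq τ ω x (fun _ => c • 1)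

/-- `N` has property gamma relative to `M`: there is a bounded sequence `(xₙ)` in `M` such that
`‖xₙ‖₂ = 1` and `E_N(xₙ) = 0` for every `n`, and `‖y xₙ - xₙ y‖₂ → 0` for every `y ∈ N`. -/
def HasRelativeGamma {N M : VonNeumannAlgebra H} (hNM : N ≤ M) (τ : M →ₗ[ℂ] ℂ) : Prop :=
  ∃ x : ℕ → M, (∃ C : ℝ, ∀ n, ‖x n‖ ≤ C) ∧ (∀ n, twoNorm τ (x n) = 1) ∧
    (∀ n, condExp hNM τ (x n) = 0) ∧
    ∀ y : N, Tendsto (fun n => twoNorm τ (incl hNM y * x n - x n * incl hNM y)) atTop (𝓝 0)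

end Defs

end VonNeumannAlgebra

/-! The reverse implication needs only a sequence in `N` that is `2`-norm dense in the unit ball:
unitaries that almost commute with longer and longer initial segments of it form a gamma sequence.

For the forward implication a gamma sequence must be turned into unitaries that are still almost
central and orthogonal to `N`. Irreducibility and factoriality give `N' ∩ M = ℂ`, so a bounded
asymptotically central sequence satisfies `τ (c * a n) ≈ τ c * τ (a n)`
(`AsympCentral.tendsto_sub`). Fullness and separability give `HasSpectralGap`, hence the conditional
expectation of an almost central contraction is almost its trace.

The engine is an increment. If `x` is a self-adjoint contraction with defect `b = 1 - x * x` and `y`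
is another one, then `x ± (b * y * b) / 2` is a contraction, and for a suitable sign its squared
`2`-norm exceeds that of `x` by at least a quarter of that of `b * y * b` (`exists_increment`). A
uniform gain can be iterated only finitely often before the `2`-norm is nearly one
(`exists_of_increment`). This is used twice.

With `y` a product of two almost orthogonal terms of the gamma sequence, the iteration starts at `0`
and stays almost central and almost traceless (`IsGammaSequence.exists_almost_central`). By the gap
its expectation is small, and a spectral cut-off makes it exactly zero (`exists_condExp_eq_zero`).

With `y` a unitary of `M` whose translates have small expectation, the same element is pushed to a
symmetry with little change (`exists_symmetry`). Such unitaries exist because the inclusion has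
infinite index in a strong sense. Under the gap, the gamma sequence contains long almost
`N`-orthogonal families. In the relative tensor square `L²(M) ⊗_N L²(M)`, nearly minimal convex
combinations of the conjugates of a vector become invariant under conjugation. By irreducibility an
invariant vector pairs with `a ⊗ b` as a multiple of a trace functional, and the orthogonal families
show that this functional is unbounded. Hence the combinations tend to zero
(`exists_small_average`). Since the symmetry is `2`-norm close to an almost central element, it is
almost central too. -/

/-! ### Faithful tracial states and their `2`-norm -/

namespace PositiveLinearMap

section TwoNorm

set_option linter.unusedSectionVars false

variable {A : Type*} [CStarAlgebra A] [PartialOrder A] [StarOrderedRing A] (τ : A →ₚ[ℂ] ℂ)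

/-- The `2`-norm of a positive functional. -/
noncomputable def tnorm (x : A) : ℝ := ‖τ.toPreGNS x‖

/-- A faithful tracial state whose norm balls are weakly compact (for sequences), as is the case
for the normal faithful traces of von Neumann algebras. -/
structure IsNormalTrace : Prop where
  map_one : τ 1 = 1
  tracial : ∀ x y : A, τ (x * y) = τ (y * x)
  faithful : ∀ x : A, τ (star x * x) = 0 → x = 0
  exists_weak_limit : ∀ (U : Ultrafilter ℕ) (x : ℕ → A) (C : ℝ), (∀ n, ‖x n‖ ≤ C) →
    ∃ a : A, ‖a‖ ≤ C ∧ ∀ c : A, Tendsto (fun n => τ (c * x n)) U (𝓝 (τ (c * a)))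

variable {τ}

theorem tnorm_eq_sqrt (x : A) : τ.tnorm x = √(τ (star x * x)).re := τ.preGNS_norm_def _

theorem tnorm_sq (x : A) : ((τ.tnorm x ^ 2 : ℝ) : ℂ) = τ (star x * x) := by
  rw [tnorm, Complex.ofReal_pow]; exact τ.preGNS_norm_sq _

theorem tnorm_sq_re (x : A) : τ.tnorm x ^ 2 = (τ (star x * x)).re := by
  rw [← tnorm_sq, Complex.ofReal_re]

theorem tnorm_nonneg (x : A) : 0 ≤ τ.tnorm x := norm_nonneg _

theorem tnorm_zero : τ.tnorm 0 = 0 := by simp [tnorm]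

theorem tnorm_neg (x : A) : τ.tnorm (-x) = τ.tnorm x := by simp [tnorm]

theorem tnorm_add_le (x y : A) : τ.tnorm (x + y) ≤ τ.tnorm x + τ.tnorm y := by
  simpa [tnorm] using norm_add_le (τ.toPreGNS x) (τ.toPreGNS y)

theorem tnorm_sub_le (x y : A) : τ.tnorm (x - y) ≤ τ.tnorm x + τ.tnorm y := by
  simpa [tnorm] using norm_sub_le (τ.toPreGNS x) (τ.toPreGNS y)

theorem tnorm_sub_comm (x y : A) : τ.tnorm (x - y) = τ.tnorm (y - x) := by
  rw [← tnorm_neg, neg_sub]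

theorem tnorm_sub_le_add (x y z : A) : τ.tnorm (x - z) ≤ τ.tnorm (x - y) + τ.tnorm (y - z) := by
  simpa using tnorm_add_le (τ := τ) (x - y) (y - z)

theorem tnorm_le_add_sub (x y : A) : τ.tnorm x ≤ τ.tnorm y + τ.tnorm (x - y) := by
  simpa using tnorm_add_le (τ := τ) y (x - y)

theorem tnorm_smul (c : ℂ) (x : A) : τ.tnorm (c • x) = ‖c‖ * τ.tnorm x := by
  simp [tnorm, norm_smul]

theorem tnorm_real_smul (c : ℝ) (x : A) : τ.tnorm (c • x) = |c| * τ.tnorm x := by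
  rw [← Complex.coe_smul, tnorm_smul]; simp

theorem norm_apply_star_mul_le (x y : A) : ‖τ (star x * y)‖ ≤ τ.tnorm x * τ.tnorm y :=
  norm_inner_le_norm (𝕜 := ℂ) (τ.toPreGNS x) (τ.toPreGNS y)

theorem tnorm_mul_le (x y : A) : τ.tnorm (x * y) ≤ ‖x‖ * τ.tnorm y := by
  have h := (τ.leftMulMapPreGNS x).le_of_opNorm_le
    (LinearMap.mkContinuous_norm_le _ (norm_nonneg x) _) (τ.toPreGNS y)
  simpa [tnorm] using h

theorem star_apply (x : A) : τ (star x) = star (τ x) := map_star τ x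

namespace IsNormalTrace

variable (hτ : τ.IsNormalTrace)
include hτ

theorem tnorm_star (x : A) : τ.tnorm (star x) = τ.tnorm x := by
  rw [tnorm_eq_sqrt, tnorm_eq_sqrt, star_star, hτ.tracial]

theorem norm_apply_mul_le (x y : A) : ‖τ (x * y)‖ ≤ τ.tnorm x * τ.tnorm y := by
  simpa [hτ.tnorm_star] using norm_apply_star_mul_le (τ := τ) (star x) y

theorem tnorm_mul_le' (x y : A) : τ.tnorm (x * y) ≤ τ.tnorm x * ‖y‖ := by
  rw [← hτ.tnorm_star, star_mul, mul_comm, ← hτ.tnorm_star x]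
  simpa using tnorm_mul_le (τ := τ) (star y) (star x)

theorem tnorm_one : τ.tnorm 1 = 1 := by simp [tnorm_eq_sqrt, hτ.map_one]

theorem tnorm_le_norm (x : A) : τ.tnorm x ≤ ‖x‖ := by
  simpa [hτ.tnorm_one] using tnorm_mul_le (τ := τ) x 1

theorem norm_apply_le_tnorm (x : A) : ‖τ x‖ ≤ τ.tnorm x := by
  simpa [hτ.tnorm_one] using hτ.norm_apply_mul_le x 1

theorem norm_apply_le (x : A) : ‖τ x‖ ≤ ‖x‖ := (hτ.norm_apply_le_tnorm x).trans (hτ.tnorm_le_norm x)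

theorem eq_zero_of_tnorm {x : A} (hx : τ.tnorm x = 0) : x = 0 := by
  apply hτ.faithful
  rw [← tnorm_sq, hx]; simp

theorem eq_zero_of_nonneg {x : A} (hx : 0 ≤ x) (h : τ x = 0) : x = 0 := by
  have hs : star (CFC.sqrt x) * CFC.sqrt x = x := by
    rw [(CFC.sqrt_nonneg x).isSelfAdjoint.star_eq, CFC.sqrt_mul_sqrt_self x]
  have := hτ.faithful (CFC.sqrt x) (by rw [hs, h])
  rw [← hs, this]; simp

theorem nontrivial : Nontrivial A := by
  refine ⟨1, 0, fun h => ?_⟩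
  have := hτ.map_one
  rw [h, map_zero] at this
  exact zero_ne_one this

theorem eq_of_forall_apply_mul_eq {a b : A} (h : ∀ c, τ (c * a) = τ (c * b)) : a = b := by
  rw [← sub_eq_zero]
  apply hτ.faithful
  rw [mul_sub, map_sub, h, sub_self]

/-- Norm balls are complete for the `2`-norm. -/
theorem exists_limit_of_cauchy {x : ℕ → A} {C : ℝ} (hC : ∀ n, ‖x n‖ ≤ C)
    (hx : ∀ ε > 0, ∃ n₀, ∀ m ≥ n₀, ∀ n ≥ n₀, τ.tnorm (x m - x n) ≤ ε) :
    ∃ a : A, ‖a‖ ≤ C ∧ Tendsto (fun n => τ.tnorm (x n - a)) atTop (𝓝 0) := by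
  obtain ⟨a, ha, hlim⟩ := hτ.exists_weak_limit (Ultrafilter.of atTop) x C hC
  refine ⟨a, ha, ?_⟩
  rw [Metric.tendsto_atTop]
  intro ε hε
  obtain ⟨n₀, h₀⟩ := hx (ε / 2) (half_pos hε)
  refine ⟨n₀, fun m hm => ?_⟩
  -- The left side is the weak limit in `n` of `τ (star (x m - a) * (x m - x n))`; Cauchy–Schwarz
  -- leaves one factor, which is then cancelled.
  have key : τ.tnorm (x m - a) ^ 2 ≤ τ.tnorm (x m - a) * (ε / 2) := by
    have h1 : Tendsto (fun n => ‖τ (star (x m - a) * (x m - x n))‖)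
        ((Ultrafilter.of atTop : Ultrafilter ℕ) : Filter ℕ)
        (𝓝 ‖τ (star (x m - a) * (x m - a))‖) := by
      simp only [mul_sub, map_sub]
      exact (tendsto_const_nhds.sub (hlim _)).norm
    rw [← tnorm_sq, Complex.norm_real, Real.norm_of_nonneg (sq_nonneg _)] at h1
    refine le_of_tendsto h1 ((Ultrafilter.of_le atTop) ?_)
    filter_upwards [eventually_ge_atTop n₀] with n hn
    exact (norm_apply_star_mul_le _ _).trans
      (mul_le_mul_of_nonneg_left (h₀ m hm n hn) (tnorm_nonneg _))
  rw [Real.dist_eq, sub_zero, abs_of_nonneg (tnorm_nonneg _)]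
  by_contra! hcon
  nlinarith

end IsNormalTrace

theorem tnorm_real_part_sq_add {x : A} (hτ : τ.IsNormalTrace) :
    τ.tnorm (realPart x : selfAdjoint A) ^ 2 + τ.tnorm (imaginaryPart x : selfAdjoint A) ^ 2 =
      τ.tnorm x ^ 2 := by
  have h := realPart_add_I_smul_imaginaryPart x
  set a : A := ((realPart x : selfAdjoint A) : A)
  set b : A := ((imaginaryPart x : selfAdjoint A) : A)
  have ha : star a = a := (realPart x).2.star_eq
  have hb : star b = b := (imaginaryPart x).2.star_eq
  rw [tnorm_sq_re, tnorm_sq_re, tnorm_sq_re, ← h, ha, hb]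
  simp only [star_add, star_smul, ha, hb, add_mul, mul_add, smul_mul_assoc, mul_smul_comm, map_add,
    map_smul, hτ.tracial b a]
  simp
  ring

theorem tnorm_add_sq {x y : A} :
    τ.tnorm (x + y) ^ 2 = τ.tnorm x ^ 2 + 2 * (τ (star x * y)).re + τ.tnorm y ^ 2 :=
  norm_add_sq (𝕜 := ℂ) (τ.toPreGNS x) (τ.toPreGNS y)

end TwoNorm

end PositiveLinearMap

/-! ### The trace-preserving conditional expectation -/

namespace PositiveLinearMap

section CondExp

set_option linter.unusedSectionVars false

variable {A : Type*} [CStarAlgebra A] [PartialOrder A] [StarOrderedRing A] {τ : A →ₚ[ℂ] ℂ}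
  {B : Type*} [CStarAlgebra B] [PartialOrder B] [StarOrderedRing B] {σ : B →ₚ[ℂ] ℂ}
  {ι : B →⋆ₐ[ℂ] A}

/-- Hölder's inequality for the `1`-norm of a positive element: split `p` into two square roots and
apply Cauchy–Schwarz. -/
theorem IsNormalTrace.norm_apply_nonneg_mul_le (hτ : τ.IsNormalTrace) {p : A} (hp : 0 ≤ p) (c : A) :
    ‖τ (p * c)‖ ≤ ‖c‖ * (τ p).re := by
  set r := CFC.sqrt p with hr
  have hrs : star r = r := (CFC.sqrt_nonneg p).isSelfAdjoint.star_eq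
  have hrr : r * r = p := CFC.sqrt_mul_sqrt_self p
  have h1 : τ (p * c) = τ (star r * (r * c)) := by rw [hrs, ← mul_assoc, hrr]
  rw [h1]
  refine (norm_apply_star_mul_le _ _).trans ?_
  have h2 : τ.tnorm r ^ 2 = (τ p).re := by rw [tnorm_sq_re, hrs, hrr]
  rw [← h2]
  nlinarith [hτ.tnorm_mul_le' r c, tnorm_nonneg (τ := τ) r]

theorem tnorm_map (hι : ∀ y, τ (ι y) = σ y) (y : B) : τ.tnorm (ι y) = σ.tnorm y := by
  rw [tnorm_eq_sqrt, tnorm_eq_sqrt, ← map_star, ← map_mul, hι]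

theorem norm_map_le (y : B) : ‖ι y‖ ≤ ‖y‖ := NonUnitalStarAlgHom.norm_apply_le ι y

/-- An approximate polar decomposition. -/
theorem exists_approx_polar (y : B) {ε : ℝ} (hε : 0 < ε) :
    ∃ p w : B, 0 ≤ p ∧ ‖w‖ ≤ 1 ∧ y = w * (p + ε • 1) ∧ ∃ d : B, ‖d‖ ≤ ε ∧ star y * w = p - d := by
  set h := star y * y
  have hh : 0 ≤ h := star_mul_self_nonneg y
  have hsa : IsSelfAdjoint h := hh.isSelfAdjoint
  have hspec : ∀ t ∈ spectrum ℝ h, 0 ≤ t := fun t ht => spectrum_nonneg_of_nonneg hh ht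
  have hpos : ∀ t : ℝ, √t + ε ≠ 0 := fun t => by positivity
  have hcont : Continuous fun t : ℝ => (√t + ε)⁻¹ :=
    (Real.continuous_sqrt.add continuous_const).inv₀ hpos
  have hidc : Continuous fun t : ℝ => t * (√t + ε)⁻¹ := continuous_id.mul hcont
  set p : B := cfc (fun t : ℝ => √t) h
  set g : B := cfc (fun t : ℝ => (√t + ε)⁻¹) h
  have hg : star g = g := (cfc_predicate (R := ℝ) (fun t : ℝ => (√t + ε)⁻¹) h).star_eq
  have hpe : p + ε • 1 = cfc (fun t : ℝ => √t + ε) h := by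
    rw [cfc_add_const ε (fun t : ℝ => √t) h, Algebra.algebraMap_eq_smul_one]
  have hgp : g * (p + ε • 1) = 1 := by
    rw [hpe, ← cfc_mul _ _ h hcont.continuousOn, ← cfc_one ℝ h]
    exact cfc_congr fun t _ => inv_mul_cancel₀ (hpos t)
  have hid : cfc (fun t : ℝ => t) h = h := cfc_id' ℝ h
  -- Here `p = |y|` and `w = y (|y| + ε)⁻¹`. The shift by `ε` replaces the partial isometry, which a
  -- general C*-algebra need not contain.
  refine ⟨p, y * g, cfc_nonneg fun t _ => Real.sqrt_nonneg t, ?_, ?_, p - star y * (y * g), ?_,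
    by abel⟩
  · have h1 : ‖y * g‖ * ‖y * g‖ ≤ 1 := by
      rw [← CStarRing.norm_star_mul_self, star_mul, hg, mul_assoc, ← mul_assoc (star y)]
      change ‖g * (h * g)‖ ≤ 1
      rw [← hid, ← cfc_mul _ _ h (continuousOn_id' _) hcont.continuousOn,
        ← cfc_mul _ _ h hcont.continuousOn (hidc.continuousOn)]
      refine norm_cfc_le zero_le_one fun t ht => ?_
      have ht0 := hspec t ht
      have h2 : (√t + ε)⁻¹ * (t * (√t + ε)⁻¹) = (√t / (√t + ε)) ^ 2 := by
        field_simp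
        exact (Real.sq_sqrt ht0).symm
      rw [h2, Real.norm_of_nonneg (sq_nonneg _)]
      refine pow_le_one₀ (by positivity) ?_
      rw [div_le_one (by positivity)]
      linarith
    nlinarith [norm_nonneg (y * g)]
  · rw [mul_assoc, hgp, mul_one]
  · rw [← mul_assoc]
    change ‖p - h * g‖ ≤ ε
    rw [← hid, ← cfc_mul _ _ h (continuousOn_id' _) hcont.continuousOn,
      ← cfc_sub _ _ h Real.continuous_sqrt.continuousOn hidc.continuousOn]
    refine norm_cfc_le hε.le fun t ht => ?_
    have ht0 := hspec t ht
    have h2 : √t - t * (√t + ε)⁻¹ = ε * (√t / (√t + ε)) := by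
      field_simp
      nlinarith [Real.sq_sqrt ht0]
    rw [h2, Real.norm_of_nonneg (by positivity)]
    refine mul_le_of_le_one_right hε.le ?_
    rw [div_le_one (by positivity)]
    linarith

/-- Both sides are compared with `‖x‖ * σ |y|`: it bounds the left side by Hölder, and it is almost
attained by `‖x‖` times the approximate phase of `y`. -/
theorem exists_re_apply_star_mul_ge (hτ : τ.IsNormalTrace) (hσ : σ.IsNormalTrace)
    (hι : ∀ y, τ (ι y) = σ y) (x : A) (y : B) {ε : ℝ} (hε : 0 < ε) :
    ∃ k : B, ‖k‖ ≤ ‖x‖ ∧ ‖τ (star (ι y) * x)‖ ≤ (σ (star y * k)).re + ε := by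
  set δ := ε / (2 * (‖x‖ + 1)) with hδ
  have hx1 : 0 < ‖x‖ + 1 := by positivity
  have hδ0 : 0 < δ := by positivity
  obtain ⟨p, w, hp, hw, hy, d, hd, hyw⟩ := exists_approx_polar y hδ0
  refine ⟨‖x‖ • w, ?_, ?_⟩
  · rw [norm_smul, norm_norm]
    exact mul_le_of_le_one_right (norm_nonneg x) hw
  · have hp' : star p = p := hp.isSelfAdjoint.star_eq
    have h1 : star (ι y) * x = ι p * (ι (star w) * x) + δ • (ι (star w) * x) := by
      rw [← map_star, hy, star_mul, star_add, hp', star_smul, star_one, star_trivial, add_mul,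
        map_add, map_mul, smul_mul_assoc, one_mul, ← Complex.coe_smul, map_smul, add_mul,
        smul_mul_assoc, mul_assoc, Complex.coe_smul]
    have hwx : ‖ι (star w) * x‖ ≤ ‖x‖ := by
      refine (norm_mul_le _ _).trans (mul_le_of_le_one_left (norm_nonneg x) ?_)
      exact (norm_map_le _).trans (by rwa [norm_star])
    have hιp : 0 ≤ ι p := map_nonneg ι hp
    have hp0 : 0 ≤ (τ (ι p)).re := (Complex.nonneg_iff.mp (τ.map_nonneg hιp)).1
    have h2 := hτ.norm_apply_nonneg_mul_le hιp (ι (star w) * x)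
    have h3 : ‖τ (δ • (ι (star w) * x))‖ ≤ δ * ‖x‖ := by
      rw [← Complex.coe_smul, map_smul, norm_smul, Complex.norm_real, Real.norm_of_nonneg hδ0.le]
      exact mul_le_mul_of_nonneg_left ((hτ.norm_apply_le _).trans hwx) hδ0.le
    have h4 : (σ (star y * (‖x‖ • w))).re = ‖x‖ * ((σ p).re - (σ d).re) := by
      rw [mul_smul_comm, hyw, ← Complex.coe_smul, map_smul, map_sub]
      simp
    have h5 : (σ d).re ≤ δ := (Complex.re_le_norm _).trans ((hσ.norm_apply_le d).trans hd)
    have h6 : 2 * δ * (‖x‖ + 1) = ε := by rw [hδ]; field_simp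
    rw [h1, map_add, h4]
    refine (norm_add_le _ _).trans ?_
    rw [← hι p]
    have := norm_nonneg x
    nlinarith [mul_le_mul_of_nonneg_right hwx hp0, mul_le_mul_of_nonneg_left h5 this]

/-- Orthogonal projection in the GNS space would give only a vector. Taking instead the nearest
point to `x` in a norm ball of `B`, which is closed because balls are `2`-norm complete, gives an
element of `B`; duality then shows that the residual is orthogonal to all of `B`. -/
theorem exists_condExp (hτ : τ.IsNormalTrace) (hσ : σ.IsNormalTrace) (hι : ∀ y, τ (ι y) = σ y)
    (x : A) : ∃ z : B, ‖z‖ ≤ ‖x‖ ∧ ∀ y, σ (z * y) = τ (x * ι y) := by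
  let e : B →ₗ[ℂ] τ.GNS :=
    (UniformSpace.Completion.toComplL (𝕜 := ℂ) (E := τ.PreGNS)).toLinearMap ∘ₗ
      (τ.toPreGNS.toLinearMap ∘ₗ ι.toAlgHom.toLinearMap)
  let X : τ.GNS := (τ.toPreGNS x : τ.GNS)
  have he : ∀ y, e y = (τ.toPreGNS (ι y) : τ.GNS) := fun y => rfl
  have heX : ∀ y, inner ℂ (e y) X = τ (star (ι y) * x) := fun y => by
    rw [he, UniformSpace.Completion.inner_coe]; rfl
  have hee : ∀ y z, inner ℂ (e y) (e z) = σ (star y * z) := fun y z => by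
    rw [he, he, UniformSpace.Completion.inner_coe, ← hι, map_mul, map_star]; rfl
  have hnorm : ∀ y, ‖e y‖ = σ.tnorm y := fun y => by
    rw [he, UniformSpace.Completion.norm_coe, ← tnorm_map hι]; rfl
  have hXn : ‖X‖ ≤ ‖x‖ := by
    rw [UniformSpace.Completion.norm_coe]; exact hτ.tnorm_le_norm x
  set K : Set τ.GNS := e '' {z | ‖z‖ ≤ ‖x‖} with hK
  have hKc : IsClosed K := by
    apply IsSeqClosed.isClosed
    intro k l hk hkl
    choose z hz hzk using hk
    have hcau := (Metric.cauchySeq_iff.mp hkl.cauchySeq)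
    obtain ⟨a, ha, hlim⟩ := hσ.exists_limit_of_cauchy hz fun ε hε => by
      obtain ⟨n₀, h₀⟩ := hcau ε hε
      refine ⟨n₀, fun m hm n hn => ?_⟩
      rw [← hnorm, map_sub, hzk, hzk, ← dist_eq_norm]
      exact (h₀ m hm n hn).le
    refine ⟨a, ha, tendsto_nhds_unique (f := k) (l := atTop) ?_ hkl⟩
    rw [tendsto_iff_norm_sub_tendsto_zero]
    simpa only [← hzk, ← map_sub, hnorm] using hlim
  have hKconv : Convex ℝ K := by
    have h1 : Convex ℝ {z : B | ‖z‖ ≤ ‖x‖} := by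
      simpa [Metric.closedBall, dist_zero_right] using convex_closedBall (0 : B) ‖x‖
    exact h1.linear_image (e.restrictScalars ℝ)
  let _ : InnerProductSpace ℝ τ.GNS := InnerProductSpace.rclikeToReal ℂ τ.GNS
  obtain ⟨Z, hZK, hZ⟩ := exists_norm_eq_iInf_of_complete_convex (K := K)
    ⟨e 0, 0, by simp, rfl⟩ hKc.isComplete hKconv X
  rw [norm_eq_iInf_iff_real_inner_le_zero hKconv hZK] at hZ
  obtain ⟨z, hz, rfl⟩ := hZK
  have hZ' : ∀ k : B, ‖k‖ ≤ ‖x‖ → (inner ℂ (X - e z) (e k)).re ≤ (inner ℂ (X - e z) (e z)).re :=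
    fun k hk => by
      have h1 : (inner ℂ (X - e z) (e k - e z)).re ≤ 0 := hZ (e k) ⟨k, hk, rfl⟩
      rw [inner_sub_right, Complex.sub_re] at h1
      linarith
  let V : Submodule ℂ τ.GNS := (LinearMap.range e).topologicalClosure
  have : CompleteSpace V := (Submodule.isClosed_topologicalClosure _).completeSpace_coe
  have heV : ∀ y, e y ∈ V := fun y => Submodule.le_topologicalClosure _ ⟨y, rfl⟩
  set η : τ.GNS := V.starProjection (X - e z) with hη
  have hηV : ∀ v ∈ V, inner ℂ η v = inner ℂ (X - e z) v := fun v hv => by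
    rw [hη, Submodule.inner_starProjection_left_eq_right,
      Submodule.starProjection_eq_self_iff.mpr hv]
  have hηmem : η ∈ V := Submodule.starProjection_apply_mem _ _
  have hη0 : η = 0 := by
    have hsq : ‖η‖ ^ 2 = (inner ℂ η (X - e z)).re := by
      have h1 : inner ℂ η (X - e z) = inner ℂ η η := by
        rw [← inner_conj_symm, ← hηV η hηmem, inner_conj_symm]
      rw [h1]; exact (inner_self_eq_norm_sq (𝕜 := ℂ) η).symm
    -- Approximate `η` by some `e y`. Up to multiples of `ε`, `⟪η, X⟫` is at most `⟪η, e k⟫` for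
    -- some `k` in the ball, which by minimality is at most `⟪η, e z⟫` in real part; so `‖η‖ ^ 2 =
    -- re ⟪η, X - e z⟫` is small.
    have hbound : ∀ ε > 0, ‖η‖ ^ 2 ≤ ε * (2 * ‖x‖ + 1) := fun ε hε => by
      obtain ⟨Y, ⟨y, rfl⟩, hy⟩ := Metric.mem_closure_iff.mp
        (show η ∈ closure (LinearMap.range e : Set τ.GNS) from hηmem) ε hε
      rw [dist_eq_norm] at hy
      obtain ⟨k, hk, hyk⟩ := exists_re_apply_star_mul_ge hτ hσ hι x y hε
      rw [← heX, ← hee] at hyk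
      have h1 : (inner ℂ η X).re ≤ (inner ℂ (e y) X).re + ε * ‖x‖ := by
        have h2 : inner ℂ η X = inner ℂ (e y) X + inner ℂ (η - e y) X := by
          rw [inner_sub_left]; ring
        rw [h2, Complex.add_re]
        have h3 := (Complex.re_le_norm _).trans (norm_inner_le_norm (𝕜 := ℂ) (η - e y) X)
        have h4 := mul_le_mul hy.le hXn (norm_nonneg X) hε.le
        linarith
      have h5 : (inner ℂ (e y) (e k)).re ≤ (inner ℂ η (e k)).re + ε * ‖x‖ := by
        have h2 : inner ℂ (e y) (e k) = inner ℂ η (e k) - inner ℂ (η - e y) (e k) := by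
          rw [inner_sub_left]; ring
        rw [h2, Complex.sub_re]
        have h3 := (Complex.abs_re_le_norm _).trans (norm_inner_le_norm (𝕜 := ℂ) (η - e y) (e k))
        have h4 := mul_le_mul hy.le ((hnorm k).le.trans ((hσ.tnorm_le_norm k).trans hk))
          (norm_nonneg _) hε.le
        have := neg_abs_le (inner ℂ (η - e y) (e k)).re
        linarith
      have h6 := hZ' k hk
      rw [← hηV _ (heV k), ← hηV _ (heV z)] at h6
      have h7 := Complex.re_le_norm (inner ℂ (e y) X)
      rw [hsq, inner_sub_right, Complex.sub_re]
      linarith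
    have hle : ‖η‖ ^ 2 ≤ 0 := by
      refine le_of_forall_pos_le_add fun ε hε => ?_
      have := hbound (ε / (2 * ‖x‖ + 1)) (by positivity)
      rwa [div_mul_cancel₀ _ (by positivity), ← zero_add ε] at this
    exact norm_eq_zero.mp (pow_eq_zero_iff two_ne_zero |>.mp (le_antisymm hle (sq_nonneg _)))
  refine ⟨z, hz, fun y => ?_⟩
  have h1 : inner ℂ (e (star y)) (X - e z) = 0 := by
    rw [← inner_conj_symm, ← hηV _ (heV _), hη0, inner_zero_left, map_zero]
  rw [inner_sub_right, heX, hee, star_star, map_star, star_star, sub_eq_zero, hσ.tracial,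
    hτ.tracial] at h1
  exact h1.symm

/-- An inclusion of algebras with normal traces together with its trace-preserving conditional
expectation. -/
structure IsCondExp (τ : A →ₚ[ℂ] ℂ) (σ : B →ₚ[ℂ] ℂ) (ι : B →⋆ₐ[ℂ] A) (E : A →ₗ[ℂ] B) : Prop where
  trace : τ.IsNormalTrace
  trace_sub : σ.IsNormalTrace
  apply_map : ∀ y, τ (ι y) = σ y
  norm_le : ∀ x, ‖E x‖ ≤ ‖x‖
  apply_mul : ∀ x y, σ (E x * y) = τ (x * ι y)

theorem eq_of_forall_apply_mul_eq' (hσ : σ.IsNormalTrace) {a b : B}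
    (h : ∀ c, σ (a * c) = σ (b * c)) : a = b :=
  hσ.eq_of_forall_apply_mul_eq fun c => by rw [hσ.tracial, h, hσ.tracial]

theorem exists_isCondExp (hτ : τ.IsNormalTrace) (hσ : σ.IsNormalTrace)
    (hι : ∀ y, τ (ι y) = σ y) : ∃ E : A →ₗ[ℂ] B, IsCondExp τ σ ι E := by
  choose E hE hE' using exists_condExp hτ hσ hι
  refine ⟨{ toFun := E, map_add' := fun x y => ?_, map_smul' := fun c x => ?_ },
    hτ, hσ, hι, hE, hE'⟩
  · exact eq_of_forall_apply_mul_eq' hσ fun d => by simp [add_mul, hE']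
  · exact eq_of_forall_apply_mul_eq' hσ fun d => by simp [hE']

namespace IsCondExp

variable {E : A →ₗ[ℂ] B} (h : IsCondExp τ σ ι E)
include h

theorem tnorm_map (y : B) : τ.tnorm (ι y) = σ.tnorm y := PositiveLinearMap.tnorm_map h.apply_map y

theorem eq_of_forall {x : A} {z : B} (hz : ∀ y, σ (z * y) = τ (x * ι y)) : E x = z :=
  eq_of_forall_apply_mul_eq' h.trace_sub fun y => by rw [h.apply_mul, hz]

theorem apply_condExp (x : A) : σ (E x) = τ x := by simpa using h.apply_mul x 1

theorem condExp_map (y : B) : E (ι y) = y :=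
  h.eq_of_forall fun z => by rw [← h.apply_map, map_mul ι]

theorem condExp_mul_map (x : A) (y : B) : E (x * ι y) = E x * y :=
  h.eq_of_forall fun z => by rw [mul_assoc, h.apply_mul, map_mul ι, mul_assoc]

theorem condExp_map_mul (y : B) (x : A) : E (ι y * x) = y * E x :=
  h.eq_of_forall fun z => by
    rw [mul_assoc, h.trace_sub.tracial, mul_assoc, h.apply_mul, mul_assoc, h.trace.tracial (ι y),
      map_mul ι, mul_assoc]

theorem condExp_star (x : A) : E (star x) = star (E x) :=
  h.eq_of_forall fun z => by
    have h1 := h.apply_mul x (star z)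
    rw [h.trace_sub.tracial, ← star_star z, ← star_mul, star_apply, h1, ← star_apply, star_mul,
      ← map_star, h.trace.tracial]

theorem tnorm_le (x : A) : σ.tnorm (E x) ≤ τ.tnorm x := by
  have h1 : ((σ.tnorm (E x) ^ 2 : ℝ) : ℂ) = τ (star (ι (E x)) * x) := by
    rw [tnorm_sq, h.trace_sub.tracial, h.apply_mul, map_star, h.trace.tracial]
  have h2 := norm_apply_star_mul_le (τ := τ) (ι (E x)) x
  rw [← h1, Complex.norm_real, Real.norm_of_nonneg (sq_nonneg _), h.tnorm_map] at h2
  by_contra! hc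
  nlinarith [tnorm_nonneg (τ := σ) (E x), tnorm_nonneg (τ := τ) x]

theorem isSelfAdjoint {x : A} (hx : IsSelfAdjoint x) : IsSelfAdjoint (E x) := by
  rw [IsSelfAdjoint, ← h.condExp_star, hx.star_eq]

end IsCondExp

end CondExp

end PositiveLinearMap

/-! ### Complete positivity and the relative tensor square -/

namespace PositiveLinearMap

universe u

section Fusion

set_option linter.unusedSectionVars false

variable {A : Type u} [CStarAlgebra A] [PartialOrder A] [StarOrderedRing A] {τ : A →ₚ[ℂ] ℂ}
  {B : Type*} [CStarAlgebra B] [PartialOrder B] [StarOrderedRing B] {σ : B →ₚ[ℂ] ℂ}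
  {ι : B →⋆ₐ[ℂ] A} {E : A →ₗ[ℂ] B}

/-- An element of a `C⋆`-algebra that is positive with respect to a faithful positive functional
is of the form `c* c`. -/
theorem exists_eq_star_mul_self_of_forall_conjugate {D : Type*} [CStarAlgebra D] [PartialOrder D]
    [StarOrderedRing D] (T : D →ₗ[ℂ] ℂ) (hT : ∀ x, 0 ≤ T (star x * x))
    (hT' : ∀ x, T (star x * x) = 0 → x = 0) {m : D} (hm : IsSelfAdjoint m)
    (hpos : ∀ x, 0 ≤ T (star x * m * x)) : ∃ c, m = star c * c := by
  have hn : 0 ≤ m⁻ := CFC.negPart_nonneg m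
  have hns : star m⁻ = m⁻ := hn.isSelfAdjoint.star_eq
  set r := CFC.sqrt m⁻
  have hrs : star r = r := (CFC.sqrt_nonneg _).isSelfAdjoint.star_eq
  have hrr : r * r = m⁻ := CFC.sqrt_mul_sqrt_self m⁻
  have hm' : m = m⁺ - m⁻ := (CFC.posPart_sub_negPart m hm).symm
  -- Testing positivity at `m⁻` itself yields minus the trace of a square, which forces `m⁻ = 0`.
  have h1 : star m⁻ * m * m⁻ = -(star (r * m⁻) * (r * m⁻)) := by
    have h2 : m * m⁻ = -(m⁻ * m⁻) := by
      calc m * m⁻ = (m⁺ - m⁻) * m⁻ := by rw [← hm']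
        _ = _ := by rw [sub_mul, CFC.posPart_mul_negPart, zero_sub]
    rw [mul_assoc, h2, hns, star_mul, hrs, hns, mul_neg, mul_assoc m⁻ r, ← mul_assoc r r, hrr]
  have h3 := hpos m⁻
  rw [h1, map_neg] at h3
  have h4 : T (star (r * m⁻) * (r * m⁻)) = 0 :=
    le_antisymm (by simpa using h3) (hT _)
  have h5 : r * m⁻ = 0 := hT' _ h4
  have h6 : m⁻ * m⁻ = 0 := by rw [← hrr, mul_assoc, hrr, h5, mul_zero]
  have h7 : m⁻ = 0 := by
    rw [← CStarRing.star_mul_self_eq_zero_iff, hns, h6]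
  rw [h7, sub_zero] at hm'
  exact CStarAlgebra.nonneg_iff_eq_star_mul_self.mp (hm' ▸ CFC.posPart_nonneg m)

namespace IsCondExp

variable (h : IsCondExp τ σ ι E)
include h

/-- This is complete positivity of `E`. The matrix `E (a i* a j)` is tested against the faithful
trace of the matrix algebra over `B`, where conjugation by `D` turns it into a sum of traces of
squares in `A`. -/
theorem exists_factorization {n : Type*} [Fintype n] [DecidableEq n] (a : n → A) :
    ∃ c : n → n → B, ∀ i j, E (star (a i) * a j) = ∑ k, star (c k i) * c k j := by
  let T : CStarMatrix n n B →ₗ[ℂ] ℂ :=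
    { toFun := fun D => ∑ i, σ (D i i)
      map_add' := fun D D' => by simp [Finset.sum_add_distrib]
      map_smul' := fun c D => by simp [Finset.mul_sum] }
  have hTapp : ∀ D : CStarMatrix n n B, T D = ∑ i, σ (D i i) := fun _ => rfl
  let m : CStarMatrix n n B := CStarMatrix.ofMatrix fun i j => E (star (a i) * a j)
  have hmapp : ∀ i j, m i j = E (star (a i) * a j) := fun _ _ => rfl
  have hTs : ∀ D : CStarMatrix n n B, T (star D * D) = ∑ i, ∑ k, σ (star (D k i) * D k i) :=
    fun D => by
      simp only [hTapp, CStarMatrix.mul_apply, CStarMatrix.star_apply, map_sum]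
  have hterm : ∀ x : B, 0 ≤ σ (star x * x) := fun x => σ.map_nonneg (star_mul_self_nonneg x)
  obtain ⟨c, hc⟩ : ∃ c, m = star c * c := by
    refine exists_eq_star_mul_self_of_forall_conjugate T (fun D => ?_) (fun D hD => ?_) ?_
      fun D => ?_
    · rw [hTs]
      exact Finset.sum_nonneg fun i _ => Finset.sum_nonneg fun k _ => hterm _
    · rw [hTs, Finset.sum_eq_zero_iff_of_nonneg
        fun i _ => Finset.sum_nonneg fun k _ => hterm _] at hD
      ext k i
      have h1 := hD i (Finset.mem_univ _)
      rw [Finset.sum_eq_zero_iff_of_nonneg fun k _ => hterm _] at h1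
      exact h.trace_sub.faithful _ (h1 k (Finset.mem_univ _))
    · ext i j
      rw [CStarMatrix.star_apply, hmapp, hmapp, ← h.condExp_star, star_mul, star_star]
    · have h1 : T (star D * m * D) =
          ∑ i, τ (star (∑ k, a k * ι (D k i)) * ∑ k, a k * ι (D k i)) := by
        rw [hTapp]
        refine Finset.sum_congr rfl fun i _ => ?_
        simp only [CStarMatrix.mul_apply, CStarMatrix.star_apply, star_sum, star_mul,
          Finset.sum_mul, Finset.mul_sum, map_sum, hmapp]
        refine Finset.sum_congr rfl fun k _ => Finset.sum_congr rfl fun l _ => ?_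
        rw [mul_assoc, h.trace_sub.tracial, mul_assoc, h.apply_mul, map_mul ι, map_star,
          mul_assoc (star (ι (D l i))), h.trace.tracial (star (ι (D l i)))]
        simp only [mul_assoc]
      rw [h1]
      exact Finset.sum_nonneg fun i _ => τ.map_nonneg (star_mul_self_nonneg _)
  refine ⟨fun k i => c k i, fun i j => ?_⟩
  rw [← hmapp, hc, CStarMatrix.mul_apply]
  simp only [CStarMatrix.star_apply]

theorem sum_kernel_nonneg {n : Type*} [Fintype n] (a b : n → A) :
    0 ≤ ∑ i, ∑ j, τ (star (b i) * ι (E (star (a i) * a j)) * b j) := by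
  classical
  obtain ⟨c, hc⟩ := h.exists_factorization a
  have h1 : ∑ i, ∑ j, τ (star (b i) * ι (E (star (a i) * a j)) * b j) =
      ∑ k, τ (star (∑ j, ι (c k j) * b j) * ∑ j, ι (c k j) * b j) := by
    simp only [hc, map_sum, Finset.sum_mul, Finset.mul_sum, star_sum, star_mul, map_mul, map_star]
    rw [Finset.sum_congr rfl fun i _ => Finset.sum_comm, Finset.sum_comm]
    refine Finset.sum_congr rfl fun k _ => ?_
    rw [Finset.sum_comm]
    simp only [mul_assoc]
  rw [h1]
  exact Finset.sum_nonneg fun i _ => τ.map_nonneg (star_mul_self_nonneg _)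

theorem kernel_symm (a b a' b' : A) :
    star (τ (star b * ι (E (star a * a')) * b')) = τ (star b' * ι (E (star a' * a)) * b) := by
  rw [← star_apply]
  simp only [star_mul, star_star, ← map_star, ← h.condExp_star, mul_assoc]

/-- The relative tensor square of `A` over `B`. -/
theorem exists_fusion : ∃ (K : Type u) (_ : NormedAddCommGroup K) (_ : InnerProductSpace ℂ K)
    (Φ : A → A → K), ∀ a b a' b',
      inner ℂ (Φ a b) (Φ a' b') = τ (star b * ι (E (star a * a')) * b') := by
  let k : A × A → A × A → ℂ := fun s t => τ (star s.2 * ι (E (star s.1 * t.1)) * t.2)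
  -- The scalar kernel is viewed as operator valued; `Φ a b` will be the kernel function at `(a,
  -- b)`, so its inner products are the prescribed values.
  let K : Matrix (A × A) (A × A) (ℂ →L[ℂ] ℂ) := fun s t => k s t • (1 : ℂ →L[ℂ] ℂ)
  have hk : ∀ s t, star (k s t) = k t s := fun s t => h.kernel_symm _ _ _ _
  have hK : K.PosSemidef := by
    have key := (RKHS.posSemidef_tfae (K := K)).out 0 2
    refine key.mpr ⟨?_, fun v => ?_⟩
    · ext s t
      change (star (k t s • (1 : ℂ →L[ℂ] ℂ))) 1 = (k s t • (1 : ℂ →L[ℂ] ℂ)) 1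
      rw [star_smul, star_one, hk]
    · classical
      have h1 := h.sum_kernel_nonneg (n := v.support) (fun s => s.1.1) fun s => v s • s.1.2
      have h2 := (Complex.nonneg_iff.mp h1).1
      convert! h2 using 1
      simp only [Finsupp.sum, K, k]
      rw [Finset.sum_coe_sort v.support (fun i => ∑ j : v.support,
        τ (star (v i • i.2) * ι (E (star i.1 * (j : A × A).1)) * v j • (j : A × A).2))]
      refine congrArg Complex.re (Finset.sum_congr rfl fun s _ => ?_)
      rw [Finset.sum_coe_sort v.support (fun j =>
        τ (star (v s • s.2) * ι (E (star s.1 * j.1)) * v j • j.2))]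
      refine Finset.sum_congr rfl fun t _ => ?_
      have h3 := hk t s
      simp only [k] at h3
      simp [← h3]
      exact Or.inl (by ring)
  have : Fact K.PosSemidef := ⟨hK⟩
  refine ⟨RKHS.OfKernel K, inferInstance, inferInstance,
    fun a b => RKHS.kerFun (RKHS.OfKernel K) (a, b) 1, fun a b a' b' => ?_⟩
  change inner ℂ (RKHS.kerFun (RKHS.OfKernel K) (a, b) 1)
    (RKHS.kerFun (RKHS.OfKernel K) (a', b') 1) = _
  rw [← RKHS.kernel_inner, RKHS.OfKernel.kernel_ofKernel]
  have h3 := hk (a', b') (a, b)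
  simp only [k] at h3
  simp [K, k, ← h3]

end IsCondExp

end Fusion

end PositiveLinearMap

/-! ### Asymptotically central sequences -/

namespace PositiveLinearMap

section Central

set_option linter.unusedSectionVars false

variable {A : Type*} [CStarAlgebra A] [PartialOrder A] [StarOrderedRing A] {τ : A →ₚ[ℂ] ℂ}
  {B : Type*} [CStarAlgebra B] [PartialOrder B] [StarOrderedRing B] {σ : B →ₚ[ℂ] ℂ}
  {ι : B →⋆ₐ[ℂ] A} {E : A →ₗ[ℂ] B}

/-- The relative commutant of `B` in `A` consists of the scalars. -/
def HasTrivialRelativeCommutant (ι : B →⋆ₐ[ℂ] A) : Prop :=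
  ∀ x : A, (∀ y : B, ι y * x = x * ι y) → ∃ c : ℂ, x = c • 1

/-- A sequence asymptotically commutes with `B` along a filter. -/
def AsympCentral (τ : A →ₚ[ℂ] ℂ) (ι : B →⋆ₐ[ℂ] A) (f : Filter ℕ) (a : ℕ → A) : Prop :=
  ∀ y : B, Tendsto (fun n => τ.tnorm (ι y * a n - a n * ι y)) f (𝓝 0)

theorem tendsto_zero_of_norm_le {f : Filter ℕ} {u : ℕ → ℂ} {v : ℕ → ℝ} (huv : ∀ n, ‖u n‖ ≤ v n)
    (hv : Tendsto v f (𝓝 0)) : Tendsto u f (𝓝 0) :=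
  squeeze_zero_norm huv hv

/-- A weak limit of the sequence along the ultrafilter commutes with `B`, hence is a scalar. -/
theorem AsympCentral.exists_scalar (hτ : τ.IsNormalTrace)
    (hcomm : HasTrivialRelativeCommutant ι) {U : Ultrafilter ℕ} {a : ℕ → A} {C : ℝ}
    (hC : ∀ n, ‖a n‖ ≤ C) (ha : AsympCentral τ ι U a) :
    ∃ z : ℂ, ∀ c, Tendsto (fun n => τ (c * a n)) U (𝓝 (τ c * z)) := by
  obtain ⟨w, -, hw⟩ := hτ.exists_weak_limit U a C hC
  obtain ⟨z, rfl⟩ := hcomm w fun y => by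
    apply hτ.eq_of_forall_apply_mul_eq
    intro c
    have h1 := hw (c * ι y)
    have h2 := hw (ι y * c)
    have h3 : Tendsto (fun n => τ (c * ι y * a n) - τ (ι y * c * a n)) U (𝓝 0) := by
      refine tendsto_zero_of_norm_le (v := fun n => τ.tnorm c * τ.tnorm (ι y * a n - a n * ι y))
        (fun n => ?_) (by simpa using (ha y).const_mul (τ.tnorm c))
      have h4 : τ (c * ι y * a n) - τ (ι y * c * a n) = τ (c * (ι y * a n - a n * ι y)) := by
        rw [mul_sub, map_sub, mul_assoc (ι y), hτ.tracial (ι y)]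
        simp only [mul_assoc]
      rw [h4]
      exact hτ.norm_apply_mul_le _ _
    have h5 := tendsto_nhds_unique h3 (h1.sub h2)
    rw [eq_comm, sub_eq_zero] at h5
    rw [← mul_assoc, h5, mul_assoc, hτ.tracial, mul_assoc]
  refine ⟨z, fun c => ?_⟩
  have := hw c
  rwa [mul_smul_comm, mul_one, map_smul, smul_eq_mul, mul_comm] at this

/-- Along each ultrafilter the scalar limit is also the limit of `τ (a n)`, by testing at `c = 1`.
Working with the difference avoids asking that `τ (a n)` converge. -/
theorem AsympCentral.tendsto_sub (hτ : τ.IsNormalTrace)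
    (hcomm : HasTrivialRelativeCommutant ι) {f : Filter ℕ} {a : ℕ → A} {C : ℝ}
    (hC : ∀ n, ‖a n‖ ≤ C) (ha : AsympCentral τ ι f a) (c : A) :
    Tendsto (fun n => τ (c * a n) - τ c * τ (a n)) f (𝓝 0) := by
  rw [tendsto_iff_ultrafilter]
  intro U hU
  obtain ⟨z, hz⟩ := exists_scalar hτ hcomm hC (fun y => (ha y).mono_left hU)
  have h1 := hz 1
  simp only [one_mul, hτ.map_one] at h1
  simpa using (hz c).sub (h1.const_mul (τ c))

theorem tnorm_commutator_star (hτ : τ.IsNormalTrace) (y x : A) :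
    τ.tnorm (y * star x - star x * y) = τ.tnorm (star y * x - x * star y) := by
  rw [← hτ.tnorm_star]
  simp only [star_sub, star_mul, star_star]
  exact tnorm_sub_comm _ _

theorem tnorm_commutator_mul_le (hτ : τ.IsNormalTrace) (y a b : A) :
    τ.tnorm (y * (a * b) - a * b * y) ≤
      τ.tnorm (y * a - a * y) * ‖b‖ + ‖a‖ * τ.tnorm (y * b - b * y) := by
  have h1 : y * (a * b) - a * b * y = (y * a - a * y) * b + a * (y * b - b * y) := by noncomm_ring
  rw [h1]
  exact (tnorm_add_le _ _).trans (add_le_add (hτ.tnorm_mul_le' _ _) (tnorm_mul_le _ _))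

theorem AsympCentral.mul (hτ : τ.IsNormalTrace) {f : Filter ℕ} {a b : ℕ → A} {C D : ℝ}
    (hC : ∀ n, ‖a n‖ ≤ C) (hD : ∀ n, ‖b n‖ ≤ D) (ha : AsympCentral τ ι f a)
    (hb : AsympCentral τ ι f b) : AsympCentral τ ι f fun n => a n * b n := fun y => by
  refine squeeze_zero (fun n => tnorm_nonneg _) (fun n => ?_)
    (by simpa using ((ha y).mul_const D).add ((hb y).const_mul C))
  exact (tnorm_commutator_mul_le hτ _ _ _).trans
    (add_le_add (mul_le_mul_of_nonneg_left (hD n) (tnorm_nonneg _))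
      (mul_le_mul_of_nonneg_right (hC n) (tnorm_nonneg _)))

theorem tnorm_commutator_smul (y x : A) (c : ℂ) :
    τ.tnorm (y * (c • x) - (c • x) * y) = ‖c‖ * τ.tnorm (y * x - x * y) := by
  rw [mul_smul_comm, smul_mul_assoc, ← smul_sub, tnorm_smul]

theorem tnorm_commutator_add_le (y a b : A) :
    τ.tnorm (y * (a + b) - (a + b) * y) ≤ τ.tnorm (y * a - a * y) + τ.tnorm (y * b - b * y) := by
  have h1 : y * (a + b) - (a + b) * y = (y * a - a * y) + (y * b - b * y) := by noncomm_ring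
  rw [h1]
  exact tnorm_add_le _ _

theorem coe_realPart (x : A) : ((realPart x : selfAdjoint A) : A) = (2⁻¹ : ℂ) • (x + star x) := by
  rw [realPart_apply_coe, ← Complex.coe_smul]
  simp

theorem coe_imaginaryPart (x : A) :
    ((imaginaryPart x : selfAdjoint A) : A) = (-(Complex.I * 2⁻¹)) • (x - star x) := by
  rw [imaginaryPart_apply_coe, ← Complex.coe_smul, smul_smul]
  simp

theorem tnorm_commutator_realPart_le (hτ : τ.IsNormalTrace) (y x : A) :
    τ.tnorm (y * (realPart x : selfAdjoint A) - (realPart x : selfAdjoint A) * y) ≤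
      2⁻¹ * (τ.tnorm (y * x - x * y) + τ.tnorm (star y * x - x * star y)) := by
  rw [coe_realPart, tnorm_commutator_smul, ← tnorm_commutator_star hτ]
  have := tnorm_commutator_add_le (τ := τ) y x (star x)
  norm_num
  linarith

theorem tnorm_commutator_imaginaryPart_le (hτ : τ.IsNormalTrace) (y x : A) :
    τ.tnorm (y * (imaginaryPart x : selfAdjoint A) - (imaginaryPart x : selfAdjoint A) * y) ≤
      2⁻¹ * (τ.tnorm (y * x - x * y) + τ.tnorm (star y * x - x * star y)) := by
  rw [coe_imaginaryPart, tnorm_commutator_smul, ← tnorm_commutator_star hτ]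
  have h1 := tnorm_commutator_add_le (τ := τ) y x ((-1 : ℂ) • star x)
  rw [tnorm_commutator_smul] at h1
  have h2 : x - star x = x + (-1 : ℂ) • star x := by simp [sub_eq_add_neg]
  rw [h2]
  simp at h1 ⊢
  linarith

/-- A bounded asymptotically central sequence, orthogonal to `B`, normalized in `2`-norm. -/
structure IsGammaSequence (τ : A →ₚ[ℂ] ℂ) (ι : B →⋆ₐ[ℂ] A) (E : A →ₗ[ℂ] B) (x : ℕ → A) : Prop where
  bounded : ∃ C : ℝ, ∀ n, ‖x n‖ ≤ C
  tnorm_eq_one : ∀ n, τ.tnorm (x n) = 1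
  condExp_eq_zero : ∀ n, E (x n) = 0
  asympCentral : AsympCentral τ ι atTop x

/-- The real or the imaginary part carries at least half of the squared `2`-norm; dividing by the
norm bound makes it a contraction. -/
theorem IsGammaSequence.exists_selfAdjoint (h : IsCondExp τ σ ι E) {x : ℕ → A}
    (hx : IsGammaSequence τ ι E x) : ∃ (z : ℕ → A) (ζ : ℝ), 0 < ζ ∧
      (∀ n, IsSelfAdjoint (z n) ∧ ‖z n‖ ≤ 1 ∧ ζ ≤ τ.tnorm (z n) ^ 2 ∧ E (z n) = 0) ∧
      AsympCentral τ ι atTop z := by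
  obtain ⟨C, hC⟩ := hx.bounded
  have hτ := h.trace
  have hC1 : 1 ≤ C := by
    rw [← hx.tnorm_eq_one 0]; exact (hτ.tnorm_le_norm _).trans (hC 0)
  have hEs : ∀ n, E (star (x n)) = 0 := fun n => by
    rw [h.condExp_star, hx.condExp_eq_zero, star_zero]
  have key : ∀ n, ∃ w : A, IsSelfAdjoint w ∧ ‖w‖ ≤ C ∧ 1 / 2 ≤ τ.tnorm w ^ 2 ∧ E w = 0 ∧
      ∀ y : B, τ.tnorm (ι y * w - w * ι y) ≤ 2⁻¹ * (τ.tnorm (ι y * x n - x n * ι y) +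
        τ.tnorm (ι (star y) * x n - x n * ι (star y))) := fun n => by
    have h1 := tnorm_real_part_sq_add (x := x n) hτ
    rw [hx.tnorm_eq_one] at h1
    rcases le_total (1 / 2) (τ.tnorm (realPart (x n) : selfAdjoint A) ^ 2) with h2 | h2
    · refine ⟨_, (realPart (x n)).2, (realPart.norm_le _).trans (hC n), h2, ?_, fun y => ?_⟩
      · rw [coe_realPart, map_smul, map_add, hEs, hx.condExp_eq_zero]; simp
      · rw [map_star]; exact tnorm_commutator_realPart_le hτ _ _
    · refine ⟨_, (imaginaryPart (x n)).2, (imaginaryPart.norm_le _).trans (hC n), by linarith, ?_,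
        fun y => ?_⟩
      · rw [coe_imaginaryPart, map_smul, map_sub, hEs, hx.condExp_eq_zero]; simp
      · rw [map_star]; exact tnorm_commutator_imaginaryPart_le hτ _ _
  choose w hw1 hw2 hw3 hw4 hw5 using key
  have hC0 : 0 < C := by linarith
  refine ⟨fun n => (C⁻¹ : ℝ) • w n, C⁻¹ ^ 2 * (1 / 2), by positivity,
    fun n => ⟨(IsSelfAdjoint.all _).smul (hw1 n), ?_, ?_, ?_⟩, fun y => ?_⟩
  · rw [norm_smul, Real.norm_of_nonneg (by positivity), inv_mul_le_one₀ hC0]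
    exact hw2 n
  · rw [tnorm_real_smul, mul_pow, sq_abs]
    exact mul_le_mul_of_nonneg_left (hw3 n) (by positivity)
  · beta_reduce
    rw [← Complex.coe_smul, map_smul, hw4, smul_zero]
  · have h1 : Tendsto (fun n => ‖((C⁻¹ : ℝ) : ℂ)‖ * (2⁻¹ * (τ.tnorm (ι y * x n - x n * ι y) +
        τ.tnorm (ι (star y) * x n - x n * ι (star y))))) atTop (𝓝 0) := by
      have := (((hx.asympCentral y).add (hx.asympCentral (star y))).const_mul (2⁻¹ : ℝ)).const_mul
        ‖((C⁻¹ : ℝ) : ℂ)‖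
      simpa using this
    refine squeeze_zero (fun n => tnorm_nonneg _) (fun n => ?_) h1
    beta_reduce
    rw [← Complex.coe_smul, tnorm_commutator_smul]
    exact mul_le_mul_of_nonneg_left (hw5 n y) (norm_nonneg _)

/-- From a gamma sequence one extracts almost central, almost orthogonal self-adjoint
contractions. -/
theorem IsGammaSequence.exists_almost_orthogonal (h : IsCondExp τ σ ι E)
    (hcomm : HasTrivialRelativeCommutant ι) {x : ℕ → A} (hx : IsGammaSequence τ ι E x) :
    ∃ ζ > 0, ∀ (F : Finset B) (ε : ℝ) (c : A), 0 < ε → ∃ z : ℕ → A,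
      (∀ n, IsSelfAdjoint (z n) ∧ ‖z n‖ ≤ 1 ∧ ζ ≤ τ.tnorm (z n) ^ 2 ∧
        (∀ y ∈ F, τ.tnorm (ι y * z n - z n * ι y) ≤ ε) ∧
        ‖τ (c * (z n * z n)) - τ c * τ (z n * z n)‖ ≤ ε) ∧
      ∀ m n, m ≠ n → ‖τ (c * (z m * z n))‖ ≤ ε := by
  have hτ := h.trace
  obtain ⟨z, ζ, hζ, hz, hzc⟩ := hx.exists_selfAdjoint h
  refine ⟨ζ, hζ, fun F ε c hε => ?_⟩
  have hz1 : ∀ n, ‖z n‖ ≤ 1 := fun n => (hz n).2.1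
  -- The scalar weak limit is zero, since vanishing expectation gives `τ (z n) = 0`.
  have hweak : ∀ d : A, Tendsto (fun n => τ (d * z n)) atTop (𝓝 0) := fun d => by
    have h1 := hzc.tendsto_sub hτ hcomm hz1 d
    refine h1.congr fun n => ?_
    rw [← h.apply_condExp (z n), (hz n).2.2.2, map_zero, mul_zero, sub_zero]
  have hsq := (hzc.mul hτ hz1 hz1 hzc).tendsto_sub hτ hcomm
    (C := 1) (fun n => (norm_mul_le _ _).trans (mul_le_one₀ (hz1 n) (norm_nonneg _) (hz1 n))) c
  have hev1 : ∀ᶠ n in atTop, ∀ y ∈ F, τ.tnorm (ι y * z n - z n * ι y) ≤ ε := by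
    rw [Filter.eventually_all_finset]
    exact fun y _ => (hzc y).eventually_le_const hε
  have hev2 : ∀ᶠ n in atTop, ‖τ (c * (z n * z n)) - τ c * τ (z n * z n)‖ ≤ ε := by
    have := hsq.norm
    rw [norm_zero] at this
    exact this.eventually_le_const hε
  have hev3 : ∀ d : A, ∀ᶠ n in atTop, ‖τ (d * z n)‖ ≤ ε := fun d => by
    have := (hweak d).norm
    rw [norm_zero] at this
    exact this.eventually_le_const hε
  -- By weak convergence to zero each new term can be taken almost orthogonal, in both orders, to
  -- the finitely many chosen before it.
  obtain ⟨f, hf, hf'⟩ := exists_seq_of_forall_finset_exists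
    (fun n => (∀ y ∈ F, τ.tnorm (ι y * z n - z n * ι y) ≤ ε) ∧
      ‖τ (c * (z n * z n)) - τ c * τ (z n * z n)‖ ≤ ε)
    (fun m n => ‖τ (c * (z m * z n))‖ ≤ ε ∧ ‖τ (c * (z n * z m))‖ ≤ ε) fun s _ => by
      have h1 : ∀ᶠ n in atTop, ∀ m ∈ s, ‖τ (c * (z m * z n))‖ ≤ ε ∧ ‖τ (c * (z n * z m))‖ ≤ ε := by
        rw [Filter.eventually_all_finset]
        intro m _
        filter_upwards [hev3 (c * z m), hev3 (z m * c)] with n h2 h3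
        rw [← mul_assoc]
        refine ⟨h2, ?_⟩
        rwa [← mul_assoc, hτ.tracial, ← mul_assoc]
      exact ((hev1.and hev2).and h1).exists
  refine ⟨fun n => z (f n), fun n => ⟨(hz _).1, hz1 _, (hz _).2.2.1, (hf n).1, (hf n).2⟩,
    fun m n hmn => ?_⟩
  rcases lt_or_gt_of_ne hmn with h1 | h1
  · exact (hf' m n h1).1
  · exact (hf' n m h1).2

end Central

end PositiveLinearMap

/-! ### Mixing by unitary conjugation -/

namespace PositiveLinearMap

universe u

section Mixing

set_option linter.unusedSectionVars false

variable {A : Type u} [CStarAlgebra A] [PartialOrder A] [StarOrderedRing A] {τ : A →ₚ[ℂ] ℂ}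
  {B : Type*} [CStarAlgebra B] [PartialOrder B] [StarOrderedRing B] {σ : B →ₚ[ℂ] ℂ}
  {ι : B →⋆ₐ[ℂ] A} {E : A →ₗ[ℂ] B}

/-- Arbitrarily long almost `B`-orthogonal families of contractions exist in `A`. -/
def HasAlmostOrthogonalFamilies (τ : A →ₚ[ℂ] ℂ) (σ : B →ₚ[ℂ] ℂ) (E : A →ₗ[ℂ] B) (ζ : ℝ) : Prop :=
  ∀ δ > 0, ∃ g : ℕ → A, (∀ n, ‖g n‖ ≤ 1 ∧ ζ ≤ τ.tnorm (g n) ^ 2) ∧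
    ∀ m n, m ≠ n → σ.tnorm (E (star (g m) * g n)) ≤ δ

/-- In a convex set of a normed space with an inner product, two vectors of equal and almost minimal
norm are close to each other. -/
theorem norm_sub_le_of_almost_minimal {K : Type*} [NormedAddCommGroup K] [InnerProductSpace ℂ K]
    {s t : K} {d η : ℝ} (hd : 0 ≤ d) (hη : 0 ≤ η) (hs : ‖s‖ ^ 2 ≤ d ^ 2 + η ^ 2)
    (ht : ‖t‖ ^ 2 ≤ d ^ 2 + η ^ 2) (hst : d ≤ ‖(2⁻¹ : ℝ) • s + (2⁻¹ : ℝ) • t‖) :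
    ‖s - t‖ ≤ 2 * η := by
  have h1 := parallelogram_law_with_norm ℂ s t
  have h2 : ‖(2⁻¹ : ℝ) • s + (2⁻¹ : ℝ) • t‖ = 2⁻¹ * ‖s + t‖ := by
    rw [← smul_add, norm_smul]; norm_num
  rw [h2] at hst
  have h3 : (2 * d) ^ 2 ≤ ‖s + t‖ ^ 2 := pow_le_pow_left₀ (by linarith) (by linarith) 2
  refine abs_le_of_sq_le_sq' ?_ (by linarith) |>.2
  nlinarith

namespace IsCondExp

variable (h : IsCondExp τ σ ι E)
include h

/-- The left side is the inner product of `Φ a (star a)` and `Φ b (star b)`, so norms of sums of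
such vectors measure expectations. -/
theorem apply_condExp_conj (a b : A) :
    τ (a * ι (E (star a * b)) * star b) = ((σ.tnorm (E (star a * b)) ^ 2 : ℝ) : ℂ) := by
  rw [tnorm_sq, ← h.condExp_star, h.apply_mul, h.trace.tracial, ← mul_assoc, star_mul, star_star]

theorem inner_fusion_conj {K : Type*} [NormedAddCommGroup K] [InnerProductSpace ℂ K]
    {Φ : A → A → K} (hΦ : ∀ a b a' b',
      inner ℂ (Φ a b) (Φ a' b') = τ (star b * ι (E (star a * a')) * b')) (u a b a' b' : A) :
    inner ℂ (Φ (u * a) (b * star u)) (Φ a' b') = inner ℂ (Φ a b) (Φ (star u * a') (b' * u)) := by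
  rw [hΦ, hΦ, star_mul, star_star, star_mul, mul_assoc, mul_assoc, h.trace.tracial]
  simp only [mul_assoc]

/-- Convex combinations of the conjugates of a vector of the relative tensor square which are almost
invariant under conjugation by unitaries. -/
theorem exists_almost_invariant {K : Type*} [NormedAddCommGroup K] [InnerProductSpace ℂ K]
    {Φ : A → A → K} (hΦ : ∀ a b a' b',
      inner ℂ (Φ a b) (Φ a' b') = τ (star b * ι (E (star a * a')) * b'))
    (V : unitary A → K) (L : Finset A)
    (hV : ∀ y, V y = ∑ b ∈ L, Φ (y * b) (star ((y : A) * b))) {η : ℝ} (hη : 0 < η) :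
    ∃ (n : Type) (_ : Fintype n) (w : n → ℝ) (y : n → unitary A), (∀ i, 0 ≤ w i) ∧
      ∑ i, w i = 1 ∧ ∀ u : unitary A,
        ‖∑ i, w i • V (u * y i) - ∑ i, w i • V (y i)‖ ≤ 2 * η := by
  classical
  have hinner : ∀ u y y' : unitary A, inner ℂ (V (u * y)) (V (u * y')) = inner ℂ (V y) (V y') := by
    intro u y y'
    have hVu : ∀ y, V (u * y) = ∑ b ∈ L, Φ (u * (y * b)) (star ((y : A) * b) * star (u : A)) :=
      fun y => by simp [hV, mul_assoc]
    simp only [hVu]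
    simp only [hV, sum_inner, inner_sum, h.inner_fusion_conj hΦ]
    have hu : star (u : A) * u = 1 := Unitary.coe_star_mul_self u
    simp only [mul_assoc, hu, ← mul_assoc (star (u : A)), one_mul, mul_one]
  set C : Set K := convexHull ℝ (Set.range V)
  have hCne : C.Nonempty := ⟨V 1, subset_convexHull ℝ _ ⟨1, rfl⟩⟩
  set d := sInf ((fun s => ‖s‖) '' C)
  have hbdd : BddBelow ((fun s : K => ‖s‖) '' C) :=
    ⟨0, by rintro _ ⟨s, -, rfl⟩; exact norm_nonneg s⟩
  have hd : ∀ s ∈ C, d ≤ ‖s‖ := fun s hs => csInf_le hbdd ⟨s, hs, rfl⟩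
  have hd0 : 0 ≤ d := Real.sInf_nonneg (by rintro _ ⟨s, -, rfl⟩; exact norm_nonneg s)
  have hlt : d < √(d ^ 2 + η ^ 2) := Real.lt_sqrt_of_sq_lt (by nlinarith)
  obtain ⟨_, ⟨s, hs, rfl⟩, hsd⟩ := exists_lt_of_csInf_lt (hCne.image _) hlt
  have hs2 : ‖s‖ ^ 2 ≤ d ^ 2 + η ^ 2 := by
    rw [← Real.sq_sqrt (show 0 ≤ d ^ 2 + η ^ 2 by positivity)]
    exact pow_le_pow_left₀ (norm_nonneg _) hsd.le 2
  obtain ⟨n, hn, w, z, hw0, hw1, hz, rfl⟩ := mem_convexHull_iff_exists_fintype.mp hs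
  choose y hy using hz
  refine ⟨n, hn, w, y, hw0, hw1, fun u => ?_⟩
  have heq : ∑ i, w i • V (y i) = ∑ i, w i • z i := Finset.sum_congr rfl fun i _ => by rw [hy]
  have hmem : ∑ i, w i • V (u * y i) ∈ C :=
    (convex_convexHull ℝ _).sum_mem (fun i _ => hw0 i) hw1
      fun i _ => subset_convexHull ℝ _ ⟨_, rfl⟩
  rw [← heq] at hs hs2
  have hnorm : ‖∑ i, w i • V (u * y i)‖ = ‖∑ i, w i • V (y i)‖ := by
    rw [← sq_eq_sq₀ (norm_nonneg _) (norm_nonneg _), ← inner_self_eq_norm_sq (𝕜 := ℂ),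
      ← inner_self_eq_norm_sq (𝕜 := ℂ)]
    simp only [← Complex.coe_smul, sum_inner, inner_sum, inner_smul_left, inner_smul_right, hinner]
  -- Conjugation preserves norms, so the combination and its conjugate are both almost minimal, and
  -- their midpoint lies in the convex set.
  refine norm_sub_le_of_almost_minimal hd0 hη.le (by rwa [hnorm]) hs2 (hd _ ?_)
  exact convex_convexHull ℝ _ hmem hs (by norm_num) (by norm_num) (by norm_num)

/-- The average over suitable unitaries of the expectation of a two-sided translate is small. -/
theorem exists_small_average (hcomm : HasTrivialRelativeCommutant ι) {ζ : ℝ} (hζ : 0 < ζ)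
    (hG : HasAlmostOrthogonalFamilies τ σ E ζ) (L : Finset A) {δ : ℝ} (hδ : 0 < δ) :
    ∃ (n : Type) (_ : Fintype n) (w : n → ℝ) (y : n → unitary A), (∀ i, 0 ≤ w i) ∧
      ∑ i, w i = 1 ∧ ∑ i, ∑ j, w i * w j * ∑ b ∈ L, ∑ c ∈ L,
        σ.tnorm (E (star ((y i : A) * b) * ((y j : A) * c))) ^ 2 ≤ δ := by
  classical
  obtain ⟨K, _, _, Φ, hΦ⟩ := h.exists_fusion
  have hτ := h.trace
  -- `V y` is the conjugate of `V 1` by `y`. The squared norm of an average of these vectors is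
  -- exactly the double sum to be bounded.
  let V : unitary A → K := fun y => ∑ b ∈ L, Φ (y * b) (star ((y : A) * b))
  have hV : ∀ y, V y = ∑ b ∈ L, Φ (y * b) (star ((y : A) * b)) := fun _ => rfl
  choose n hn w y hw0 hw1 hinv using fun m : ℕ =>
    h.exists_almost_invariant hΦ V L hV (η := 1 / ((m : ℝ) + 1)) (by positivity)
  set η : ℕ → ℝ := fun m => 2 * (1 / ((m : ℝ) + 1)) with hη
  have hη0 : Tendsto η atTop (𝓝 0) := by
    simpa [hη] using (tendsto_one_div_add_atTop_nhds_zero_nat (𝕜 := ℝ)).const_mul (2 : ℝ)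
  set S : ℕ → K := fun m => ∑ i, w m i • V (y m i) with hS
  set SU : ℕ → unitary A → K := fun m u => ∑ i, w m i • V (u * y m i) with hSU
  have hconjV : ∀ (u x : unitary A) (a b : A),
      inner ℂ (Φ (u * a) (b * star (u : A))) (V x) = inner ℂ (Φ a b) (V (star u * x)) := by
    intro u x a b
    simp only [hV, inner_sum, h.inner_fusion_conj hΦ]
    simp [mul_assoc]
  have hconj : ∀ m (u : unitary A) (a b : A),
      inner ℂ (Φ (u * a) (b * star (u : A))) (S m) = inner ℂ (Φ a b) (SU m (star u)) := by
    intro m u a b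
    simp only [hS, hSU, inner_sum, ← Complex.coe_smul, inner_smul_right, hconjV]
  have hSUS : ∀ m (u : unitary A) (v : K), ‖inner ℂ v (SU m u) - inner ℂ v (S m)‖ ≤ ‖v‖ * η m := by
    intro m u v
    rw [← inner_sub_right]
    exact (norm_inner_le_norm _ _).trans (mul_le_mul_of_nonneg_left (hinv m u) (norm_nonneg _))
  -- `Z m` is the bounded element of `A` that represents the pairings of `S m` with the vectors `Φ 1
  -- c`.
  set Z : ℕ → A := fun m => ∑ i, w m i • ∑ b ∈ L, ι (E ((y m i : A) * b)) * star ((y m i : A) * b)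
    with hZ
  have hZS : ∀ m c, inner ℂ (Φ 1 c) (S m) = τ (star c * Z m) := by
    intro m c
    simp only [hS, hZ, hV, inner_sum, ← Complex.coe_smul, inner_smul_right, hΦ, star_one, one_mul,
      Finset.mul_sum, map_sum, mul_smul_comm, map_smul, smul_eq_mul, mul_assoc]
  have hZn : ∀ m, ‖Z m‖ ≤ ∑ b ∈ L, ‖b‖ * ‖b‖ := by
    intro m
    have h1 : ∀ i, ‖w m i • ∑ b ∈ L, ι (E ((y m i : A) * b)) * star ((y m i : A) * b)‖ ≤
        w m i * ∑ b ∈ L, ‖b‖ * ‖b‖ := fun i => by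
      rw [norm_smul, Real.norm_of_nonneg (hw0 m i)]
      refine mul_le_mul_of_nonneg_left ((norm_sum_le _ _).trans (Finset.sum_le_sum fun b _ => ?_))
        (hw0 m i)
      refine (norm_mul_le _ _).trans (mul_le_mul ?_ ?_ (norm_nonneg _) (norm_nonneg _))
      · refine (norm_map_le _).trans ((h.norm_le _).trans ?_)
        rw [CStarRing.norm_coe_unitary_mul]
      · rw [norm_star, CStarRing.norm_coe_unitary_mul]
    refine (norm_sum_le _ _).trans ((Finset.sum_le_sum fun i _ => h1 i).trans ?_)
    rw [← Finset.sum_mul, hw1, one_mul]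
  have hΦ1 : ∀ c, ‖Φ 1 c‖ = τ.tnorm c := by
    intro c
    rw [← sq_eq_sq₀ (norm_nonneg _) (tnorm_nonneg _), ← inner_self_eq_norm_sq (𝕜 := ℂ), hΦ,
      tnorm_sq_re]
    have h1 : E 1 = 1 := by simpa using h.condExp_map 1
    simp [h1]
  have hZc : AsympCentral τ ι atTop Z := by
    intro x
    have hx : x ∈ Submodule.span ℂ (unitary B : Set B) := by
      rw [CStarAlgebra.span_unitary]; trivial
    induction hx using Submodule.span_induction with
    | zero => simp [tnorm_zero]
    | add a b _ _ ha hb =>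
      refine squeeze_zero (fun n => tnorm_nonneg _) (fun n => ?_) (by simpa using ha.add hb)
      have h1 : ι (a + b) * Z n - Z n * ι (a + b) =
          (ι a * Z n - Z n * ι a) + (ι b * Z n - Z n * ι b) := by
        rw [map_add]; noncomm_ring
      rw [h1]
      exact tnorm_add_le _ _
    | smul c a _ ha =>
      have h1 := ha.const_mul ‖c‖
      rw [mul_zero] at h1
      refine h1.congr fun n => ?_
      rw [map_smul, smul_mul_assoc, mul_smul_comm, ← smul_sub, tnorm_smul]
    | mem v hv =>
      let v' : unitary A := ⟨ι v, by
        have h2 := Unitary.mem_iff.mp hv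
        rw [Unitary.mem_iff, ← map_star, ← map_mul, ← map_mul, h2.1, h2.2, map_one]
        exact ⟨rfl, rfl⟩⟩
      have hv1 : ι v * star (ι v) = 1 := Unitary.coe_mul_star_self v'
      have hv2 : star (ι v) * ι v = 1 := Unitary.coe_star_mul_self v'
      refine squeeze_zero (fun m => tnorm_nonneg _) (fun m => ?_) hη0
      set D := ι v * Z m * star (ι v) - Z m with hD
      have h1 : ∀ c, inner ℂ (Φ (star (ι v)) (c * ι v)) (S m) =
          τ (star c * (ι v * Z m * star (ι v))) := by
        intro c
        -- Factors from `B` pass through the middle of the relative tensor product.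
        have h2 : inner ℂ (Φ (star (ι v)) (c * ι v)) (S m) =
            inner ℂ (Φ 1 (star (ι v) * c * ι v)) (S m) := by
          simp only [hS, hV, inner_sum, ← Complex.coe_smul, inner_smul_right, hΦ, star_one, one_mul,
            star_star, h.condExp_map_mul, map_mul, star_mul, mul_assoc]
        rw [h2, hZS, star_mul, star_mul, star_star, mul_assoc, hτ.tracial]
        simp only [mul_assoc]
      have h3 : ∀ c, ‖τ (star c * D)‖ ≤ τ.tnorm c * η m := by
        intro c
        have h4 := hconj m (star v') 1 c
        rw [mul_one, star_star] at h4
        have h5 := hSUS m v' (Φ 1 c)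
        rw [← h4, hZS, hΦ1] at h5
        have h6 : inner ℂ (Φ ((star v' : unitary A) : A) (c * star ((star v' : unitary A) : A)))
            (S m) = τ (star c * (ι v * Z m * star (ι v))) := by
          rw [← h1]; simp [v']
        rw [h6] at h5
        rwa [hD, mul_sub, map_sub]
      have h7 : τ.tnorm D ≤ η m := by
        have h8 := h3 D
        rw [← tnorm_sq, Complex.norm_real, Real.norm_of_nonneg (sq_nonneg _)] at h8
        by_contra! hc
        have : 0 ≤ η m := by positivity
        nlinarith
      have h9 : ι v * Z m - Z m * ι v = D * ι v := by
        rw [hD, sub_mul, mul_assoc, hv2, mul_one]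
      rw [h9]
      refine (hτ.tnorm_mul_le' _ _).trans ?_
      have h10 : ‖ι v‖ ≤ 1 := by
        have := hτ.nontrivial
        exact (CStarRing.norm_of_mem_unitary v'.2).le
      exact (mul_le_of_le_one_right (tnorm_nonneg _) h10).trans h7
  -- For unitary `u`, `Φ u c` is the conjugate by `u` of `Φ 1 (c * u)`, so almost invariance of `S
  -- m` reduces the pairing to `Z m`; the unitaries span `A`.
  have hlim : ∀ g c, Tendsto (fun m => inner ℂ (Φ g c) (S m) - τ (star (c * g) * Z m)) atTop
      (𝓝 0) := by
    intro g
    have hg : g ∈ Submodule.span ℂ (unitary A : Set A) := by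
      rw [CStarAlgebra.span_unitary]; trivial
    induction hg using Submodule.span_induction with
    | zero =>
      intro c
      have h1 : ∀ a b, inner ℂ (Φ 0 c) (Φ a b) = 0 := fun a b => by simp [hΦ]
      simp only [hS, hV, inner_sum, ← Complex.coe_smul, inner_smul_right, h1]
      simp
    | add a b _ _ ha hb =>
      intro c
      have h1 := (ha c).add (hb c)
      rw [add_zero] at h1
      refine h1.congr fun m => ?_
      simp only [hS, hV, inner_sum, ← Complex.coe_smul, inner_smul_right, hΦ, star_add, add_mul,
        mul_add, map_add, Finset.sum_add_distrib]
      ring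
    | smul d a _ ha =>
      intro c
      have h1 := (ha c).const_mul (star d)
      rw [mul_zero] at h1
      refine h1.congr fun m => ?_
      simp only [hS, hV, inner_sum, ← Complex.coe_smul, inner_smul_right, hΦ, star_smul,
        smul_mul_assoc, mul_smul_comm, map_smul, smul_eq_mul, ← Finset.mul_sum]
      simp only [mul_left_comm _ (star d), ← Finset.mul_sum]
      ring
    | mem u hu =>
      intro c
      have h1 : Tendsto (fun m => τ.tnorm (c * u) * η m) atTop (𝓝 0) := by
        simpa using hη0.const_mul (τ.tnorm (c * u))
      refine tendsto_zero_of_norm_le (fun m => ?_) h1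
      have h2 := hconj m ⟨u, hu⟩ 1 (c * u)
      have h3 := hSUS m (star ⟨u, hu⟩) (Φ 1 (c * u))
      rw [← h2, hZS, hΦ1] at h3
      simpa [mul_assoc, (Unitary.mem_iff.mp hu).2] using h3
  have hlim' : ∀ g c, Tendsto (fun m => inner ℂ (Φ g c) (S m) - τ (star (c * g)) * τ (Z m)) atTop
      (𝓝 0) := by
    intro g c
    have h1 := (hlim g c).add (hZc.tendsto_sub hτ hcomm hZn (star (c * g)))
    rw [add_zero] at h1
    exact h1.congr fun m => by ring
  set R : ℝ := ∑ b ∈ L, ‖Φ b (star b)‖ with hR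
  have hR0 : 0 ≤ R := Finset.sum_nonneg fun _ _ => norm_nonneg _
  have hVn : ∀ x, ‖V x‖ ≤ R := by
    intro x
    refine (norm_sum_le _ _).trans (Finset.sum_le_sum fun b _ => le_of_eq ?_)
    rw [← sq_eq_sq₀ (norm_nonneg _) (norm_nonneg _), ← inner_self_eq_norm_sq (𝕜 := ℂ),
      ← inner_self_eq_norm_sq (𝕜 := ℂ), star_mul, h.inner_fusion_conj hΦ]
    simp [mul_assoc, ← mul_assoc (star (x : A))]
  have hSn : ∀ m, ‖S m‖ ≤ R := by
    intro m
    refine (norm_sum_le _ _).trans ?_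
    have h1 : ∀ i, ‖w m i • V (y m i)‖ ≤ w m i * R := fun i => by
      rw [norm_smul, Real.norm_of_nonneg (hw0 m i)]
      exact mul_le_mul_of_nonneg_left (hVn _) (hw0 m i)
    refine (Finset.sum_le_sum fun i _ => h1 i).trans ?_
    rw [← Finset.sum_mul, hw1, one_mul]
  -- Sum `k` almost orthogonal vectors `Φ (g i) (star (g i))`. The norm of the sum is of order `√k`,
  -- whereas its pairing with `S m` is at least about `k * ζ * ‖τ (Z m)‖`. As `S m` is bounded, a
  -- large `k` forces `τ (Z m)` to be small.
  have hZ0 : Tendsto (fun m => τ (Z m)) atTop (𝓝 0) := by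
    rw [Metric.tendsto_nhds]
    intro ε hε
    obtain ⟨k, hk⟩ := exists_nat_gt (((2 * R + 1) / (ε * ζ)) ^ 2 + 1)
    have hk1 : (1 : ℝ) < k := by nlinarith [sq_nonneg ((2 * R + 1) / (ε * ζ))]
    have hk0 : (0 : ℝ) < k := by linarith
    obtain ⟨g, hg, hg'⟩ := hG (1 / √k) (by positivity)
    set G := ∑ i ∈ Finset.range k, Φ (g i) (star (g i)) with hGdef
    have hGn : ‖G‖ ^ 2 ≤ 2 * k := by
      have h1 : (inner ℂ G G) = ((∑ i ∈ Finset.range k, ∑ j ∈ Finset.range k,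
          σ.tnorm (E (star (g i) * g j)) ^ 2 : ℝ) : ℂ) := by
        simp only [hGdef, sum_inner, inner_sum, hΦ, star_star, h.apply_condExp_conj,
          Complex.ofReal_sum]
        exact Finset.sum_comm
      rw [← inner_self_eq_norm_sq (𝕜 := ℂ), h1]
      change (∑ i ∈ Finset.range k, ∑ j ∈ Finset.range k,
          σ.tnorm (E (star (g i) * g j)) ^ 2 : ℝ) ≤ 2 * k
      have h2 : ∀ i j, σ.tnorm (E (star (g i) * g j)) ^ 2 ≤ (if i = j then 1 else 0) + 1 / k := by
        intro i j
        split_ifs with hij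
        · have h3 : σ.tnorm (E (star (g i) * g j)) ≤ 1 := by
            refine (h.tnorm_le _).trans ((hτ.tnorm_le_norm _).trans ((norm_mul_le _ _).trans ?_))
            rw [norm_star]
            exact mul_le_one₀ (hg i).1 (norm_nonneg _) (hg j).1
          have h4 := pow_le_pow_left₀ (tnorm_nonneg _) h3 2
          have : 0 < 1 / (k : ℝ) := by positivity
          linarith
        · have h4 := pow_le_pow_left₀ (tnorm_nonneg _) (hg' i j hij) 2
          rwa [div_pow, one_pow, Real.sq_sqrt hk0.le, ← zero_add (1 / (k : ℝ))] at h4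
      refine (Finset.sum_le_sum fun i _ => Finset.sum_le_sum fun j _ => h2 i j).trans ?_
      have h5 : ∀ i ∈ Finset.range k, ∑ j ∈ Finset.range k,
          ((if i = j then (1 : ℝ) else 0) + 1 / k) = 2 := fun i hi => by
        rw [Finset.sum_add_distrib, Finset.sum_ite_eq, if_pos hi, Finset.sum_const,
          Finset.card_range, nsmul_eq_mul, mul_one_div_cancel hk0.ne']
        norm_num
      rw [Finset.sum_congr rfl h5]
      simp [mul_comm]
    have hGn' : ‖G‖ ≤ 2 * √k := by
      refine abs_le_of_sq_le_sq' ?_ (by positivity) |>.2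
      rw [mul_pow, Real.sq_sqrt hk0.le]
      linarith
    have h1 : Tendsto (fun m => inner ℂ G (S m) -
        (∑ i ∈ Finset.range k, τ (star (g i) * g i)) * τ (Z m)) atTop (𝓝 0) := by
      have h2 := tendsto_finsetSum (Finset.range k) fun i _ => hlim' (g i) (star (g i))
      simp only [Finset.sum_const_zero] at h2
      refine h2.congr fun m => ?_
      rw [Finset.sum_sub_distrib, hGdef, sum_inner, Finset.sum_mul]
      simp
    have h2 := (Metric.tendsto_nhds.mp h1) 1 one_pos
    filter_upwards [h2] with m hm
    rw [dist_zero_right] at hm ⊢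
    have h3 : (∑ i ∈ Finset.range k, τ (star (g i) * g i)) =
        ((∑ i ∈ Finset.range k, τ.tnorm (g i) ^ 2 : ℝ) : ℂ) := by
      rw [Complex.ofReal_sum]
      exact Finset.sum_congr rfl fun i _ => (tnorm_sq _).symm
    have h4 : (k : ℝ) * ζ ≤ ∑ i ∈ Finset.range k, τ.tnorm (g i) ^ 2 := by
      have := Finset.card_nsmul_le_sum (Finset.range k) (fun i => τ.tnorm (g i) ^ 2) ζ
        fun i _ => (hg i).2
      simpa using this
    rw [h3] at hm
    have h5 : (k : ℝ) * ζ * ‖τ (Z m)‖ < 2 * √k * R + 1 := by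
      have h6 := norm_sub_norm_le
        (((∑ i ∈ Finset.range k, τ.tnorm (g i) ^ 2 : ℝ) : ℂ) * τ (Z m)) (inner ℂ G (S m))
      rw [norm_sub_rev, norm_mul, Complex.norm_real,
        Real.norm_of_nonneg (le_trans (by positivity) h4)] at h6
      have h7 := norm_inner_le_norm (𝕜 := ℂ) G (S m)
      have h8 := mul_le_mul hGn' (hSn m) (norm_nonneg _) (by positivity)
      have h9 := mul_le_mul_of_nonneg_right h4 (norm_nonneg (τ (Z m)))
      linarith
    have h6 : (2 * R + 1) / (ε * ζ) < √k := by
      refine Real.lt_sqrt_of_sq_lt (by linarith)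
    rw [div_lt_iff₀ (by positivity)] at h6
    have h7 : 1 ≤ √(k : ℝ) := Real.one_le_sqrt.mpr hk1.le
    have h8 : √(k : ℝ) * √k = k := Real.mul_self_sqrt hk0.le
    by_contra! hc
    have h9 : (k : ℝ) * ζ * ε ≤ k * ζ * ‖τ (Z m)‖ :=
      mul_le_mul_of_nonneg_left hc (by positivity)
    nlinarith [mul_lt_mul_of_pos_left h6 (by linarith : 0 < √(k : ℝ))]
  have hV1 : Tendsto (fun m => ‖inner ℂ (V 1) (S m)‖ + ‖V 1‖ * η m) atTop (𝓝 0) := by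
    have h1 : ∀ b : A, Tendsto (fun m => inner ℂ (Φ b (star b)) (S m)) atTop (𝓝 0) := by
      intro b
      have h2 := (hlim' b (star b)).add (hZ0.const_mul (τ (star (star b * b))))
      rw [mul_zero, add_zero] at h2
      exact h2.congr fun m => by ring
    have h2 := tendsto_finsetSum L fun b _ => h1 b
    rw [Finset.sum_const_zero] at h2
    have h3 := h2.norm.add (hη0.const_mul ‖V 1‖)
    rw [norm_zero, mul_zero, add_zero] at h3
    refine h3.congr fun m => ?_
    simp [hV]
  -- By almost invariance every `V x` pairs with `S m` nearly as `V 1` does, and `S m` is an average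
  -- of such vectors.
  have hSle : ∀ m, ‖S m‖ ^ 2 ≤ ‖inner ℂ (V 1) (S m)‖ + ‖V 1‖ * η m := by
    intro m
    have h1 : ∀ x : unitary A, ‖inner ℂ (V x) (S m)‖ ≤ ‖inner ℂ (V 1) (S m)‖ + ‖V 1‖ * η m := by
      intro x
      have h2 : inner ℂ (V x) (S m) = inner ℂ (V 1) (SU m (star x)) := by
        have h3 : ∀ b, Φ ((x : A) * b) (star ((x : A) * b)) = Φ (x * b) (star b * star (x : A)) :=
          fun b => by rw [star_mul]
        simp only [hV x, hV 1, h3, sum_inner, hconj]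
        simp
      have h4 := hSUS m (star x) (V 1)
      rw [h2]
      have h5 := norm_sub_norm_le (inner ℂ (V 1) (SU m (star x))) (inner ℂ (V 1) (S m))
      linarith
    have h2 : ∀ v, inner ℂ (S m) v = ∑ i, (w m i : ℂ) * inner ℂ (V (y m i)) v := fun v => by
      simp only [hS, sum_inner, ← Complex.coe_smul, inner_smul_left, Complex.conj_ofReal]
    rw [← inner_self_eq_norm_sq (𝕜 := ℂ), h2]
    refine (RCLike.re_le_norm _).trans ((norm_sum_le _ _).trans ?_)
    have h3 : ∀ i, ‖(w m i : ℂ) * inner ℂ (V (y m i)) (S m)‖ ≤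
        w m i * (‖inner ℂ (V 1) (S m)‖ + ‖V 1‖ * η m) := fun i => by
      rw [norm_mul, Complex.norm_real, Real.norm_of_nonneg (hw0 m i)]
      exact mul_le_mul_of_nonneg_left (h1 _) (hw0 m i)
    refine (Finset.sum_le_sum fun i _ => h3 i).trans ?_
    rw [← Finset.sum_mul, hw1, one_mul]
  obtain ⟨m, hm⟩ := (hV1.eventually_le_const hδ).exists
  refine ⟨n m, hn m, w m, y m, hw0 m, hw1 m, ?_⟩
  have hVV : ∀ x x' : unitary A, inner ℂ (V x) (V x') =
      ((∑ b ∈ L, ∑ c ∈ L, σ.tnorm (E (star ((x : A) * b) * ((x' : A) * c))) ^ 2 : ℝ) : ℂ) := by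
    intro x x'
    simp only [hV, sum_inner, inner_sum, hΦ, star_star, h.apply_condExp_conj, Complex.ofReal_sum]
    exact Finset.sum_comm
  have h1 : inner ℂ (S m) (S m) = ((∑ i, ∑ j, w m i * w m j * ∑ b ∈ L, ∑ c ∈ L,
        σ.tnorm (E (star ((y m i : A) * b) * ((y m j : A) * c))) ^ 2 : ℝ) : ℂ) := by
    simp only [hS, sum_inner, inner_sum, ← Complex.coe_smul, inner_smul_left, inner_smul_right,
      Complex.conj_ofReal, hVV]
    push_cast
    rw [Finset.sum_comm]
    refine Finset.sum_congr rfl fun i _ => ?_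
    simp only [Finset.mul_sum]
    refine Finset.sum_congr rfl fun j _ => Finset.sum_congr rfl fun b _ =>
      Finset.sum_congr rfl fun c _ => by ring
  have h2 := (hSle m).trans hm
  rw [← inner_self_eq_norm_sq (𝕜 := ℂ), h1] at h2
  exact h2

/-- A unitary for which the two-sided translates of a finite set have small expectation, although
a given compression of it is not small. -/
theorem exists_unitary_small_condExp (hcomm : HasTrivialRelativeCommutant ι) {ζ : ℝ} (hζ : 0 < ζ)
    (hG : HasAlmostOrthogonalFamilies τ σ E ζ) (L : Finset A) {δ : ℝ} (hδ : 0 < δ) {b : A}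
    (hb : IsSelfAdjoint b) (hb1 : ‖b‖ ≤ 1) {t : ℝ} (ht : 0 < t) (htb : t ≤ τ.tnorm b ^ 2) :
    ∃ u : unitary A, (∀ c ∈ L, ∀ d ∈ L, σ.tnorm (E (star c * u * d)) ≤ δ) ∧
      t ^ 2 / 2 ≤ τ.tnorm (b * u * b) ^ 2 := by
  have hτ := h.trace
  have hu1 : ∀ u : unitary A, τ.tnorm (b * u * b) ^ 2 ≤ 1 := fun u => by
    have h0 : ‖b * (u : A)‖ ≤ 1 := by rw [CStarRing.norm_mul_coe_unitary]; exact hb1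
    have h1 : τ.tnorm (b * u * b) ≤ 1 :=
      (hτ.tnorm_le_norm _).trans ((norm_mul_le _ _).trans (mul_le_one₀ h0 (norm_nonneg _) hb1))
    exact pow_le_one₀ (tnorm_nonneg _) h1
  set r : ℝ := t ^ 2 / 4 * δ ^ 2 with hr
  have hr0 : 0 < r := by positivity
  obtain ⟨n, _, w, y, hw0, hw1, hsum⟩ := h.exists_small_average hcomm hζ hG L hr0
  set Q : n → n → ℝ := fun i j => ∑ c ∈ L, ∑ d ∈ L,
    σ.tnorm (E (star ((y i : A) * c) * ((y j : A) * d))) ^ 2 with hQ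
  set P : n → n → ℝ := fun i j => τ.tnorm (b * (star (y i : A) * y j) * b) ^ 2 with hP
  have hbs := hb.star_eq
  -- The sum is the squared `2`-norm of the average of the conjugates of `b * b`, whose trace is
  -- still `τ (b * b) ≥ t`.
  have hPsum : t ^ 2 ≤ ∑ i, ∑ j, w i * w j * P i j := by
    set W : A := ∑ i, w i • ((y i : A) * (b * b) * star (y i : A)) with hW
    have hterm : ∀ i, τ ((y i : A) * (b * b) * star (y i : A)) = τ (b * b) := fun i => by
      rw [hτ.tracial, ← mul_assoc, Unitary.coe_star_mul_self, one_mul]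
    have hτW : τ W = τ (b * b) := by
      simp only [hW, map_sum, ← Complex.coe_smul, map_smul, hterm, smul_eq_mul, ← Finset.sum_mul,
        ← Complex.ofReal_sum, hw1]
      simp
    have hbb : τ (b * b) = ((τ.tnorm b ^ 2 : ℝ) : ℂ) := by rw [tnorm_sq, hbs]
    have hWs : star W = W := by
      simp only [hW, star_sum, star_smul, star_mul, star_star, star_trivial, hbs, mul_assoc]
    have h1 : t ≤ τ.tnorm W := by
      refine htb.trans ?_
      have h2 := hτ.norm_apply_le_tnorm W
      rwa [hτW, hbb, Complex.norm_real, Real.norm_of_nonneg (sq_nonneg _)] at h2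
    have h2 : τ.tnorm W ^ 2 = ∑ i, ∑ j, w i * w j * P i j := by
      have h3 : ((τ.tnorm W ^ 2 : ℝ) : ℂ) = ((∑ i, ∑ j, w i * w j * P i j : ℝ) : ℂ) := by
        rw [tnorm_sq, hWs]
        rw [hW, Finset.sum_mul_sum, map_sum]
        push_cast
        refine Finset.sum_congr rfl fun i _ => ?_
        rw [map_sum]
        refine Finset.sum_congr rfl fun j _ => ?_
        have h4 : ((P i j : ℝ) : ℂ) = τ ((y i : A) * (b * b) * star (y i : A) *
            ((y j : A) * (b * b) * star (y j : A))) := by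
          have h5 : star (b * (star (y i : A) * y j) * b) * (b * (star (y i : A) * y j) * b) =
              b * star (y j : A) * ((y i : A) * (b * b) * star (y i : A) * (y j * b)) := by
            simp only [star_mul, star_star, hbs, mul_assoc]
          rw [hP, tnorm_sq, h5, hτ.tracial]
          simp only [mul_assoc]
        rw [smul_mul_smul_comm, ← Complex.coe_smul, map_smul, smul_eq_mul, h4]
        push_cast
        ring
      exact_mod_cast h3
    rw [← h2]
    exact pow_le_pow_left₀ ht.le h1 2
  -- Otherwise `P ≤ t ^ 2 / 2 + Q / δ ^ 2` for all pairs, because `P ≤ 1`, and averaging would give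
  -- `t ^ 2 ≤ 3 / 4 * t ^ 2` by the choice of `r`.
  obtain ⟨i, j, hij⟩ : ∃ i j, Q i j ≤ δ ^ 2 * 1 ∧ t ^ 2 / 2 ≤ P i j := by
    by_contra! hcon
    have h1 : ∀ i j, w i * w j * P i j ≤ w i * w j * (t ^ 2 / 2) + w i * w j * Q i j / δ ^ 2 := by
      intro i j
      have hww : 0 ≤ w i * w j := mul_nonneg (hw0 i) (hw0 j)
      have hQ0 : 0 ≤ Q i j := Finset.sum_nonneg fun _ _ => Finset.sum_nonneg fun _ _ => sq_nonneg _
      rw [mul_div_assoc, ← mul_add]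
      refine mul_le_mul_of_nonneg_left ?_ hww
      by_cases hq : Q i j ≤ δ ^ 2 * 1
      · have := hcon i j hq
        have : 0 ≤ Q i j / δ ^ 2 := by positivity
        linarith
      · have h2 : 1 ≤ Q i j / δ ^ 2 := by
          rw [le_div_iff₀ (by positivity)]; linarith
        have h3 := hu1 (star (y i) * y j)
        have h4 : 0 < t ^ 2 / 2 := by positivity
        have h5 : P i j ≤ 1 := by simpa [hP] using h3
        linarith
    have h2 : ∑ i, ∑ j, w i * w j * P i j ≤ t ^ 2 / 2 + r / δ ^ 2 := by
      refine (Finset.sum_le_sum fun i _ => Finset.sum_le_sum fun j _ => h1 i j).trans ?_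
      simp only [Finset.sum_add_distrib, ← Finset.sum_mul, ← Finset.mul_sum, ← Finset.sum_div, hw1,
        mul_one, one_mul]
      gcongr
    have h3 : r / δ ^ 2 = t ^ 2 / 4 := by rw [hr]; field_simp
    nlinarith [sq_pos_of_pos ht]
  refine ⟨star (y i) * y j, fun c hc d hd => ?_, by simpa [hP] using hij.2⟩
  have h1 : σ.tnorm (E (star ((y i : A) * c) * ((y j : A) * d))) ^ 2 ≤ Q i j :=
    (Finset.single_le_sum (f := fun d => σ.tnorm (E (star ((y i : A) * c) * ((y j : A) * d))) ^ 2)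
      (fun _ _ => sq_nonneg _) hd).trans
      (Finset.single_le_sum (f := fun c => ∑ d ∈ L,
        σ.tnorm (E (star ((y i : A) * c) * ((y j : A) * d))) ^ 2)
        (fun _ _ => Finset.sum_nonneg fun _ _ => sq_nonneg _) hc)
  have h2 := h1.trans hij.1
  rw [mul_one] at h2
  have h3 := abs_le_of_sq_le_sq' h2 hδ.le |>.2
  simpa [mul_assoc] using h3

end IsCondExp

end Mixing

end PositiveLinearMap

/-! ### Pushing self-adjoint contractions towards unitaries -/

namespace PositiveLinearMap

universe u

section Increment

set_option linter.unusedSectionVars false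

variable {A : Type u} [CStarAlgebra A] [PartialOrder A] [StarOrderedRing A] {τ : A →ₚ[ℂ] ℂ}
  {B : Type*} [CStarAlgebra B] [PartialOrder B] [StarOrderedRing B] {σ : B →ₚ[ℂ] ℂ}
  {ι : B →⋆ₐ[ℂ] A} {E : A →ₗ[ℂ] B}

theorem norm_le_one_of_le {x : A} (hx : IsSelfAdjoint x) (h1 : x ≤ 1) (h2 : -x ≤ 1) : ‖x‖ ≤ 1 := by
  have h3 : ∀ t ∈ spectrum ℝ x, t ≤ 1 := by
    have h4 : x ≤ algebraMap ℝ A 1 := by simpa using h1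
    exact (le_algebraMap_iff_spectrum_le (a := x)).mp h4
  have h5 : ∀ t ∈ spectrum ℝ x, -1 ≤ t := by
    have h6 : algebraMap ℝ A (-1) ≤ x := by
      rw [map_neg, map_one]; exact neg_le.mp h2
    exact (algebraMap_le_iff_le_spectrum (a := x)).mp h6
  rw [← cfc_id' ℝ x]
  exact norm_cfc_le zero_le_one fun t ht => abs_le.mpr ⟨h5 t ht, h3 t ht⟩

theorem le_one_of_norm_le {x : A} (hx : IsSelfAdjoint x) (h1 : ‖x‖ ≤ 1) : x ≤ 1 := by
  refine hx.le_algebraMap_norm_self.trans ?_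
  rw [← map_one (algebraMap ℝ A)]
  exact algebraMap_mono A h1

theorem one_sub_sq_nonneg {x : A} (hx : IsSelfAdjoint x) (h1 : ‖x‖ ≤ 1) : 0 ≤ 1 - x * x := by
  rw [sub_nonneg]
  refine le_one_of_norm_le (hx.mul_self_nonneg.isSelfAdjoint) ?_
  exact (norm_mul_le _ _).trans (mul_le_one₀ h1 (norm_nonneg _) h1)

theorem norm_one_sub_sq_le {x : A} (hx : IsSelfAdjoint x) (h1 : ‖x‖ ≤ 1) : ‖1 - x * x‖ ≤ 1 := by
  have h2 := one_sub_sq_nonneg hx h1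
  refine norm_le_one_of_le h2.isSelfAdjoint ?_ ?_
  · exact sub_le_self _ hx.mul_self_nonneg
  · exact (neg_nonpos.mpr h2).trans zero_le_one

/-- With `b = 1 - x * x` one has `b * y * b ≤ b * b ≤ b`, and `x + b / 2 = 1 - (1 - x) ^ 2 / 2`. -/
theorem add_half_conjugate_le {x y : A} (hx : IsSelfAdjoint x) (hx1 : ‖x‖ ≤ 1)
    (hy : IsSelfAdjoint y) (hy1 : ‖y‖ ≤ 1) :
    x + (2⁻¹ : ℝ) • ((1 - x * x) * y * (1 - x * x)) ≤ 1 := by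
  set b := 1 - x * x with hb
  have hb0 : 0 ≤ b := one_sub_sq_nonneg hx hx1
  have hbs : star b = b := hb0.isSelfAdjoint.star_eq
  have h1 : b * y * b ≤ b * b := by
    have := star_left_conjugate_le_conjugate (le_one_of_norm_le hy hy1) b
    rwa [hbs, mul_one] at this
  have h2 : b * b ≤ b := by
    have h3 := star_left_conjugate_nonneg hb0 x
    rw [hx.star_eq] at h3
    have h4 : b - b * b = x * b * x := by rw [hb]; noncomm_ring
    rw [← sub_nonneg, h4]; exact h3
  have h5 : 0 ≤ (1 - x) * (1 - x) := ((IsSelfAdjoint.one A).sub hx).mul_self_nonneg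
  have h6 : (2⁻¹ : ℝ) • (b * y * b) ≤ (2⁻¹ : ℝ) • b :=
    smul_le_smul_of_nonneg_left (h1.trans h2) (by norm_num)
  have h7 : 0 ≤ (2⁻¹ : ℝ) • ((1 - x) * (1 - x)) := smul_nonneg (by norm_num) h5
  have h8 : x + (2⁻¹ : ℝ) • b = 1 - (2⁻¹ : ℝ) • ((1 - x) * (1 - x)) := by
    have : (1 - x) * (1 - x) = 1 - x - x + x * x := by noncomm_ring
    rw [hb, this]
    module
  calc _ ≤ x + (2⁻¹ : ℝ) • b := by gcongr
    _ ≤ 1 := by rw [h8]; exact sub_le_self _ h7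

theorem norm_add_half_conjugate_le {x y : A} (hx : IsSelfAdjoint x) (hx1 : ‖x‖ ≤ 1)
    (hy : IsSelfAdjoint y) (hy1 : ‖y‖ ≤ 1) :
    IsSelfAdjoint (x + (2⁻¹ : ℝ) • ((1 - x * x) * y * (1 - x * x))) ∧
      ‖x + (2⁻¹ : ℝ) • ((1 - x * x) * y * (1 - x * x))‖ ≤ 1 := by
  have hs : IsSelfAdjoint (x + (2⁻¹ : ℝ) • ((1 - x * x) * y * (1 - x * x))) := by
    rw [IsSelfAdjoint]
    simp [hx.star_eq, hy.star_eq, mul_assoc]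
  refine ⟨hs, norm_le_one_of_le hs (add_half_conjugate_le hx hx1 hy hy1) ?_⟩
  have h1 := add_half_conjugate_le hx.neg (by rwa [norm_neg]) hy.neg (by rwa [norm_neg])
  convert h1 using 1
  simp [add_comm]

/-- A self-adjoint contraction is improved by adding a compression by its defect. -/
theorem exists_increment (hτ : τ.IsNormalTrace) {x y b w : A} (hx : IsSelfAdjoint x)
    (hx1 : ‖x‖ ≤ 1) (hy1 : ‖y‖ ≤ 1) (hb : b = 1 - x * x) (hw : w = b * y * b) :
    ∃ α : ℂ, ‖α‖ ≤ 1 / 4 ∧ IsSelfAdjoint (x + (α • w + star (α • w))) ∧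
      ‖x + (α • w + star (α • w))‖ ≤ 1 ∧
      τ.tnorm x ^ 2 + 1 / 8 * τ.tnorm w ^ 2 ≤ τ.tnorm (x + (α • w + star (α • w))) ^ 2 := by
  have hbs : star b = b := by rw [hb, star_sub, star_mul, star_one, hx.star_eq]
  have hw' : star w = b * star y * b := by rw [hw]; simp [hbs, mul_assoc]
  have key : ∀ (y' : A) (γ : ℂ), IsSelfAdjoint y' → ‖y'‖ ≤ 1 → ‖γ‖ ≤ 1 / 4 →
      (2⁻¹ : ℝ) • (b * y' * b) = γ • w + star (γ • w) →
      1 / 2 * τ.tnorm w ^ 2 ≤ τ.tnorm (b * y' * b) ^ 2 →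
      ∃ α : ℂ, ‖α‖ ≤ 1 / 4 ∧ IsSelfAdjoint (x + (α • w + star (α • w))) ∧
      ‖x + (α • w + star (α • w))‖ ≤ 1 ∧
      τ.tnorm x ^ 2 + 1 / 8 * τ.tnorm w ^ 2 ≤ τ.tnorm (x + (α • w + star (α • w))) ^ 2 := by
    intro y' γ hy' hy'1 hγ heq hlow
    have h1 : τ.tnorm ((2⁻¹ : ℝ) • (b * y' * b)) ^ 2 = 1 / 4 * τ.tnorm (b * y' * b) ^ 2 := by
      rw [tnorm_real_smul, mul_pow]; norm_num
    -- The sign is chosen so that the cross term is nonnegative; the gain is then `1 / 4` of the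
    -- norm of `b * y' * b` squared, at least `1 / 8` of that of `w`.
    rcases le_total 0 (τ (star x * ((2⁻¹ : ℝ) • (b * y' * b)))).re with h2 | h2
    · refine ⟨γ, hγ, ?_⟩
      have h3 := norm_add_half_conjugate_le hx hx1 hy' hy'1
      rw [← hb] at h3
      rw [← heq]
      refine ⟨h3.1, h3.2, ?_⟩
      rw [tnorm_add_sq, h1]
      linarith
    · refine ⟨-γ, by rwa [norm_neg], ?_⟩
      have h3 := norm_add_half_conjugate_le hx hx1 hy'.neg (by rwa [norm_neg])
      rw [← hb] at h3
      have h4 : (2⁻¹ : ℝ) • (b * -y' * b) = -γ • w + star (-γ • w) := by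
        rw [neg_smul, star_neg, mul_neg, neg_mul, smul_neg, heq]; abel
      have h5 : (2⁻¹ : ℝ) • (b * -y' * b) = -((2⁻¹ : ℝ) • (b * y' * b)) := by simp
      rw [← h4]
      refine ⟨h3.1, h3.2, ?_⟩
      rw [h5, tnorm_add_sq, tnorm_neg, h1, mul_neg, map_neg, Complex.neg_re]
      linarith
  have hre : ((realPart w : selfAdjoint A) : A) = b * (realPart y : selfAdjoint A) * b := by
    rw [coe_realPart, coe_realPart, hw', hw]
    simp [mul_add, add_mul]
  have him : ((imaginaryPart w : selfAdjoint A) : A) =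
      b * (imaginaryPart y : selfAdjoint A) * b := by
    rw [coe_imaginaryPart, coe_imaginaryPart, hw', hw]
    simp [mul_sub, sub_mul]
  have hsum := tnorm_real_part_sq_add (x := w) hτ
  -- One of the two parts of `w` has at least half of its squared `2`-norm, and it is the
  -- compression of the same part of `y`.
  rcases le_total (1 / 2 * τ.tnorm w ^ 2) (τ.tnorm (realPart w : selfAdjoint A) ^ 2) with h1 | h1
  · refine key (realPart y : selfAdjoint A) (1 / 4) (realPart y).2 ((realPart.norm_le y).trans hy1)
      (by norm_num) ?_ (by rwa [← hre])
    rw [← hre, coe_realPart, ← Complex.coe_smul, smul_smul, star_smul, smul_add]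
    norm_num
  · refine key (imaginaryPart y : selfAdjoint A) (-(Complex.I / 4)) (imaginaryPart y).2
      ((imaginaryPart.norm_le y).trans hy1) (by norm_num) ?_ (by rw [← him]; linarith)
    rw [← him, coe_imaginaryPart, ← Complex.coe_smul, smul_smul, star_smul, smul_sub]
    have h2 : ((2⁻¹ : ℝ) : ℂ) * -(Complex.I * 2⁻¹) = -(Complex.I / 4) := by push_cast; ring
    have h3 : star (-(Complex.I / 4)) = Complex.I / 4 := by simp; ring
    rw [h2, h3, neg_smul, neg_smul]
    abel

/-- Iterating an improvement by a fixed amount. -/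
theorem exists_of_increment {P : ℝ → A → Prop} {κ η : ℝ} (hη : 0 < η) (x₀ : A)
    (h₀ : ∀ δ > 0, P δ x₀) (hle : ∀ δ x, P δ x → τ.tnorm x ≤ 1)
    (hmono : ∀ δ δ' x, δ ≤ δ' → P δ x → P δ' x)
    (hstep : ∀ δ > 0, ∃ δ' > 0, ∀ x, P δ' x → τ.tnorm x ^ 2 < 1 - κ →
      ∃ x', P δ x' ∧ τ.tnorm x ^ 2 + η ≤ τ.tnorm x' ^ 2) {δ : ℝ} (hδ : 0 < δ) :
    ∃ x, P δ x ∧ 1 - κ ≤ τ.tnorm x ^ 2 := by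
  -- The tolerance is quantified inside the induction: the one needed after the last step determines
  -- all earlier ones. The process stops because `m * η` cannot exceed `1`.
  have key : ∀ m : ℕ, ∀ δ > 0, ∃ x, P δ x ∧ (1 - κ ≤ τ.tnorm x ^ 2 ∨ m * η ≤ τ.tnorm x ^ 2) := by
    intro m
    induction m with
    | zero => exact fun δ hδ => ⟨x₀, h₀ δ hδ, Or.inr (by simpa using sq_nonneg _)⟩
    | succ m ih =>
      intro δ hδ
      obtain ⟨δ', hδ', hs⟩ := hstep δ hδ
      obtain ⟨x, hx, hx'⟩ := ih (min δ δ') (lt_min hδ hδ')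
      rcases le_or_gt (1 - κ) (τ.tnorm x ^ 2) with h1 | h1
      · exact ⟨x, hmono _ _ _ (min_le_left _ _) hx, Or.inl h1⟩
      · obtain ⟨x', h2, h3⟩ := hs x (hmono _ _ _ (min_le_right _ _) hx) h1
        refine ⟨x', h2, Or.inr ?_⟩
        rcases hx' with h4 | h4
        · linarith
        · push_cast; linarith
  obtain ⟨m, hm⟩ := exists_nat_gt (1 / η)
  obtain ⟨x, hx, h1 | h1⟩ := key m δ hδ
  · exact ⟨x, hx, h1⟩
  · rw [div_lt_iff₀ hη] at hm
    have h2 := pow_le_one₀ (n := 2) (tnorm_nonneg _) (hle _ _ hx)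
    linarith

/-- The trace of the defect is `1 - ‖x‖₂²`, and the trace is bounded by the `2`-norm. -/
theorem sq_le_tnorm_defect_sq (hτ : τ.IsNormalTrace) {x : A} (hx : IsSelfAdjoint x) {κ : ℝ}
    (hκ : 0 < κ) (h1 : τ.tnorm x ^ 2 < 1 - κ) : κ ^ 2 ≤ τ.tnorm (1 - x * x) ^ 2 := by
  have h2 := hτ.norm_apply_le_tnorm (1 - x * x)
  have h3 : τ (x * x) = ((τ.tnorm x ^ 2 : ℝ) : ℂ) := by rw [tnorm_sq, hx.star_eq]
  rw [map_sub, hτ.map_one, h3, ← Complex.ofReal_one, ← Complex.ofReal_sub, Complex.norm_real,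
    Real.norm_of_nonneg (by linarith)] at h2
  exact pow_le_pow_left₀ hκ.le (by linarith) 2

namespace IsCondExp

variable (h : IsCondExp τ σ ι E)
include h

theorem norm_apply_le_tnorm_condExp (x : A) : ‖τ x‖ ≤ σ.tnorm (E x) := by
  rw [← h.apply_condExp]; exact h.trace_sub.norm_apply_le_tnorm _

/-- A self-adjoint contraction can be pushed close to a symmetry without changing its conditional
expectation much. -/
theorem exists_almost_symmetry (hcomm : HasTrivialRelativeCommutant ι) {ζ : ℝ} (hζ : 0 < ζ)
    (hG : HasAlmostOrthogonalFamilies τ σ E ζ) {x₀ : A} (hx₀ : IsSelfAdjoint x₀)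
    (hx₀1 : ‖x₀‖ ≤ 1) {δ κ : ℝ} (hδ : 0 < δ) (hκ : 0 < κ) :
    ∃ x : A, IsSelfAdjoint x ∧ ‖x‖ ≤ 1 ∧ σ.tnorm (E (x - x₀)) ≤ δ ∧
      ‖τ (x₀ * (x - x₀))‖ ≤ δ ∧ 1 - κ ≤ τ.tnorm x ^ 2 := by
  classical
  have hτ := h.trace
  suffices hstep : ∀ δ > 0, ∃ δ' > 0, ∀ x : A, (IsSelfAdjoint x ∧ ‖x‖ ≤ 1 ∧
      σ.tnorm (E (x - x₀)) ≤ δ' ∧ ‖τ (x₀ * (x - x₀))‖ ≤ δ') → τ.tnorm x ^ 2 < 1 - κ →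
      ∃ x' : A, (IsSelfAdjoint x' ∧ ‖x'‖ ≤ 1 ∧ σ.tnorm (E (x' - x₀)) ≤ δ ∧
        ‖τ (x₀ * (x' - x₀))‖ ≤ δ) ∧ τ.tnorm x ^ 2 + κ ^ 4 / 16 ≤ τ.tnorm x' ^ 2 by
    obtain ⟨x, hx, hx'⟩ := exists_of_increment (τ := τ) (κ := κ) (η := κ ^ 4 / 16)
      (P := fun δ x => IsSelfAdjoint x ∧ ‖x‖ ≤ 1 ∧ σ.tnorm (E (x - x₀)) ≤ δ ∧
        ‖τ (x₀ * (x - x₀))‖ ≤ δ) (by positivity) x₀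
      (fun δ hδ => ⟨hx₀, hx₀1, by simpa [tnorm_zero] using hδ.le, by simpa using hδ.le⟩)
      (fun δ x hx => (hτ.tnorm_le_norm x).trans hx.2.1)
      (fun δ δ' x hle hx => ⟨hx.1, hx.2.1, hx.2.2.1.trans hle, hx.2.2.2.trans hle⟩) hstep hδ
    exact ⟨x, hx.1, hx.2.1, hx.2.2.1, hx.2.2.2, hx'⟩
  intro δ hδ
  refine ⟨δ / 2, by positivity, fun x ⟨hx, hx1, hE, hτx⟩ hlt => ?_⟩
  set b := 1 - x * x with hb
  have hbs : IsSelfAdjoint b := (one_sub_sq_nonneg hx hx1).isSelfAdjoint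
  -- The pair `b, b` controls `E (b * u * b)`; the pair `b * x₀ * b, 1` controls `τ (x₀ * (b * u *
  -- b))`. With `t = κ ^ 2` the gain is `κ ^ 4 / 16`.
  obtain ⟨u, hu, hu'⟩ := h.exists_unitary_small_condExp hcomm hζ hG {b, 1, b * x₀ * b}
    (half_pos hδ) hbs (norm_one_sub_sq_le hx hx1) (t := κ ^ 2) (by positivity)
    (sq_le_tnorm_defect_sq hτ hx hκ hlt)
  have hu1 : ‖(u : A)‖ ≤ 1 := by
    have := hτ.nontrivial
    exact (CStarRing.norm_coe_unitary u).le
  obtain ⟨α, hα, hs, hn, hinc⟩ := exists_increment hτ hx hx1 hu1 hb rfl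
  set w := b * (u : A) * b with hw
  clear_value w
  refine ⟨_, ⟨hs, hn, ?_, ?_⟩, ?_⟩
  · have h1 : E (x + (α • w + star (α • w)) - x₀) = E (x - x₀) + (α • E w + star (α • E w)) := by
      have : x + (α • w + star (α • w)) - x₀ = (x - x₀) + (α • w + star (α • w)) := by abel
      rw [this, map_add, map_add, h.condExp_star, map_smul]
    have h2 : σ.tnorm (E w) ≤ δ / 2 := by
      have := hu b (by simp) b (by simp)
      rwa [hbs.star_eq, ← hw] at this
    rw [h1]
    refine (tnorm_add_le _ _).trans ?_
    have h3 := tnorm_add_le (τ := σ) (α • E w) (star (α • E w))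
    rw [h.trace_sub.tnorm_star, tnorm_smul] at h3
    have h4 := mul_le_mul hα h2 (tnorm_nonneg _) (by norm_num)
    linarith
  · have h1 : x₀ * (x + (α • w + star (α • w)) - x₀) =
        x₀ * (x - x₀) + (α • (x₀ * w) + x₀ * star (α • w)) := by
      rw [← mul_smul_comm]; noncomm_ring
    have h2 : ‖τ (x₀ * w)‖ ≤ δ / 2 := by
      have h3 := hu (b * x₀ * b) (by simp) 1 (by simp)
      refine (le_trans (le_of_eq ?_) (h.norm_apply_le_tnorm_condExp _)).trans h3
      rw [hw, ← mul_assoc, hτ.tracial, mul_one]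
      simp [hbs.star_eq, hx₀.star_eq, mul_assoc]
    have h4 : ‖τ (x₀ * star (α • w))‖ = ‖α‖ * ‖τ (x₀ * w)‖ := by
      have h5 : x₀ * star (α • w) = star (α • (w * x₀)) := by
        rw [star_smul, star_smul, star_mul, hx₀.star_eq, mul_smul_comm]
      rw [h5, star_apply, norm_star, map_smul, norm_smul, hτ.tracial]
    have h6 := mul_le_mul hα h2 (norm_nonneg _) (by norm_num)
    rw [h1, map_add, map_add, map_smul]
    refine (norm_add_le _ _).trans ?_
    have h7 := norm_add_le (α • τ (x₀ * w)) (τ (x₀ * star (α • w)))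
    rw [h4, norm_smul] at h7
    linarith
  · nlinarith

end IsCondExp

end Increment

end PositiveLinearMap

/-! ### Almost central self-adjoint contractions of large `2`-norm -/

namespace PositiveLinearMap

universe u

section AlmostCentral

set_option linter.unusedSectionVars false

variable {A : Type u} [CStarAlgebra A] [PartialOrder A] [StarOrderedRing A] {τ : A →ₚ[ℂ] ℂ}
  {B : Type*} [CStarAlgebra B] [PartialOrder B] [StarOrderedRing B] {σ : B →ₚ[ℂ] ℂ}
  {ι : B →⋆ₐ[ℂ] A} {E : A →ₗ[ℂ] B}

theorem tnorm_commutator_of_isSelfAdjoint (hτ : τ.IsNormalTrace) {x : A} (hx : IsSelfAdjoint x)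
    (y : A) : τ.tnorm (star y * x - x * star y) = τ.tnorm (y * x - x * y) := by
  rw [← tnorm_commutator_star hτ, hx.star_eq]

/-- A single compression `b * z i * b` need not be large, since `z i` is not assumed to commute with
`b`. The sum `W` of the `z i * b * b * z i` has trace at least `k * μ`, and its squared `2`-norm is
the double sum of those of the `b * (z i * z j) * b`; for large `k` the diagonal alone cannot
account for it. -/
theorem exists_pair_le_tnorm (hτ : τ.IsNormalTrace) {b : A} (hb : IsSelfAdjoint b) (hb1 : ‖b‖ ≤ 1)
    {z : ℕ → A} (hz : ∀ n, IsSelfAdjoint (z n)) (hz1 : ∀ n, ‖z n‖ ≤ 1) {μ : ℝ} (hμ : 0 < μ)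
    (hle : ∀ n, μ ≤ (τ (b * b * (z n * z n))).re) :
    ∃ i j, i ≠ j ∧ μ ^ 2 / 2 ≤ τ.tnorm (b * (z i * z j) * b) ^ 2 := by
  by_contra! hcon
  obtain ⟨k, hk⟩ := exists_nat_gt (2 / μ ^ 2)
  rw [div_lt_iff₀ (by positivity)] at hk
  have hk0 : 0 < (k : ℝ) := by
    by_contra! h0
    nlinarith [sq_nonneg μ]
  set W := ∑ i ∈ Finset.range k, z i * b * b * z i with hW
  have hWs : star W = W := by
    rw [hW, star_sum]
    refine Finset.sum_congr rfl fun i _ => ?_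
    simp [(hz i).star_eq, hb.star_eq, mul_assoc]
  have h1 : k * μ ≤ τ.tnorm W := by
    refine le_trans ?_ ((Complex.re_le_norm _).trans (hτ.norm_apply_le_tnorm W))
    rw [hW, map_sum, Complex.re_sum]
    have h2 : ∀ i ∈ Finset.range k, μ ≤ (τ (z i * b * b * z i)).re := fun i _ => by
      rw [hτ.tracial, ← mul_assoc, ← mul_assoc, mul_assoc, hτ.tracial]
      exact hle i
    have := Finset.card_nsmul_le_sum _ _ _ h2
    simpa using this
  have h2 : τ.tnorm W ^ 2 = ∑ i ∈ Finset.range k, ∑ j ∈ Finset.range k,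
      τ.tnorm (b * (z i * z j) * b) ^ 2 := by
    rw [tnorm_sq_re, hWs, hW, Finset.sum_mul_sum, map_sum, Complex.re_sum]
    refine Finset.sum_congr rfl fun i _ => ?_
    rw [map_sum, Complex.re_sum]
    refine Finset.sum_congr rfl fun j _ => ?_
    rw [← hτ.tnorm_star, tnorm_sq_re, star_star]
    have h3 : z i * b * b * z i * (z j * b * b * z j) =
        (z i * b) * (b * z i * z j * b * b * z j) := by
      noncomm_ring
    rw [h3, hτ.tracial]
    have h4 : b * z i * z j * b * b * z j * (z i * b) =
      b * (z i * z j) * b * star (b * (z i * z j) * b) := by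
      simp only [star_mul, hb.star_eq, (hz _).star_eq]; noncomm_ring
    rw [h4]
  have h3 : ∀ i ∈ Finset.range k, ∑ j ∈ Finset.range k, τ.tnorm (b * (z i * z j) * b) ^ 2 ≤
      1 + k * (μ ^ 2 / 2) := fun i hi => by
    have h5 : ∀ j ∈ Finset.range k, τ.tnorm (b * (z i * z j) * b) ^ 2 ≤
        (if j = i then 1 else 0) + μ ^ 2 / 2 := fun j _ => by
      split_ifs with hji
      · have h6 : ‖b * (z i * z j) * b‖ ≤ 1 :=
          (norm_mul_le _ _).trans (mul_le_one₀ ((norm_mul_le _ _).trans (mul_le_one₀ hb1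
            (norm_nonneg _) ((norm_mul_le _ _).trans (mul_le_one₀ (hz1 _) (norm_nonneg _)
              (hz1 _))))) (norm_nonneg _) hb1)
        have := pow_le_one₀ (n := 2) (tnorm_nonneg _) ((hτ.tnorm_le_norm _).trans h6)
        have := sq_nonneg μ
        linarith
      · rw [zero_add]; exact (hcon i j (Ne.symm hji)).le
    refine (Finset.sum_le_sum h5).trans ?_
    rw [Finset.sum_add_distrib, Finset.sum_ite_eq', if_pos hi]
    simp
  have h4 := Finset.sum_le_sum h3
  rw [← h2] at h4
  simp only [Finset.sum_const, Finset.card_range, nsmul_eq_mul] at h4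
  have h5 := pow_le_pow_left₀ (by positivity) h1 2
  nlinarith

/-- Leibniz rule for a product of contractions; each of the two defects costs two commutators with
`x`. -/
theorem tnorm_commutator_defect_conjugate_le (hτ : τ.IsNormalTrace) {x u v : A}
    (hx : IsSelfAdjoint x)
    (hx1 : ‖x‖ ≤ 1) (hu1 : ‖u‖ ≤ 1) (hv1 : ‖v‖ ≤ 1) (y : A) :
    τ.tnorm (y * ((1 - x * x) * (u * v) * (1 - x * x)) - (1 - x * x) * (u * v) * (1 - x * x) * y) ≤
      4 * τ.tnorm (y * x - x * y) + τ.tnorm (y * u - u * y) + τ.tnorm (y * v - v * y) := by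
  have hprod : ∀ p q : A, ‖p‖ ≤ 1 → ‖q‖ ≤ 1 → τ.tnorm (y * (p * q) - p * q * y) ≤
      τ.tnorm (y * p - p * y) + τ.tnorm (y * q - q * y) := fun p q hp hq => by
    refine (tnorm_commutator_mul_le hτ y p q).trans (add_le_add ?_ ?_)
    · exact mul_le_of_le_one_right (tnorm_nonneg _) hq
    · exact mul_le_of_le_one_left (tnorm_nonneg _) hp
  have hb : τ.tnorm (y * (1 - x * x) - (1 - x * x) * y) ≤ 2 * τ.tnorm (y * x - x * y) := by
    have h1 : y * (1 - x * x) - (1 - x * x) * y = -(y * (x * x) - x * x * y) := by noncomm_ring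
    rw [h1, tnorm_neg]
    linarith [hprod x x hx1 hx1]
  have hb1 := norm_one_sub_sq_le hx hx1
  have huv : ‖u * v‖ ≤ 1 := (norm_mul_le _ _).trans (mul_le_one₀ hu1 (norm_nonneg _) hv1)
  have h1 := hprod _ _ ((norm_mul_le _ _).trans (mul_le_one₀ hb1 (norm_nonneg _) huv)) hb1
  have h2 := hprod _ _ hb1 huv
  have h3 := hprod _ _ hu1 hv1
  linarith

/-- A gamma sequence produces almost central self-adjoint contractions of almost vanishing trace and
of `2`-norm almost one. -/
theorem IsGammaSequence.exists_almost_central (h : IsCondExp τ σ ι E)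
    (hcomm : HasTrivialRelativeCommutant ι) {x : ℕ → A} (hx : IsGammaSequence τ ι E x)
    (F : Finset B) {δ κ : ℝ} (hδ : 0 < δ) (hκ : 0 < κ) :
    ∃ x : A, IsSelfAdjoint x ∧ ‖x‖ ≤ 1 ∧ (∀ y ∈ F, τ.tnorm (ι y * x - x * ι y) ≤ δ) ∧
      ‖τ x‖ ≤ δ ∧ 1 - κ ≤ τ.tnorm x ^ 2 := by
  have hτ := h.trace
  obtain ⟨ζ, hζ, hZ⟩ := hx.exists_almost_orthogonal h hcomm
  -- The product `τ (b * b) * τ (z n * z n)` is at least `κ ^ 2 * ζ`; half of it is spent on the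
  -- factorization error.
  set μ := κ ^ 2 * ζ / 2 with hμ
  have hμ0 : 0 < μ := by positivity
  suffices hstep : ∀ δ > 0, ∃ δ' > 0, ∀ x : A, (IsSelfAdjoint x ∧ ‖x‖ ≤ 1 ∧
      (∀ y ∈ F, τ.tnorm (ι y * x - x * ι y) ≤ δ') ∧ ‖τ x‖ ≤ δ') → τ.tnorm x ^ 2 < 1 - κ →
      ∃ x' : A, (IsSelfAdjoint x' ∧ ‖x'‖ ≤ 1 ∧ (∀ y ∈ F, τ.tnorm (ι y * x' - x' * ι y) ≤ δ) ∧
        ‖τ x'‖ ≤ δ) ∧ τ.tnorm x ^ 2 + μ ^ 2 / 16 ≤ τ.tnorm x' ^ 2 by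
    obtain ⟨x, hx, hx'⟩ := exists_of_increment (τ := τ) (κ := κ) (η := μ ^ 2 / 16)
      (P := fun δ x => IsSelfAdjoint x ∧ ‖x‖ ≤ 1 ∧
        (∀ y ∈ F, τ.tnorm (ι y * x - x * ι y) ≤ δ) ∧ ‖τ x‖ ≤ δ) (by positivity) 0
      (fun δ hδ => ⟨IsSelfAdjoint.zero A, by simp, fun y _ => by simpa [tnorm_zero] using hδ.le,
        by simpa using hδ.le⟩)
      (fun δ x hx => (hτ.tnorm_le_norm x).trans hx.2.1)
      (fun δ δ' x hle hx => ⟨hx.1, hx.2.1, fun y hy => (hx.2.2.1 y hy).trans hle,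
        hx.2.2.2.trans hle⟩) hstep hδ
    exact ⟨x, hx.1, hx.2.1, hx.2.2.1, hx.2.2.2, hx'⟩
  intro δ hδ
  -- The compression has commutators at most `6 * (δ / 4)` and enters twice with coefficient at most
  -- `1 / 4`, so the total is at most `δ`.
  refine ⟨δ / 4, by positivity, fun x ⟨hx, hx1, hF, hτx⟩ hlt => ?_⟩
  set b := 1 - x * x with hb
  have hbs : IsSelfAdjoint b := (one_sub_sq_nonneg hx hx1).isSelfAdjoint
  have hb1 := norm_one_sub_sq_le hx hx1
  have hbκ := sq_le_tnorm_defect_sq hτ hx hκ hlt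
  obtain ⟨z, hz, hzz⟩ := hZ F (min (δ / 4) μ) (b * b) (by positivity)
  have hpos : ∀ n, μ ≤ (τ (b * b * (z n * z n))).re := fun n => by
    have h1 := (hz n).2.2.2.2.trans (min_le_right _ _)
    have h2 : τ (b * b) * τ (z n * z n) = ((τ.tnorm b ^ 2 * τ.tnorm (z n) ^ 2 : ℝ) : ℂ) := by
      rw [Complex.ofReal_mul, tnorm_sq, tnorm_sq, hbs.star_eq, (hz n).1.star_eq]
    rw [h2] at h1
    have h3 := (Complex.abs_re_le_norm _).trans h1
    rw [Complex.sub_re, Complex.ofReal_re, abs_le] at h3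
    have h4 := mul_le_mul hbκ (hz n).2.2.1 hζ.le (by positivity)
    linarith [h3.1]
  obtain ⟨i, j, hij, hw⟩ := exists_pair_le_tnorm hτ hbs hb1 (fun n => (hz n).1)
    (fun n => (hz n).2.1) hμ0 hpos
  have hy1 : ‖z i * z j‖ ≤ 1 :=
    (norm_mul_le _ _).trans (mul_le_one₀ (hz i).2.1 (norm_nonneg _) (hz j).2.1)
  obtain ⟨α, hα, hs, hn, hinc⟩ := exists_increment hτ hx hx1 hy1 hb rfl
  have hcw : ∀ y : A, τ.tnorm (y * (b * (z i * z j) * b) - b * (z i * z j) * b * y) ≤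
      4 * τ.tnorm (y * x - x * y) + τ.tnorm (y * z i - z i * y) + τ.tnorm (y * z j - z j * y) :=
    tnorm_commutator_defect_conjugate_le hτ hx hx1 (hz i).2.1 (hz j).2.1
  have hτw : ‖τ (b * (z i * z j) * b)‖ ≤ δ / 4 := by
    rw [hτ.tracial, ← mul_assoc]
    exact (hzz i j hij).trans (min_le_left _ _)
  generalize b * (z i * z j) * b = w at *
  refine ⟨_, ⟨hs, hn, fun y hy => ?_, ?_⟩, by linarith⟩
  · have h1 := tnorm_commutator_add_le (τ := τ) (ι y) x (α • w + star (α • w))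
    have h2 := tnorm_commutator_add_le (τ := τ) (ι y) (α • w) (star (α • w))
    rw [tnorm_commutator_star hτ, tnorm_commutator_smul, tnorm_commutator_smul] at h2
    have h3 : τ.tnorm (ι y * w - w * ι y) ≤ 6 * (δ / 4) := by
      refine (hcw (ι y)).trans ?_
      linarith [hF y hy, ((hz i).2.2.2.1 y hy).trans (min_le_left _ _),
        ((hz j).2.2.2.1 y hy).trans (min_le_left _ _)]
    have h4 : τ.tnorm (star (ι y) * w - w * star (ι y)) ≤ 6 * (δ / 4) := by
      refine (hcw _).trans ?_
      rw [tnorm_commutator_of_isSelfAdjoint hτ hx, tnorm_commutator_of_isSelfAdjoint hτ (hz i).1,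
        tnorm_commutator_of_isSelfAdjoint hτ (hz j).1]
      linarith [hF y hy, ((hz i).2.2.2.1 y hy).trans (min_le_left _ _),
        ((hz j).2.2.2.1 y hy).trans (min_le_left _ _)]
    have h5 := mul_le_mul hα h3 (tnorm_nonneg _) (by norm_num)
    have h6 := mul_le_mul hα h4 (tnorm_nonneg _) (by norm_num)
    linarith [hF y hy]
  · rw [map_add, map_add, star_apply, map_smul]
    refine (norm_add_le _ _).trans ?_
    have h1 := norm_add_le (α • τ w) (star (α • τ w))
    rw [norm_star, norm_smul] at h1
    have h5 := mul_le_mul hα hτw (norm_nonneg _) (by norm_num)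
    linarith

/-- A finitary form of fullness: elements of the unit ball that almost commute with a suitable
finite set are almost scalar. -/
def HasSpectralGap (σ : B →ₚ[ℂ] ℂ) : Prop :=
  ∀ δ > 0, ∃ (F : Finset B) (ε : ℝ), 0 < ε ∧ ∀ a : B, ‖a‖ ≤ 1 →
    (∀ y ∈ F, σ.tnorm (y * a - a * y) ≤ ε) → σ.tnorm (a - σ a • 1) ≤ δ

/-- Bimodularity of `E` and its contractivity in the `2`-norm; it carries almost centrality down to
`B`. -/
theorem IsCondExp.tnorm_commutator_le (h : IsCondExp τ σ ι E) (y : B) (x : A) :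
    σ.tnorm (y * E x - E x * y) ≤ τ.tnorm (ι y * x - x * ι y) := by
  rw [← h.condExp_map_mul, ← h.condExp_mul_map, ← map_sub]
  exact h.tnorm_le _

/-- Under fullness the conditional expectation of an almost central element is almost its trace. -/
theorem IsCondExp.tnorm_condExp_le_of_gap (h : IsCondExp τ σ ι E) {δ ε : ℝ} {F : Finset B}
    (hF : ∀ a : B, ‖a‖ ≤ 1 → (∀ y ∈ F, σ.tnorm (y * a - a * y) ≤ ε) →
      σ.tnorm (a - σ a • 1) ≤ δ) {x : A} (hx : ‖x‖ ≤ 1)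
    (hxF : ∀ y ∈ F, τ.tnorm (ι y * x - x * ι y) ≤ ε) : σ.tnorm (E x) ≤ ‖τ x‖ + δ := by
  have h1 := hF (E x) ((h.norm_le x).trans hx) fun y hy =>
    (h.tnorm_commutator_le y x).trans (hxF y hy)
  have h2 := tnorm_le_add_sub (τ := σ) (E x) (σ (E x) • 1)
  rw [tnorm_smul, h.trace_sub.tnorm_one, mul_one, h.apply_condExp] at h2
  rw [h.apply_condExp] at h1
  linarith

/-- Products of almost central elements are almost central, so the gap upgrades smallness of `τ (z m
* z n)` to smallness of `E (z m * z n)`. -/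
theorem IsGammaSequence.exists_hasAlmostOrthogonalFamilies (h : IsCondExp τ σ ι E)
    (hcomm : HasTrivialRelativeCommutant ι) (hgap : HasSpectralGap σ) {x : ℕ → A}
    (hx : IsGammaSequence τ ι E x) : ∃ ζ > 0, HasAlmostOrthogonalFamilies τ σ E ζ := by
  have hτ := h.trace
  obtain ⟨ζ, hζ, hZ⟩ := hx.exists_almost_orthogonal h hcomm
  refine ⟨ζ, hζ, fun δ hδ => ?_⟩
  obtain ⟨F, ε, hε, hF⟩ := hgap (δ / 2) (by positivity)
  obtain ⟨z, hz, hzz⟩ := hZ F (min (ε / 2) (δ / 2)) 1 (by positivity)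
  refine ⟨z, fun n => ⟨(hz n).2.1, (hz n).2.2.1⟩, fun m n hmn => ?_⟩
  rw [(hz m).1.star_eq]
  have h1 := h.tnorm_condExp_le_of_gap hF (x := z m * z n)
    ((norm_mul_le _ _).trans (mul_le_one₀ (hz m).2.1 (norm_nonneg _) (hz n).2.1)) fun y hy => by
      refine (tnorm_commutator_mul_le hτ _ _ _).trans ?_
      have h2 := ((hz m).2.2.2.1 y hy).trans (min_le_left _ _)
      have h3 := ((hz n).2.2.2.1 y hy).trans (min_le_left _ _)
      have h4 := mul_le_of_le_one_right (tnorm_nonneg (τ := τ) (ι y * z m - z m * ι y)) (hz n).2.1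
      have h5 := mul_le_of_le_one_left (tnorm_nonneg (τ := τ) (ι y * z n - z n * ι y)) (hz m).2.1
      linarith
  have h6 := (hzz m n hmn).trans (min_le_right _ _)
  rw [one_mul] at h6
  linarith

end AlmostCentral

end PositiveLinearMap

/-! ### Symmetries of vanishing conditional expectation -/

namespace PositiveLinearMap

universe u

section Symmetry

set_option linter.unusedSectionVars false

variable {A : Type u} [CStarAlgebra A] [PartialOrder A] [StarOrderedRing A] {τ : A →ₚ[ℂ] ℂ}
  {B : Type*} [CStarAlgebra B] [PartialOrder B] [StarOrderedRing B] {σ : B →ₚ[ℂ] ℂ}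
  {ι : B →⋆ₐ[ℂ] A} {E : A →ₗ[ℂ] B}

/-- A smooth spectral cut-off of a self-adjoint element of small `2`-norm. -/
theorem exists_cutoff {a : B} (ha : IsSelfAdjoint a) {s : ℝ} (hs : 0 < s)
    (has : σ.tnorm a ≤ s ^ 2) : ∃ q : B, IsSelfAdjoint q ∧ ‖q‖ ≤ 1 ∧ ‖q * a * q‖ ≤ s ∧
      σ.tnorm (1 - q) ≤ s := by
  -- Two bounds matter: `|t| * f t ≤ s`, and `1 - f t` is `t` times a factor of size at most `1 /
  -- s`, which turns `‖a‖₂ ≤ s ^ 2` into `‖1 - q‖₂ ≤ s`.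
  set f : ℝ → ℝ := fun t => (1 + t ^ 2 / s ^ 2)⁻¹ with hf
  have hpos : ∀ t : ℝ, 0 < 1 + t ^ 2 / s ^ 2 := fun t => by positivity
  have hfc : Continuous f := by
    refine Continuous.inv₀ (by fun_prop) fun t => (hpos t).ne'
  have hf0 : ∀ t, 0 ≤ f t := fun t => (inv_pos.mpr (hpos t)).le
  have hf1 : ∀ t, f t ≤ 1 := fun t => inv_le_one_of_one_le₀ (by
    have : 0 ≤ t ^ 2 / s ^ 2 := by positivity
    linarith)
  have hft : ∀ t, |t| * f t ≤ s := fun t => by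
    rw [hf, mul_inv_le_iff₀ (hpos t)]
    have h1 : s * (1 + t ^ 2 / s ^ 2) = (s ^ 2 + |t| ^ 2) / s := by rw [sq_abs]; field_simp
    rw [h1, le_div_iff₀ hs]
    nlinarith [sq_nonneg (s - |t|), abs_nonneg t]
  have h1f : ∀ t, 1 - f t = f t * t / s ^ 2 * t := fun t => by
    have h4 := (hpos t).ne'
    simp only [hf]
    field_simp
    ring
  clear_value f
  have hmul : ∀ g₁ g₂ : ℝ → ℝ, Continuous g₁ → Continuous g₂ →
      cfc (fun t => g₁ t * g₂ t) a = cfc g₁ a * cfc g₂ a := fun g₁ g₂ h₁ h₂ =>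
    cfc_mul g₁ g₂ a h₁.continuousOn h₂.continuousOn
  have haa : cfc (fun t : ℝ => t) a = a := cfc_id' ℝ a
  have hqaq : cfc f a * a * cfc f a = cfc (fun t => f t * t * f t) a := by
    rw [hmul (fun t => f t * t) f (hfc.mul continuous_id) hfc,
      hmul f (fun t => t) hfc continuous_id, haa]
  refine ⟨cfc f a, cfc_predicate f a, ?_, ?_, ?_⟩
  · refine norm_cfc_le zero_le_one fun t _ => ?_
    rw [Real.norm_of_nonneg (hf0 t)]; exact hf1 t
  · rw [hqaq]
    refine norm_cfc_le hs.le fun t _ => ?_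
    rw [norm_mul, norm_mul, Real.norm_of_nonneg (hf0 t), Real.norm_eq_abs]
    have h1 := hft t
    have h2 := mul_le_of_le_one_right (mul_nonneg (abs_nonneg t) (hf0 t)) (hf1 t)
    linarith [mul_comm (f t) |t|]
  · have h1 : 1 - cfc f a = cfc (fun t => f t * t / s ^ 2) a * a := by
      have h2 : (1 : B) - cfc f a = cfc (fun t => 1 - f t) a := by
        rw [cfc_sub (fun _ => (1 : ℝ)) f a continuousOn_const hfc.continuousOn, cfc_const_one ℝ a]
      have h3 := hmul (fun t => f t * t / s ^ 2) (fun t => t) (by fun_prop) continuous_id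
      rw [haa] at h3
      rw [h2, ← h3]
      exact cfc_congr fun t _ => h1f t
    have h2 : ‖cfc (fun t => f t * t / s ^ 2) a‖ ≤ 1 / s := by
      refine norm_cfc_le (by positivity) fun t _ => ?_
      rw [norm_div, norm_mul, Real.norm_of_nonneg (hf0 t), Real.norm_eq_abs,
        Real.norm_of_nonneg (sq_nonneg s), div_le_div_iff₀ (by positivity) hs]
      nlinarith [hft t]
    rw [h1]
    refine (tnorm_mul_le _ _).trans ((mul_le_mul h2 has (tnorm_nonneg _) (by positivity)).trans
      (le_of_eq ?_))
    field_simp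

namespace IsCondExp

variable (h : IsCondExp τ σ ι E)
include h

/-- Correcting a self-adjoint contraction so that its conditional expectation vanishes. -/
theorem exists_condExp_eq_zero {x : A} (hx : IsSelfAdjoint x) (hx1 : ‖x‖ ≤ 1) {s : ℝ} (hs : 0 < s)
    (hxs : σ.tnorm (E x) ≤ s ^ 2) : ∃ x' : A, IsSelfAdjoint x' ∧ ‖x'‖ ≤ 1 ∧ E x' = 0 ∧
      τ.tnorm (x' - x) ≤ 4 * s := by
  have hτ := h.trace
  obtain ⟨q, hq, hq1, hqaq, hqs⟩ := exists_cutoff (h.isSelfAdjoint hx) hs hxs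
  have hιq : star (ι q) = ι q := by rw [← map_star, hq.star_eq]
  have hιq1 : ‖ι q‖ ≤ 1 := (norm_map_le q).trans hq1
  have hιs : τ.tnorm (ι q - 1) ≤ s := by
    rw [tnorm_sub_comm, ← map_one ι, ← map_sub, h.tnorm_map]; exact hqs
  -- Subtracting `E x` directly could double the norm. After cutting down by `q` the expectation has
  -- operator norm at most `s`, so rescaling by `1 + s` suffices.
  set v := ι q * x * ι q - ι (q * E x * q) with hv
  have hvs : IsSelfAdjoint v := by
    rw [hv, IsSelfAdjoint]
    simp [hιq, hx.star_eq, ← map_star, (h.isSelfAdjoint hx).star_eq, mul_assoc]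
  have hv1 : ‖v‖ ≤ 1 + s := by
    refine (norm_sub_le _ _).trans (add_le_add ?_ ((norm_map_le _).trans hqaq))
    exact (norm_mul_le _ _).trans (mul_le_one₀ ((norm_mul_le _ _).trans
      (mul_le_one₀ hιq1 (norm_nonneg _) hx1)) (norm_nonneg _) hιq1)
  have hvE : E v = 0 := by
    rw [hv, map_sub, h.condExp_mul_map, h.condExp_map_mul, h.condExp_map, sub_self]
  have hvx : τ.tnorm (v - x) ≤ 3 * s := by
    have h1 : v - x = (ι q - 1) * (x * ι q) + x * (ι q - 1) - ι (q * E x * q) := by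
      rw [hv]; noncomm_ring
    have h2 := tnorm_sub_le (τ := τ) ((ι q - 1) * (x * ι q) + x * (ι q - 1)) (ι (q * E x * q))
    have h3 := tnorm_add_le (τ := τ) ((ι q - 1) * (x * ι q)) (x * (ι q - 1))
    have h4 : τ.tnorm ((ι q - 1) * (x * ι q)) ≤ s * 1 :=
      (hτ.tnorm_mul_le' _ _).trans (mul_le_mul hιs ((norm_mul_le _ _).trans
        (mul_le_one₀ hx1 (norm_nonneg _) hιq1)) (norm_nonneg _) hs.le)
    have h5 : τ.tnorm (x * (ι q - 1)) ≤ 1 * s :=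
      (tnorm_mul_le _ _).trans (mul_le_mul hx1 hιs (tnorm_nonneg _) zero_le_one)
    have h6 : τ.tnorm (ι (q * E x * q)) ≤ s :=
      (hτ.tnorm_le_norm _).trans ((norm_map_le _).trans hqaq)
    rw [h1]
    linarith
  have hs1 : 0 < 1 + s := by linarith
  have hx'1 : ‖((1 + s)⁻¹ : ℝ) • v‖ ≤ 1 := by
    rw [norm_smul, Real.norm_of_nonneg (by positivity), inv_mul_le_one₀ hs1]; exact hv1
  refine ⟨((1 + s)⁻¹ : ℝ) • v, (IsSelfAdjoint.all _).smul hvs, hx'1, ?_, ?_⟩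
  · rw [← Complex.coe_smul, map_smul, hvE, smul_zero]
  · have h1 : ((1 + s)⁻¹ : ℝ) • v - x = (v - x) - s • (((1 + s)⁻¹ : ℝ) • v) := by
      have h2 : v = (1 + s) • (((1 + s)⁻¹ : ℝ) • v) := by
        rw [smul_smul, mul_inv_cancel₀ hs1.ne', one_smul]
      nth_rw 2 [h2]
      module
    have h2 := tnorm_sub_le (τ := τ) (v - x) (s • (((1 + s)⁻¹ : ℝ) • v))
    rw [tnorm_real_smul, abs_of_pos hs] at h2
    have h3 := mul_le_mul_of_nonneg_left ((hτ.tnorm_le_norm _).trans hx'1) hs.le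
    rw [h1]
    linarith

/-- Closeness is automatic when `x` already has `2`-norm near one: the new element has `2`-norm at
most one and almost the same inner product with `x` as `x` itself. -/
theorem exists_next_almost_symmetry (hcomm : HasTrivialRelativeCommutant ι) {ζ : ℝ} (hζ : 0 < ζ)
    (hG : HasAlmostOrthogonalFamilies τ σ E ζ) {x : A} (hx : IsSelfAdjoint x)
    (hx1 : ‖x‖ ≤ 1) (hE : E x = 0) {r r' : ℝ} (hr : 0 < r) (hr' : 0 < r')
    (hxr : 1 - r ^ 2 ≤ τ.tnorm x ^ 2) :
    ∃ x' : A, IsSelfAdjoint x' ∧ ‖x'‖ ≤ 1 ∧ E x' = 0 ∧ 1 - r' ^ 2 ≤ τ.tnorm x' ^ 2 ∧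
      τ.tnorm (x' - x) ≤ 2 * r := by
  have hτ := h.trace
  -- The correction moves by `4 * s`, costing at most `8 * s ≤ r' ^ 2 / 2` in squared `2`-norm and
  -- `r / 2` in distance.
  obtain ⟨s, hs, hsr, hsr'⟩ : ∃ s : ℝ, 0 < s ∧ s ≤ r / 8 ∧ s ≤ r' ^ 2 / 16 :=
    ⟨min (r / 8) (r' ^ 2 / 16), by positivity, min_le_left _ _, min_le_right _ _⟩
  obtain ⟨w, hw, hw1, hwE, hwx, hwr⟩ := h.exists_almost_symmetry hcomm hζ hG hx hx1
    (δ := s ^ 2) (κ := r' ^ 2 / 2) (by positivity) (by positivity)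
  rw [map_sub, hE, sub_zero] at hwE
  obtain ⟨x', hx', hx'1, hx'E, hx'w⟩ := h.exists_condExp_eq_zero hw hw1 hs hwE
  have hwt := (hτ.tnorm_le_norm w).trans hw1
  have hx't := (hτ.tnorm_le_norm x').trans hx'1
  refine ⟨x', hx', hx'1, hx'E, ?_, ?_⟩
  · have h1 := tnorm_le_add_sub (τ := τ) w x'
    rw [tnorm_sub_comm] at h1
    nlinarith [tnorm_nonneg (τ := τ) w, tnorm_nonneg (τ := τ) x']
  · have h1 := tnorm_sub_le_add (τ := τ) x' w x
    have h2 : τ.tnorm (w - x) ^ 2 ≤ r ^ 2 + 2 * s ^ 2 := by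
      have h3 : τ.tnorm w ^ 2 = τ.tnorm (x + (w - x)) ^ 2 := by rw [add_sub_cancel]
      rw [tnorm_add_sq, hx.star_eq] at h3
      have h4 := (abs_le.mp ((Complex.abs_re_le_norm _).trans hwx)).1
      have h5 := pow_le_one₀ (n := 2) (tnorm_nonneg _) hwt
      linarith
    have h3 : τ.tnorm (w - x) ≤ 3 / 2 * r := by
      refine (abs_le_of_sq_le_sq' ?_ (by positivity)).2
      nlinarith
    linarith

/-- A self-adjoint contraction of vanishing conditional expectation and of `2`-norm almost one is
close to a symmetry of vanishing conditional expectation. -/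
theorem exists_symmetry (hcomm : HasTrivialRelativeCommutant ι) {ζ : ℝ} (hζ : 0 < ζ)
    (hG : HasAlmostOrthogonalFamilies τ σ E ζ) {x : A} (hx : IsSelfAdjoint x)
    (hx1 : ‖x‖ ≤ 1) (hE : E x = 0) {r : ℝ} (hr : 0 < r) (hxr : 1 - r ^ 2 ≤ τ.tnorm x ^ 2) :
    ∃ u : A, u ∈ unitary A ∧ E u = 0 ∧ τ.tnorm (u - x) ≤ 5 * r := by
  have hτ := h.trace
  set P : ℕ → A → Prop := fun n x => IsSelfAdjoint x ∧ ‖x‖ ≤ 1 ∧ E x = 0 ∧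
    1 - (r * (1 / 2) ^ n) ^ 2 ≤ τ.tnorm x ^ 2 with hP
  have hstep : ∀ n x, P n x → ∃ x', P (n + 1) x' ∧ τ.tnorm (x' - x) ≤ 2 * (r * (1 / 2) ^ n) := by
    rintro n x ⟨h1, h2, h3, h4⟩
    obtain ⟨x', h5, h6, h7, h8, h9⟩ := h.exists_next_almost_symmetry hcomm hζ hG h1 h2 h3
      (by positivity) (r' := r * (1 / 2) ^ (n + 1)) (by positivity) h4
    exact ⟨x', ⟨h5, h6, h7, h8⟩, h9⟩
  choose! f hf hfd using hstep
  set y : ℕ → A := fun n => Nat.rec x (fun n z => f n z) n with hy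
  have hyP : ∀ n, P n (y n) := fun n => by
    induction n with
    | zero => exact ⟨hx, hx1, hE, by simpa [hy] using hxr⟩
    | succ n ih => exact hf n (y n) ih
  have hyd : ∀ n, τ.tnorm (y (n + 1) - y n) ≤ 2 * (r * (1 / 2) ^ n) := fun n => hfd n (y n) (hyP n)
  -- The defect parameter is halved each time, so the displacements are summable with total at most
  -- `4 * r`.
  have hyk : ∀ n k, τ.tnorm (y (n + k) - y n) ≤ 4 * r * (1 / 2) ^ n * (1 - (1 / 2) ^ k) := by
    intro n k
    induction k with
    | zero => simp [tnorm_zero]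
    | succ k ih =>
      have h1 := tnorm_sub_le_add (τ := τ) (y (n + k + 1)) (y (n + k)) (y n)
      have h2 := hyd (n + k)
      rw [pow_add] at h2
      rw [← add_assoc, pow_succ]
      linarith
  have hyk' : ∀ n k, τ.tnorm (y (n + k) - y n) ≤ 4 * r * (1 / 2) ^ n := fun n k =>
    (hyk n k).trans (mul_le_of_le_one_right (by positivity) (sub_le_self _ (by positivity)))
  have hpow : Tendsto (fun n : ℕ => ((1 : ℝ) / 2) ^ n) atTop (𝓝 0) :=
    tendsto_pow_atTop_nhds_zero_of_lt_one (by norm_num) (by norm_num)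
  obtain ⟨u, hu1, hu⟩ := hτ.exists_limit_of_cauchy (fun n => (hyP n).2.1) fun ε hε => by
    have h1 := hpow.const_mul (8 * r)
    rw [mul_zero] at h1
    obtain ⟨n₀, h₀⟩ := (h1.eventually_le_const hε).exists
    refine ⟨n₀, fun m hm n hn => ?_⟩
    obtain ⟨k, rfl⟩ := Nat.exists_eq_add_of_le hm
    obtain ⟨l, rfl⟩ := Nat.exists_eq_add_of_le hn
    have h2 := tnorm_sub_le_add (τ := τ) (y (n₀ + k)) (y n₀) (y (n₀ + l))
    rw [tnorm_sub_comm (y n₀)] at h2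
    linarith [hyk' n₀ k, hyk' n₀ l]
  have hus : star u = u := by
    rw [← sub_eq_zero]
    refine hτ.eq_zero_of_tnorm (le_antisymm ?_ (tnorm_nonneg _))
    refine ge_of_tendsto' (by simpa using hu.const_mul 2) fun n => ?_
    have h1 := tnorm_sub_le_add (τ := τ) (star u) (star (y n)) u
    rw [← star_sub, hτ.tnorm_star, tnorm_sub_comm u, (hyP n).1.star_eq] at h1
    linarith
  have huE : E u = 0 := by
    refine h.trace_sub.eq_zero_of_tnorm (le_antisymm ?_ (tnorm_nonneg _))
    refine ge_of_tendsto' hu fun n => ?_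
    have h1 := h.tnorm_le (u - y n)
    rwa [map_sub, (hyP n).2.2.1, sub_zero, tnorm_sub_comm] at h1
  have hut : τ.tnorm u = 1 := by
    refine le_antisymm ((hτ.tnorm_le_norm u).trans hu1) ?_
    have h1 := (((hpow.const_mul r).pow 2).add hu).const_add (τ.tnorm u)
    simp only [mul_zero, ne_eq, OfNat.ofNat_ne_zero, not_false_eq_true, zero_pow, add_zero] at h1
    refine ge_of_tendsto' h1 fun n => ?_
    have h2 := tnorm_le_add_sub (τ := τ) (y n) u
    have h3 := (hτ.tnorm_le_norm _).trans (hyP n).2.1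
    have h4 := (hyP n).2.2.2
    nlinarith [tnorm_nonneg (τ := τ) (y n)]
  -- A self-adjoint contraction of `2`-norm one has a nonnegative defect of trace zero.
  have huu : u * u = 1 := by
    have h1 : τ (1 - u * u) = 0 := by
      have h2 := tnorm_sq (τ := τ) u
      rw [hut, hus] at h2
      rw [map_sub, hτ.map_one, ← h2]
      norm_num
    exact (sub_eq_zero.mp (hτ.eq_zero_of_nonneg (one_sub_sq_nonneg hus hu1) h1)).symm
  refine ⟨u, Unitary.mem_iff.mpr ⟨by rw [hus, huu], by rw [hus, huu]⟩, huE, ?_⟩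
  refine ge_of_tendsto' (by simpa using hu.const_add (5 * r)) fun n => ?_
  have h1 := tnorm_sub_le_add (τ := τ) u (y n) x
  have h2 := hyk' 0 n
  rw [zero_add, pow_zero, mul_one] at h2
  have h3 : τ.tnorm (y n - x) ≤ 4 * r := h2
  rw [tnorm_sub_comm u (y n)] at h1
  linarith

end IsCondExp

/-- Under fullness, a gamma sequence gives almost central unitaries of vanishing conditional
expectation. -/
theorem IsGammaSequence.exists_unitary (h : IsCondExp τ σ ι E)
    (hcomm : HasTrivialRelativeCommutant ι) (hgap : HasSpectralGap σ) {x : ℕ → A}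
    (hx : IsGammaSequence τ ι E x) (F : Finset B) {ε : ℝ} (hε : 0 < ε) :
    ∃ u ∈ unitary A, E u = 0 ∧ ∀ y ∈ F, τ.tnorm (ι y * u - u * ι y) ≤ ε := by
  classical
  have hτ := h.trace
  obtain ⟨ζ, hζ, hG⟩ := hx.exists_hasAlmostOrthogonalFamilies h hcomm hgap
  obtain ⟨C, hC0, hC⟩ : ∃ C : ℝ, 0 < C ∧ ∀ y ∈ F, ‖ι y‖ ≤ C :=
    ⟨∑ y ∈ F, ‖ι y‖ + 1, by positivity, fun y hy =>
      (Finset.single_le_sum (f := fun y => ‖ι y‖) (fun _ _ => norm_nonneg _) hy).trans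
        (by linarith)⟩
  -- The symmetry will lie within `6 * r` of the almost central element, changing a commutator by at
  -- most `12 * r * C ≤ ε / 2`.
  obtain ⟨r, hr, hr1, hrε⟩ : ∃ r : ℝ, 0 < r ∧ r ≤ 1 ∧ r ≤ ε / (24 * C) :=
    ⟨min 1 (ε / (24 * C)), by positivity, min_le_left _ _, min_le_right _ _⟩
  rw [le_div_iff₀ (by positivity)] at hrε
  set s := r ^ 2 / 16 with hs
  have hs0 : 0 < s := by positivity
  obtain ⟨F', ε', hε', hF'⟩ := hgap (s ^ 2 / 2) (by positivity)
  obtain ⟨w, hw, hw1, hwF, hwτ, hwr⟩ := hx.exists_almost_central h hcomm (F ∪ F')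
    (δ := min (ε / 2) (min ε' (s ^ 2 / 2))) (κ := r ^ 2 / 2) (by positivity) (by positivity)
  have hwE := h.tnorm_condExp_le_of_gap hF' hw1 fun y hy =>
    (hwF y (Finset.mem_union_right _ hy)).trans ((min_le_right _ _).trans (min_le_left _ _))
  have hwτ' := hwτ.trans ((min_le_right _ _).trans (min_le_right _ _))
  obtain ⟨x', hx', hx'1, hx'E, hx'w⟩ := h.exists_condExp_eq_zero hw hw1 hs0 (by linarith)
  have hx'r : 1 - r ^ 2 ≤ τ.tnorm x' ^ 2 := by
    have h1 := tnorm_le_add_sub (τ := τ) w x'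
    rw [tnorm_sub_comm] at h1
    have hwt := (hτ.tnorm_le_norm w).trans hw1
    have hx't := (hτ.tnorm_le_norm x').trans hx'1
    nlinarith [tnorm_nonneg (τ := τ) w, tnorm_nonneg (τ := τ) x']
  obtain ⟨u, hu, huE, hux⟩ := h.exists_symmetry hcomm hζ hG hx' hx'1 hx'E hr hx'r
  refine ⟨u, hu, huE, fun y hy => ?_⟩
  have h1 : τ.tnorm (u - w) ≤ 6 * r := by
    have := tnorm_sub_le_add (τ := τ) u x' w
    nlinarith
  have h2 : ι y * u - u * ι y = (ι y * w - w * ι y) + (ι y * (u - w) - (u - w) * ι y) := by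
    noncomm_ring
  have h3 := tnorm_add_le (τ := τ) (ι y * w - w * ι y) (ι y * (u - w) - (u - w) * ι y)
  have h4 := tnorm_sub_le (τ := τ) (ι y * (u - w)) ((u - w) * ι y)
  have h5 : τ.tnorm (ι y * (u - w)) ≤ C * (6 * r) :=
    (tnorm_mul_le _ _).trans (mul_le_mul (hC y hy) h1 (tnorm_nonneg _) hC0.le)
  have h6 : τ.tnorm ((u - w) * ι y) ≤ 6 * r * C :=
    (hτ.tnorm_mul_le' _ _).trans (mul_le_mul h1 (hC y hy) (norm_nonneg _) (by positivity))
  have h7 := (hwF y (Finset.mem_union_left _ hy)).trans (min_le_left _ _)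
  rw [h2]
  linarith

end Symmetry

end PositiveLinearMap

/-! ### Von Neumann algebras with a trace -/

section WeakLimit

variable {H : Type*} [NormedAddCommGroup H] [InnerProductSpace ℂ H] [CompleteSpace H]

/-- Bounded sequences of operators have weak limits along ultrafilters. -/
theorem ContinuousLinearMap.exists_tendsto_inner (U : Ultrafilter ℕ) (x : ℕ → H →L[ℂ] H) {C : ℝ}
    (hC : ∀ n, ‖x n‖ ≤ C) :
    ∃ T : H →L[ℂ] H, ‖T‖ ≤ C ∧
      ∀ v w, Tendsto (fun n => (inner ℂ (x n v) w : ℂ)) U (𝓝 (inner ℂ (T v) w)) := by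
  have hC0 : 0 ≤ C := (norm_nonneg _).trans (hC 0)
  have hbd : ∀ (n : ℕ) v w, ‖(inner ℂ (x n v) w : ℂ)‖ ≤ C * ‖v‖ * ‖w‖ := fun n v w =>
    (norm_inner_le_norm _ _).trans (mul_le_mul_of_nonneg_right ((x n).le_of_opNorm_le (hC n) v)
      (norm_nonneg _))
  have hlim : ∀ v w, ∃ z : ℂ, ‖z‖ ≤ C * ‖v‖ * ‖w‖ ∧
      Tendsto (fun n => (inner ℂ (x n v) w : ℂ)) U (𝓝 z) := fun v w => by
    obtain ⟨z, hz, hlim⟩ := (isCompact_closedBall (0 : ℂ) (C * ‖v‖ * ‖w‖)).ultrafilter_le_nhds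
      (U.map fun n => (inner ℂ (x n v) w : ℂ)) (by
        rw [le_principal_iff, Ultrafilter.coe_map, mem_map]
        exact Eventually.of_forall fun n => by simpa using hbd n v w)
    exact ⟨z, by simpa using hz, hlim⟩
  choose f hf hlim using hlim
  let b : H →ₗ⋆[ℂ] H →ₗ[ℂ] ℂ := LinearMap.mk₂'ₛₗ (starRingEnd ℂ) (RingHom.id ℂ) f
    (fun v₁ v₂ w => tendsto_nhds_unique (hlim (v₁ + v₂) w) (by
      simpa [inner_add_left] using (hlim v₁ w).add (hlim v₂ w)))
    (fun c v w => tendsto_nhds_unique (hlim (c • v) w) (by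
      simpa [inner_smul_left, mul_comm] using (hlim v w).const_mul (starRingEnd ℂ c)))
    (fun v w₁ w₂ => tendsto_nhds_unique (hlim v (w₁ + w₂)) (by
      simpa [inner_add_right] using (hlim v w₁).add (hlim v w₂)))
    (fun c v w => tendsto_nhds_unique (hlim v (c • w)) (by
      simpa [inner_smul_right] using (hlim v w).const_mul c))
  let B : H →L⋆[ℂ] H →L[ℂ] ℂ := b.mkContinuous₂ C hf
  have hB : ∀ v w, inner ℂ (InnerProductSpace.continuousLinearMapOfBilin B v) w = f v w :=
    fun v w => InnerProductSpace.continuousLinearMapOfBilin_apply B v w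
  refine ⟨InnerProductSpace.continuousLinearMapOfBilin B, ?_, fun v w => ?_⟩
  · refine ContinuousLinearMap.opNorm_le_bound _ hC0 fun v => ?_
    set y := InnerProductSpace.continuousLinearMapOfBilin B v
    have h1 := hf v y
    rw [← hB v y, inner_self_eq_norm_sq_to_K, norm_pow, RCLike.norm_ofReal, abs_norm] at h1
    by_contra! hcon
    nlinarith [norm_nonneg y, mul_nonneg hC0 (norm_nonneg v)]
  · rw [hB]; exact hlim v w

end WeakLimit

namespace VonNeumannAlgebra

section Trace

variable {H : Type*} [NormedAddCommGroup H] [InnerProductSpace ℂ H] [CompleteSpace H]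

theorem isClosed_coe (M : VonNeumannAlgebra H) : IsClosed (M : Set (H →L[ℂ] H)) := by
  rw [← M.centralizer_centralizer]
  exact Set.isClosed_centralizer _

attribute [local instance] isClosed_coe

/-- The order of a von Neumann algebra, as a C*-algebra. -/
noncomputable local instance instPartialOrderCoe (M : VonNeumannAlgebra H) : PartialOrder M :=
  CStarAlgebra.spectralOrder M

local instance instStarOrderedRingCoe (M : VonNeumannAlgebra H) : StarOrderedRing M :=
  CStarAlgebra.spectralOrderedRing M

/-- A weak limit still commutes with the commutant, so it belongs to `M` by the bicommutant
property. -/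
theorem exists_tendsto_inner (M : VonNeumannAlgebra H) (U : Ultrafilter ℕ) (x : ℕ → M) {C : ℝ}
    (hC : ∀ n, ‖x n‖ ≤ C) : ∃ a : M, ‖a‖ ≤ C ∧ ∀ v w,
      Tendsto (fun n => (inner ℂ v ((x n : H →L[ℂ] H) w) : ℂ)) U
        (𝓝 (inner ℂ v ((a : H →L[ℂ] H) w))) := by
  obtain ⟨T, hT, hlim⟩ := ContinuousLinearMap.exists_tendsto_inner U
    (fun n => (x n : H →L[ℂ] H)) hC
  have hTM : T ∈ M := by
    rw [← M.commutant_commutant, mem_commutant_iff]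
    intro g hg
    rw [mem_commutant_iff] at hg
    ext v
    refine ext_inner_right ℂ fun w => ?_
    have h1 := hlim (g v) w
    have h2 := hlim v (ContinuousLinearMap.adjoint g w)
    rw [ContinuousLinearMap.adjoint_inner_right] at h2
    refine tendsto_nhds_unique h2 (h1.congr fun n => ?_)
    rw [ContinuousLinearMap.adjoint_inner_right]
    have h3 := hg (x n) (x n).2
    have h4 := congrArg (fun S : H →L[ℂ] H => (inner ℂ (S v) w : ℂ)) h3
    exact h4
  refine ⟨⟨T, hTM⟩, hT, fun v w => ?_⟩
  have h1 := (hlim w v).star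
  simpa [← starRingEnd_apply, inner_conj_symm] using h1

variable {M : VonNeumannAlgebra H} {τ : M →ₗ[ℂ] ℂ}

/-- Dominated convergence in the series that defines a normal functional. -/
theorem IsNormal.tendsto {τ : M →ₗ[ℂ] ℂ} (hτ : IsNormal τ) {f : Filter ℕ} {x : ℕ → M}
    {a : M} {C : ℝ}
    (hC : ∀ n, ‖x n‖ ≤ C) (hx : ∀ v w, Tendsto (fun n => (inner ℂ v ((x n : H →L[ℂ] H) w) : ℂ)) f
      (𝓝 (inner ℂ v ((a : H →L[ℂ] H) w)))) : Tendsto (fun n => τ (x n)) f (𝓝 (τ a)) := by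
  obtain ⟨ξ, η, hξ, hη, hsum⟩ := hτ
  simp_rw [← fun y => (hsum y).tsum_eq]
  have hC0 : 0 ≤ C := (norm_nonneg _).trans (hC 0)
  refine tendsto_tsum_of_dominated_convergence (bound := fun k => C * (‖ξ k‖ ^ 2 + ‖η k‖ ^ 2))
    ((hξ.add hη).mul_left C) (fun k => hx _ _) (Eventually.of_forall fun n k => ?_)
  have h1 : ‖(x n : H →L[ℂ] H) (η k)‖ ≤ C * ‖η k‖ := (x n : H →L[ℂ] H).le_of_opNorm_le (hC n) _
  refine (norm_inner_le_norm _ _).trans ?_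
  have h2 := mul_le_mul_of_nonneg_left h1 (norm_nonneg (ξ k))
  have h3 : ‖ξ k‖ * ‖η k‖ ≤ ‖ξ k‖ ^ 2 + ‖η k‖ ^ 2 := by
    nlinarith [sq_nonneg (‖ξ k‖ - ‖η k‖), sq_nonneg (‖ξ k‖), sq_nonneg (‖η k‖)]
  have h4 := mul_le_mul_of_nonneg_left h3 hC0
  linarith

/-- A trace as a positive functional. -/
noncomputable def IsTrace.toPositive (hτ : IsTrace τ) : M →ₚ[ℂ] ℂ :=
  PositiveLinearMap.mk₀ τ fun x hx => by
    obtain ⟨y, rfl⟩ := CStarAlgebra.nonneg_iff_eq_star_mul_self.mp hx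
    exact hτ.nonneg y

theorem IsTrace.tnorm_eq (hτ : IsTrace τ) (x : M) : hτ.toPositive.tnorm x = twoNorm τ x :=
  PositiveLinearMap.tnorm_eq_sqrt x

theorem IsTrace.isNormalTrace (hτ : IsTrace τ) : hτ.toPositive.IsNormalTrace where
  map_one := hτ.map_one
  tracial := hτ.tracial
  faithful := hτ.faithful
  exists_weak_limit U x C hC := by
    obtain ⟨a, ha, hlim⟩ := M.exists_tendsto_inner U x hC
    refine ⟨a, ha, fun c => ?_⟩
    refine hτ.normal.tendsto (C := ‖c‖ * C) (fun n => (norm_mul_le _ _).trans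
      (mul_le_mul_of_nonneg_left (hC n) (norm_nonneg _))) fun v w => ?_
    have h1 := hlim (ContinuousLinearMap.adjoint (c : H →L[ℂ] H) v) w
    simpa [ContinuousLinearMap.adjoint_inner_left] using h1

variable {N : VonNeumannAlgebra H} (hNM : N ≤ M)

theorem IsTrace.comp_incl (hτ : IsTrace τ) : IsTrace (τ ∘ₗ incl hNM) where
  map_one := hτ.map_one
  nonneg x := hτ.nonneg (incl hNM x)
  tracial x y := hτ.tracial (incl hNM x) (incl hNM y)
  faithful x hx := Subtype.ext
    (congrArg (fun w : M => (w : H →L[ℂ] H)) (hτ.faithful (incl hNM x) hx))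
  normal := by
    obtain ⟨ξ, η, hξ, hη, h⟩ := hτ.normal
    exact ⟨ξ, η, hξ, hη, fun x => h (incl hNM x)⟩

/-- The inclusion as a homomorphism of *-algebras. -/
noncomputable def inclStarAlgHom : N →⋆ₐ[ℂ] M where
  toFun := incl hNM
  map_one' := rfl
  map_mul' _ _ := rfl
  map_zero' := rfl
  map_add' _ _ := rfl
  commutes' _ := rfl
  map_star' _ := rfl

theorem IsTrace.exists_isCondExp (hτ : IsTrace τ) : ∃ E : M →ₗ[ℂ] N,
    PositiveLinearMap.IsCondExp hτ.toPositive (hτ.comp_incl hNM).toPositive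
      (inclStarAlgHom hNM) E ∧ ∀ x, condExp hNM τ x = E x := by
  obtain ⟨E, hE⟩ := PositiveLinearMap.exists_isCondExp (ι := inclStarAlgHom hNM) hτ.isNormalTrace
    (hτ.comp_incl hNM).isNormalTrace fun _ => rfl
  exact ⟨E, hE, fun x => condExp_eq hNM hτ fun y => hE.apply_mul x y⟩

theorem hasTrivialRelativeCommutant (hN : N.IsFactor) (hirr : IsIrreducibleIn hNM) :
    PositiveLinearMap.HasTrivialRelativeCommutant (inclStarAlgHom hNM) := by
  intro x hx
  obtain ⟨z, rfl⟩ := hirr x hx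
  obtain ⟨c, rfl⟩ := hN z fun y => Subtype.ext (congrArg (fun w : M => (w : H →L[ℂ] H)) (hx y).symm)
  exact ⟨c, rfl⟩

end Trace

end VonNeumannAlgebra

/-! ### Separability in the `2`-norm -/

namespace PositiveLinearMap

section Separable

set_option linter.unusedSectionVars false

variable {A : Type*} [CStarAlgebra A] [PartialOrder A] [StarOrderedRing A] {τ : A →ₚ[ℂ] ℂ}
  {B : Type*} [CStarAlgebra B] [PartialOrder B] [StarOrderedRing B] {σ : B →ₚ[ℂ] ℂ}
  {ι : B →⋆ₐ[ℂ] A} {E : A →ₗ[ℂ] B}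

/-- A sequence that is dense in the unit ball for the `2`-norm. -/
def IsDenseInBall (σ : B →ₚ[ℂ] ℂ) (d : ℕ → B) : Prop :=
  ∀ y : B, ‖y‖ ≤ 1 → ∀ ε > 0, ∃ k, σ.tnorm (y - d k) ≤ ε

/-- Operator norm bounds on `x n` make the commutator `2`-norm continuous in `y`, uniformly in `n`;
homogeneity removes the restriction to the unit ball. -/
theorem AsympCentral.of_isDenseInBall (hτ : τ.IsNormalTrace) (hι : ∀ y, τ (ι y) = σ y) {d : ℕ → B}
    (hd : IsDenseInBall σ d) {f : Filter ℕ} {x : ℕ → A} (hx : ∀ n, ‖x n‖ ≤ 1)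
    (h : ∀ k, Tendsto (fun n => τ.tnorm (ι (d k) * x n - x n * ι (d k))) f (𝓝 0)) :
    AsympCentral τ ι f x := by
  have hball : ∀ y : B, ‖y‖ ≤ 1 → Tendsto (fun n => τ.tnorm (ι y * x n - x n * ι y)) f (𝓝 0) := by
    intro y hy
    rw [Metric.tendsto_nhds]
    intro ε hε
    obtain ⟨k, hk⟩ := hd y hy (ε / 4) (by positivity)
    rw [← tnorm_map hι, map_sub] at hk
    filter_upwards [(h k).eventually_lt_const (show 0 < ε / 2 by positivity)] with n hn
    rw [Real.dist_eq, sub_zero, abs_of_nonneg (tnorm_nonneg _)]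
    have h1 : ι y * x n - x n * ι y = (ι (d k) * x n - x n * ι (d k)) +
        ((ι y - ι (d k)) * x n - x n * (ι y - ι (d k))) := by noncomm_ring
    have h2 := tnorm_add_le (τ := τ) (ι (d k) * x n - x n * ι (d k))
      ((ι y - ι (d k)) * x n - x n * (ι y - ι (d k)))
    have h3 := tnorm_sub_le (τ := τ) ((ι y - ι (d k)) * x n) (x n * (ι y - ι (d k)))
    have h4 := (hτ.tnorm_mul_le' (ι y - ι (d k)) (x n)).trans
      (mul_le_of_le_one_right (tnorm_nonneg _) (hx n))
    have h5 := (tnorm_mul_le (τ := τ) (x n) (ι y - ι (d k))).trans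
      (mul_le_of_le_one_left (tnorm_nonneg _) (hx n))
    rw [h1]
    linarith
  intro y
  rcases eq_or_ne y 0 with rfl | hy
  · simpa [tnorm_zero] using tendsto_const_nhds
  have hy0 : 0 < ‖y‖ := norm_pos_iff.mpr hy
  have h1 := (hball ((‖y‖⁻¹ : ℂ) • y) (by
    rw [norm_smul, norm_inv, Complex.norm_real, norm_norm, inv_mul_cancel₀ hy0.ne'])).const_mul ‖y‖
  rw [mul_zero] at h1
  refine h1.congr fun n => ?_
  rw [map_smul, smul_mul_assoc, mul_smul_comm, ← smul_sub, tnorm_smul, norm_inv, Complex.norm_real,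
    norm_norm, mul_inv_cancel_left₀ hy0.ne']

theorem tendsto_one_div_succ_of_le {u : ℕ → ℝ} (k : ℕ) (h0 : ∀ n, 0 ≤ u n)
    (h : ∀ n, k < n + 1 → u n ≤ 1 / ((n : ℝ) + 1)) : Tendsto u atTop (𝓝 0) := by
  refine squeeze_zero' (Eventually.of_forall h0) ?_ tendsto_one_div_add_atTop_nhds_zero_nat
  filter_upwards [eventually_ge_atTop k] with n hn using h n (by omega)

/-- Fullness, formulated by central sequences, gives its finitary form. -/
theorem hasSpectralGap_of_full (hσ : σ.IsNormalTrace) {d : ℕ → B} (hd : IsDenseInBall σ d)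
    {ω : Ultrafilter ℕ} (hω : (ω : Filter ℕ) ≤ atTop)
    (hfull : ∀ x : ℕ → B, (∀ n, ‖x n‖ ≤ 1) → AsympCentral σ (StarAlgHom.id ℂ B) ω x →
      ∃ c : ℂ, Tendsto (fun n => σ.tnorm (x n - c • 1)) ω (𝓝 0)) : HasSpectralGap σ := by
  classical
  by_contra hcon
  simp only [HasSpectralGap] at hcon
  push Not at hcon
  obtain ⟨δ, hδ, hcon⟩ := hcon
  -- Counterexamples for growing finite sets form a central sequence that stays at distance more
  -- than `δ` from its own trace.
  choose a ha1 haF haδ using fun n : ℕ =>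
    hcon ((Finset.range (n + 1)).image d) (1 / ((n : ℝ) + 1)) (by positivity)
  have hcent : AsympCentral σ (StarAlgHom.id ℂ B) ω a := by
    refine AsympCentral.of_isDenseInBall (σ := σ) hσ (fun _ => rfl) hd ha1 fun k => ?_
    refine (tendsto_one_div_succ_of_le k (fun n => tnorm_nonneg _) fun n hn => ?_).mono_left hω
    exact haF n (d k) (Finset.mem_image_of_mem _ (Finset.mem_range.mpr hn))
  obtain ⟨c, hc⟩ := hfull a ha1 hcent
  obtain ⟨n, hn⟩ := (hc.eventually_lt_const (half_pos hδ)).exists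
  have h1 := tnorm_sub_le_add (τ := σ) (a n) (c • 1) (σ (a n) • 1)
  have h2 := hσ.norm_apply_le_tnorm (a n - c • 1)
  rw [map_sub, map_smul, hσ.map_one, smul_eq_mul, mul_one] at h2
  rw [← sub_smul, tnorm_smul, hσ.tnorm_one, mul_one, norm_sub_rev c] at h1
  linarith [haδ n]

/-- Almost central unitaries of vanishing conditional expectation form a gamma sequence. -/
theorem IsCondExp.exists_isGammaSequence (h : IsCondExp τ σ ι E) {d : ℕ → B}
    (hd : IsDenseInBall σ d) (hu : ∀ (m : ℕ) (y : Fin m → B) (ε : ℝ), 0 < ε → ∃ u ∈ unitary A,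
      E u = 0 ∧ ∀ j, τ.tnorm (ι (y j) * u - u * ι (y j)) ≤ ε) :
    ∃ x : ℕ → A, IsGammaSequence τ ι E x := by
  have hτ := h.trace
  have := hτ.nontrivial
  choose u huu huE huc using fun n : ℕ =>
    hu (n + 1) (fun j => d j) (1 / ((n : ℝ) + 1)) (by positivity)
  have hu1 : ∀ n, ‖u n‖ ≤ 1 := fun n => (CStarRing.norm_of_mem_unitary (huu n)).le
  refine ⟨u, ⟨1, hu1⟩, fun n => ?_, huE, ?_⟩
  · rw [tnorm_eq_sqrt, Unitary.star_mul_self_of_mem (huu n), hτ.map_one]; simp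
  · exact AsympCentral.of_isDenseInBall hτ h.apply_map hd hu1 fun k =>
      tendsto_one_div_succ_of_le k (fun n => tnorm_nonneg _) fun n hn => huc n ⟨k, hn⟩

end Separable

end PositiveLinearMap

/-! ### From separability of the predual to separability of the unit ball in `2`-norm -/

namespace VonNeumannAlgebra

section Predual

variable {H : Type*} [NormedAddCommGroup H] [InnerProductSpace ℂ H] [CompleteSpace H]
  {M N : VonNeumannAlgebra H} {τ : M →ₗ[ℂ] ℂ} (hNM : N ≤ M)

attribute [local instance] isClosed_coe instPartialOrderCoe instStarOrderedRingCoe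

/-- The functional `y ↦ τ(x y)`. -/
noncomputable def IsTrace.mulLeft (hτ : IsTrace τ) (x : M) : StrongDual ℂ M :=
  LinearMap.mkContinuous
    { toFun := fun y => τ (x * y)
      map_add' := fun y z => by rw [mul_add, map_add]
      map_smul' := fun c y => by rw [mul_smul_comm, map_smul]; rfl } ‖x‖
    fun y => (hτ.isNormalTrace.norm_apply_le (x * y)).trans (norm_mul_le x y)

theorem IsTrace.mulLeft_apply (hτ : IsTrace τ) (x y : M) : hτ.mulLeft x y = τ (x * y) := rfl

theorem IsTrace.mulLeft_mem_predual (hτ : IsTrace τ) (x : M) : hτ.mulLeft x ∈ M.predual := by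
  obtain ⟨ξ, η, hξ, hη, h⟩ := hτ.normal
  refine ⟨fun n => ContinuousLinearMap.adjoint (x : H →L[ℂ] H) (ξ n), η, ?_, hη, fun y => ?_⟩
  · refine Summable.of_nonneg_of_le (fun n => sq_nonneg _) (fun n => ?_)
      (hξ.mul_left (‖ContinuousLinearMap.adjoint (x : H →L[ℂ] H)‖ ^ 2))
    rw [← mul_pow]
    exact pow_le_pow_left₀ (norm_nonneg _) (ContinuousLinearMap.le_opNorm _ _) 2
  · have h1 := h (x * y)
    simp only [ContinuousLinearMap.adjoint_inner_left]
    exact h1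

/-- The unit ball of `N` embeds in the predual by `y ↦ τ (y ·)`, and subsets of a separable metric
space have countable dense subsets. Evaluating a difference of such functionals at `star (y - d k)`
recovers the squared `2`-norm distance. -/
theorem IsTrace.exists_isDenseInBall (hτ : IsTrace τ) (hsep : M.HasSeparablePredual) :
    ∃ d : ℕ → N, PositiveLinearMap.IsDenseInBall (hτ.comp_incl hNM).toPositive d := by
  set S : Set (StrongDual ℂ M) := (fun x : N => hτ.mulLeft (incl hNM x)) '' {x | ‖x‖ ≤ 1} with hS
  have hSsep : TopologicalSpace.IsSeparable S := hsep.mono (by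
    rintro _ ⟨x, -, rfl⟩
    exact hτ.mulLeft_mem_predual _)
  obtain ⟨t, htS, htc, htd⟩ := hSsep.exists_countable_dense_subset
  have hne : t.Nonempty := by
    have h1 : hτ.mulLeft (incl hNM 0) ∈ closure t := htd ⟨0, by simp, rfl⟩
    exact closure_nonempty_iff.mp ⟨_, h1⟩
  obtain ⟨e, rfl⟩ := htc.exists_eq_range hne
  choose d hd hde using fun n => htS (Set.mem_range_self n)
  refine ⟨d, fun y hy ε hε => ?_⟩
  have h1 : hτ.mulLeft (incl hNM y) ∈ closure (Set.range e) := htd ⟨y, hy, rfl⟩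
  obtain ⟨_, ⟨k, rfl⟩, hk⟩ := Metric.mem_closure_iff.mp h1 (ε ^ 2 / 2) (by positivity)
  refine ⟨k, ?_⟩
  rw [dist_eq_norm, ← hde k] at hk
  set w := y - d k with hw
  have hw2 : ‖w‖ ≤ 2 := (norm_sub_le _ _).trans (by
    have h0 : ‖d k‖ ≤ 1 := hd k
    linarith)
  have h2 := (hτ.mulLeft (incl hNM y) - hτ.mulLeft (incl hNM (d k))).le_opNorm (incl hNM (star w))
  have h3 : (hτ.mulLeft (incl hNM y) - hτ.mulLeft (incl hNM (d k))) (incl hNM (star w)) =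
      (τ ∘ₗ incl hNM) (w * star w) := by
    rw [sub_apply, hτ.mulLeft_apply, hτ.mulLeft_apply, ← map_sub, ← sub_mul,
      ← map_sub]
    rfl
  have h4 := PositiveLinearMap.tnorm_sq (τ := (hτ.comp_incl hNM).toPositive) w
  have h5 : (τ ∘ₗ incl hNM) (w * star w) = (hτ.comp_incl hNM).toPositive (star w * w) :=
    (hτ.comp_incl hNM).tracial w (star w)
  rw [h3, h5, ← h4, Complex.norm_real, Real.norm_of_nonneg (sq_nonneg _)] at h2
  have h6 : ‖incl hNM (star w)‖ ≤ 2 := (norm_star w).le.trans hw2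
  refine (abs_le_of_sq_le_sq' ?_ hε.le).2
  have h7 := mul_le_mul hk.le h6 (norm_nonneg _) (by positivity)
  refine h2.trans (h7.trans (le_of_eq (by ring)))

end Predual

end VonNeumannAlgebra

/-! ### Transfer to von Neumann algebras and the equivalence -/

namespace VonNeumannAlgebra

section RelativeGamma

variable {H : Type*} [NormedAddCommGroup H] [InnerProductSpace ℂ H] [CompleteSpace H]
  {M N : VonNeumannAlgebra H} {τ : M →ₗ[ℂ] ℂ} (hNM : N ≤ M)

attribute [local instance] isClosed_coe instPartialOrderCoe instStarOrderedRingCoe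

theorem IsTrace.hasSpectralGap (hτ : IsTrace τ) (hsep : M.HasSeparablePredual) {ω : Ultrafilter ℕ}
    (hω : (ω : Filter ℕ) ≤ cofinite) (hfull : IsFull (τ ∘ₗ incl hNM) ω) :
    PositiveLinearMap.HasSpectralGap (hτ.comp_incl hNM).toPositive := by
  obtain ⟨d, hd⟩ := hτ.exists_isDenseInBall hNM hsep
  rw [Nat.cofinite_eq_atTop] at hω
  refine PositiveLinearMap.hasSpectralGap_of_full (hτ.comp_incl hNM).isNormalTrace hd hω
    fun x hx hc => ?_
  obtain ⟨c, hc⟩ := hfull x ⟨1, hx⟩ fun y =>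
    (hc y).congr fun n => (hτ.comp_incl hNM).tnorm_eq _
  exact ⟨c, hc.congr fun n => ((hτ.comp_incl hNM).tnorm_eq _).symm⟩

/-- Relative property gamma gives almost central unitaries of vanishing conditional expectation. -/
theorem HasRelativeGamma.exists_unitary (hsep : M.HasSeparablePredual) (hτ : IsTrace τ)
    (hN : N.IsFactor) (hirr : IsIrreducibleIn hNM) {ω : Ultrafilter ℕ}
    (hω : (ω : Filter ℕ) ≤ cofinite) (hfull : IsFull (τ ∘ₗ incl hNM) ω)
    (hγ : HasRelativeGamma hNM τ) (F : Finset N) {ε : ℝ} (hε : 0 < ε) :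
    ∃ u : M, (star u * u = 1 ∧ u * star u = 1) ∧ condExp hNM τ u = 0 ∧
      ∀ y ∈ F, twoNorm τ (incl hNM y * u - u * incl hNM y) ≤ ε := by
  obtain ⟨E, hE, hEc⟩ := hτ.exists_isCondExp hNM
  obtain ⟨x, hxb, hx1, hx0, hxc⟩ := hγ
  have hx : PositiveLinearMap.IsGammaSequence hτ.toPositive (inclStarAlgHom hNM) E x :=
    ⟨hxb, fun n => (hτ.tnorm_eq _).trans (hx1 n), fun n => (hEc _).symm.trans (hx0 n),
      fun y => (hxc y).congr fun n => (hτ.tnorm_eq _).symm⟩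
  obtain ⟨u, hu, hu0, hu1⟩ := hx.exists_unitary hE (hasTrivialRelativeCommutant hNM hN hirr)
    (hτ.hasSpectralGap hNM hsep hω hfull) F hε
  exact ⟨u, Unitary.mem_iff.mp hu, (hEc u).trans hu0, fun y hy =>
    (hτ.tnorm_eq _).symm.le.trans (hu1 y hy)⟩

/-- Almost central unitaries of vanishing conditional expectation give relative property gamma. -/
theorem IsTrace.hasRelativeGamma (hτ : IsTrace τ) (hsep : M.HasSeparablePredual)
    (hu : ∀ (m : ℕ) (y : Fin m → N) (ε : ℝ), 0 < ε →
      ∃ u : M, (star u * u = 1 ∧ u * star u = 1) ∧ condExp hNM τ u = 0 ∧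
        ∀ j, twoNorm τ (incl hNM (y j) * u - u * incl hNM (y j)) ≤ ε) :
    HasRelativeGamma hNM τ := by
  obtain ⟨E, hE, hEc⟩ := hτ.exists_isCondExp hNM
  obtain ⟨d, hd⟩ := hτ.exists_isDenseInBall hNM hsep
  obtain ⟨x, hx⟩ := hE.exists_isGammaSequence hd fun m y ε hε => by
    obtain ⟨u, huu, hu0, hu1⟩ := hu m y ε hε
    exact ⟨u, Unitary.mem_iff.mpr huu, (hEc u).symm.trans hu0,
      fun j => (hτ.tnorm_eq _).le.trans (hu1 j)⟩
  exact ⟨x, hx.bounded, fun n => (hτ.tnorm_eq _).symm.trans (hx.tnorm_eq_one n),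
    fun n => (hEc _).trans (hx.condExp_eq_zero n),
    fun y => (hx.asympCentral y).congr fun n => hτ.tnorm_eq _⟩

end RelativeGamma

end VonNeumannAlgebra

theorem mainTheorem12 {H : Type*} [NormedAddCommGroup H] [InnerProductSpace ℂ H] [CompleteSpace H]
    (N M : VonNeumannAlgebra H) (hNM : N ≤ M)
    (hM : M.IsTypeIIOneFactor) (hsep : M.HasSeparablePredual)
    (τ : M →ₗ[ℂ] ℂ) (hτ : VonNeumannAlgebra.IsTrace τ)
    (hN : N.IsFactor) (hirr : VonNeumannAlgebra.IsIrreducibleIn hNM)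
    (ω : Ultrafilter ℕ) (hω : (ω : Filter ℕ) ≤ Filter.cofinite)
    (hfull : VonNeumannAlgebra.IsFull (τ ∘ₗ VonNeumannAlgebra.incl hNM) ω) :
    VonNeumannAlgebra.HasRelativeGamma hNM τ ↔
      ∀ (m : ℕ) (y : Fin m → N) (ε : ℝ), 0 < ε →
        ∃ u ∈ unitary M, VonNeumannAlgebra.condExp hNM τ u = 0 ∧
          ∀ j, VonNeumannAlgebra.twoNorm τ
            (VonNeumannAlgebra.incl hNM (y j) * u - u * VonNeumannAlgebra.incl hNM (y j)) ≤ ε := by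
  classical
  constructor
  · intro hγ m y ε hε
    obtain ⟨u, huu, hu0, hu1⟩ := hγ.exists_unitary hNM hsep hτ hN hirr hω hfull
      (Finset.univ.image y) hε
    exact ⟨u, Unitary.mem_iff.mpr huu, hu0, fun j =>
      hu1 _ (Finset.mem_image_of_mem y (Finset.mem_univ j))⟩
  · intro h
    refine hτ.hasRelativeGamma hNM hsep fun m y ε hε => ?_
    obtain ⟨u, huu, hu0, hu1⟩ := h m y ε hε
    exact ⟨u, Unitary.mem_iff.mp huu, hu0, hu1⟩
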